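/- Let $(\mathbf X,Y)$ be a random vector in $\mathbb R^d\times\{1,2\}$, $d\ge 1$, with distribution $P$, let $p_j(\mathbf x)=P(Y=j\mid \mathbf X=\mathbf x)$, and let $g^*(\mathbf x)=2$ if $p_2(\mathbf x)>p_1(\mathbf x)$ and $g^*(\mathbf x)=1$ otherwise be the Bayes classifier. Let $(\mathbf X_1,Y_1),(\mathbf X_2,Y_2),\dots$ be independent copies of $(\mathbf X,Y)$. Let $K:\mathbb R^d\to[0,\infty[$ be a continuous regular kernel, that is, $K$ is continuous and there are a closed ball $S$ about $0$ of positive radius and a constant $b>0$ such that $K\ge b$ on $S$ and $\int \sup_{\mathbf y\in \mathbf x+S}K(\mathbf y)\,d\mathbf x<\infty$. Let $h_n>0$, $h_n\to0$ and $n h_n^d\to\infty$. From the first $n$ observations, the potential of $\mathbf x$ with respect to class $j$ is estimated by $$\hat\phi_{j}(\mathbf x)=\frac1{n h_n^d}\sum_{i\le n,\;Y_i=j}K\Bigl(\frac{\mathbf x-\mathbf X_i}{h_n}\Bigr),\qquad j=1,2 ,$$ and $\mathbf x$ is mapped to the point $(z_1,z_2)=(\hat\phi_{1}(\mathbf x),\hat\phi_{2}(\mathbf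 x))$. The pot-pot plot consists of the images of all $n$ observations, with their class labels. The $\alpha$-procedure of given degree $p\ge1$ separates the plot as follows. Its features are the monomials $z_1^az_2^b$ with $1\le a+b\le p$. In its first step, for each pair $(u,v)$ of distinct features, it determines an oriented line $\{\cos(\alpha)\,u+\sin(\alpha)\,v=c\}$ that minimises the empirical risk, that is, the portion of misclassified points of the plot (points with $\cos(\alpha)\,u+\sin(\alpha)\,v>c$ are assigned to class 2, all others to class 1), and it keeps a pair with the smallest minimum. In each further step it does the same for the pairs that consist of the last composed feature $\cos(\alpha)\,u+\sin(\alpha)\,v$ and a feature not used so far, provided that this lowers the empirical risk. Either only lines through the origin ($c=0$) or all lines are admitted; ties between minimisers are broken arbitrarily; and the procedure may be stopped after any step, in particular when no further step lowers the empirical risk. The pot-pot classifier $g_n$ assigns $\mathbf x$ to the class to which the final separation assigns $(\hat\phi_{1}(\mathbf x),\hat\phi_{2}(\mathbf x))$. **Theorem ($\alpha$-procedure).** Assume that both classes are continuously distributed, that is, the measures $A\mapsto P(\mathbf X\in A,\,Y=j)$, $j=1,2$, are absolutely continuous with respect to Lebesgue measure, and that $P(p_1(\mathbf X)=p_2(\mathbf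 X))=0$. Then the pot-pot procedure with separation by the $\alpha$-procedure is strongly Bayes-consistent: almost surely, the error probability of $g_n$, given the first $n$ observations, converges to the Bayes risk, $$P\bigl(g_n(\mathbf X)\ne Y\mid (\mathbf X_1,Y_1),\dots,(\mathbf X_n,Y_n)\bigr)\longrightarrow P\bigl(g^*(\mathbf X)\ne Y\bigr)\qquad(n\to\infty).$$ -/

import Mathlib

open MeasureTheory ProbabilityTheory Filter Topology

noncomputable section

/-- The two classes: `0` is class 1 and `1` is class 2. -/
abbrev Label : Type := Fin 2

/-- The space of the attributes, `ℝ^d` with its Euclidean norm. -/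
abbrev Attr (d : ℕ) : Type := EuclideanSpace ℝ (Fin d)

/-! ### Classifiers, posterior probabilities and risk -/

/-- The posterior probability `P(Y = j | X = x)`, where `P` is the law of `(X, Y)`. -/
def classPosterior {d : ℕ} (P : Measure (Attr d × Label)) [IsFiniteMeasure P]
    (j : Label) (x : Attr d) : ℝ :=
  (P.condKernel x).real {j}

/-- The Bayes classifier: class 2 if its posterior probability is strictly larger, and class 1
otherwise. -/
def bayesClassifier {d : ℕ} (P : Measure (Attr d × Label)) [IsFiniteMeasure P]
    (x : Attr d) : Label :=
  if classPosterior P 0 x < classPosterior P 1 x then 1 else 0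

/-- The probability of misclassification `P(g(X) ≠ Y)` of a (fixed) classifier `g`. -/
def errorProb {d : ℕ} (P : Measure (Attr d × Label)) (g : Attr d → Label) : ℝ :=
  P.real {q | g q.1 ≠ q.2}

/-- The Bayes risk. -/
def bayesErrorProb {d : ℕ} (P : Measure (Attr d × Label)) [IsFiniteMeasure P] : ℝ :=
  errorProb P (bayesClassifier P)

/-! ### Potentials -/

/-- A continuous regular kernel: `K` is continuous and nonnegative, and there is a closed ball
`S` about `0`, of positive radius, with `K ≥ b > 0` on `S` and
`∫ sup_{y ∈ x + S} K(y) dx < ∞`. -/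
structure IsContinuousRegularKernel {d : ℕ} (K : Attr d → ℝ) : Prop where
  continuous : Continuous K
  nonneg : ∀ x, 0 ≤ K x
  regular : ∃ r > 0, ∃ b > 0, (∀ x, ‖x‖ ≤ r → b ≤ K x) ∧
    Integrable (fun x => sSup (K '' Metric.closedBall x r)) volume

/-- The estimated potential of the point `x` with respect to class `j`, that is, the estimated
prior `n_j / n` times the kernel density estimate from class `j` with bandwidth matrix `h² I`:
`(1/n) ∑_{i : Y_i = j} h^{-d} K((x - X_i)/h)`. -/
def potential {d n : ℕ} (K : Attr d → ℝ) (h : ℝ) (D : Fin n → Attr d × Label)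
    (j : Label) (x : Attr d) : ℝ :=
  (1 / (n : ℝ)) * ∑ i with (D i).2 = j, (h ^ d)⁻¹ * K (h⁻¹ • (x - (D i).1))

/-- The point of the pot-pot plot that belongs to `x`. -/
def potPot {d n : ℕ} (K : Attr d → ℝ) (h : ℝ) (D : Fin n → Attr d × Label)
    (x : Attr d) : ℝ × ℝ :=
  (potential K h D 0 x, potential K h D 1 x)

/-- The labelled pot-pot plot of all training data. -/
def potPotPlot {d n : ℕ} (K : Attr d → ℝ) (h : ℝ) (D : Fin n → Attr d × Label) :
    Fin n → (ℝ × ℝ) × Label :=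
  fun i => (potPot K h D (D i).1, (D i).2)

/-! ### The α-procedure in the plane -/

/-- The features `z ↦ z₁ ^ a * z₂ ^ b` offered to the procedure of degree `p` are indexed by their
exponents `(a, b)`, with `1 ≤ a + b ≤ p`. -/
def featureIndex (p : ℕ) : Finset (ℕ × ℕ) :=
  (Finset.range (p + 1) ×ˢ Finset.range (p + 1)).filter (fun k => 1 ≤ k.1 + k.2 ∧ k.1 + k.2 ≤ p)

/-- The feature with index `k = (a, b)`. -/
def feature (k : ℕ × ℕ) (z : ℝ × ℝ) : ℝ := z.1 ^ k.1 * z.2 ^ k.2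

/-- The straight lines that the procedure may use in a plane of two features: only those through
the origin, or all of them. -/
inductive LineFamily : Type
  | throughOrigin
  | affine

/-- The oriented line `a u + b v = c`, with unit normal vector `(a, b)`, belongs to the family. -/
def LineFamily.Allows : LineFamily → ℝ → ℝ → ℝ → Prop
  | .throughOrigin, a, b, c => a ^ 2 + b ^ 2 = 1 ∧ c = 0
  | .affine, a, b, _ => a ^ 2 + b ^ 2 = 1

/-- The separation of the plot given by a composed feature `w` and a threshold `c`: class 2 if
`w z > c`, and class 1 otherwise. -/
def thresholdRule (w : ℝ × ℝ → ℝ) (c : ℝ) (z : ℝ × ℝ) : Label :=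
  if c < w z then 1 else 0

/-- The empirical risk on a labelled plot: the portion of misclassified points. -/
def empRisk {n : ℕ} (Z : Fin n → (ℝ × ℝ) × Label) (w : ℝ × ℝ → ℝ) (c : ℝ) : ℝ :=
  (Finset.univ.filter (fun i => thresholdRule w c (Z i).1 ≠ (Z i).2)).card / (n : ℝ)

/-- The composed feature `a u + b v`: the coordinate along the unit normal vector of a line. -/
def combine (a b : ℝ) (u v : ℝ × ℝ → ℝ) : ℝ × ℝ → ℝ := fun z => a * u z + b * v z

/-- `AlphaRun F p Z U w c` says that the α-procedure of degree `p`, working on the labelled plot `Z`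
with lines from `F`, can arrive in one or more steps at the separation `thresholdRule w c`, having
used the features in `U`.

* First step: in the plane of each pair of features take a line of minimal empirical risk, and keep
  a pair for which this minimum is smallest. The coordinate along the normal vector of the line
  becomes the current composed feature.
* Each further step: do the same in the planes that are spanned by the current composed feature and
  one of the features not used so far. The step is made only if it lowers the empirical risk.

Ties are broken arbitrarily. -/
inductive AlphaRun (F : LineFamily) (p : ℕ) {n : ℕ} (Z : Fin n → (ℝ × ℝ) × Label) :
    Finset (ℕ × ℕ) → (ℝ × ℝ → ℝ) → ℝ → Prop
  | first (k l : ℕ × ℕ) (hk : k ∈ featureIndex p) (hl : l ∈ featureIndex p) (hkl : k ≠ l)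
      (a b c : ℝ) (hline : F.Allows a b c)
      (hmin : ∀ k' ∈ featureIndex p, ∀ l' ∈ featureIndex p, k' ≠ l' →
        ∀ a' b' c' : ℝ, F.Allows a' b' c' →
          empRisk Z (combine a b (feature k) (feature l)) c
            ≤ empRisk Z (combine a' b' (feature k') (feature l')) c') :
      AlphaRun F p Z {k, l} (combine a b (feature k) (feature l)) c
  | next (U : Finset (ℕ × ℕ)) (w : ℝ × ℝ → ℝ) (c₀ : ℝ) (hprev : AlphaRun F p Z U w c₀)
      (k : ℕ × ℕ) (hk : k ∈ featureIndex p) (hkU : k ∉ U)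
      (a b c : ℝ) (hline : F.Allows a b c)
      (hmin : ∀ k' ∈ featureIndex p, k' ∉ U →
        ∀ a' b' c' : ℝ, F.Allows a' b' c' →
          empRisk Z (combine a b w (feature k)) c ≤ empRisk Z (combine a' b' w (feature k')) c')
      (hlower : empRisk Z (combine a b w (feature k)) c < empRisk Z w c₀) :
      AlphaRun F p Z (insert k U) (combine a b w (feature k)) c

/-- `g` is a pot-pot classifier trained on `D`, the separation on the pot-pot plot being made by the
α-procedure. No stopping rule is imposed: the procedure may be stopped after its first or any later
step, in particular when no further step lowers the empirical risk. -/
def IsAlphaPotPotClassifier {d n : ℕ} (F : LineFamily) (p : ℕ) (K : Attr d → ℝ) (h : ℝ)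
    (D : Fin n → Attr d × Label) (g : Attr d → Label) : Prop :=
  ∃ (U : Finset (ℕ × ℕ)) (w : ℝ × ℝ → ℝ) (c : ℝ),
    AlphaRun F p (potPotPlot K h D) U w c ∧ ∀ x, g x = thresholdRule w c (potPot K h D x)

end

/-! The theorem rests on three facts. (1) Almost surely, error probability and empirical risk differ
by `o(1)`, uniformly over all rules `c < w z` with `w` a polynomial of degree at most `p` in each
coordinate (`ae_eventually_abs_errorProb_sub_empRisk_le`); every composed feature is of this kind.
(2) The first step could have chosen the diagonal `z₁ = z₂`, and later steps only lower the
empirical risk (`AlphaRun.empRisk_le_diagonal`). (3) The diagonal rule is the plug-in rule of two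
kernel estimates that converge in `L¹` on bounded sets, so its error probability is asymptotically
at most the Bayes risk (`ae_eventually_errorProb_diagonal_le`). Hence error of `g` ≤ its empirical
risk + o(1) ≤ empirical risk of the diagonal + o(1) ≤ error of the diagonal + o(1) ≤ Bayes risk +
o(1).

The difficulty is (1): the plot is built from the very observations on which the rule is evaluated,
so the sets `{x | c < w (φ₁ x, φ₂ x)}` are random and depend on all data. Fix a class, and condition
on the labels and on the sample of the other class. Then the kernel sum `ψ` of the other class is a
fixed function, the own kernel sum `s` comes from `k` i.i.d. points, and the sets are `posSet θ ψ
s`. Take out a block of `m` own points. The sum over the remaining points is independent of the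
block, so Vapnik-Chervonenkis theory applies to the block. Putting the block back raises `s` by at
most `t`, except at few crowded points, and by Thom's lemma this can matter only where the
polynomial or one of its derivatives in `s` has different signs at `s` and `s + t`. Averaging over
all cyclic blocks recovers the whole sample (`measure_block_dev_le`, `measure_hits_posSet_dev_le`).

It remains to show that this unstable set has small mass, uniformly in `θ`, with probability close
to one (`measure_exists_unstable_gt_le`). It is tested on `m'` ghost points that are pairwise far
apart on the scale of the bandwidth. The observations are presented as pairs from which fair coins
select. Given the pairs, about `k h ^ d` coins move the sum at one ghost point by at least `b / 2`
and hardly move the other sums. A multidimensional Littlewood-Offord estimate then bounds the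
probability that `R` such sums fall into prescribed intervals of length `t` by `(C t / √(k h ^ d)) ^
R`. On a grid of mesh `t` the polynomials `θ` show only polynomially many sign patterns, each with
boundedly many critical cells per point, so a union bound applies (`card_coins_not_towerAgree_le`).

The scales are `Λ = (k h ^ d) ^ (1/8)`, `Z = (h ^ d)⁻¹ ^ (1/8)`, so that `k = (Λ Z) ^ 8`, with `t =
Λ ^ 2`, `m ≈ Λ Z`, `m' ≈ Z`. Then `t / √(k h ^ d) = Λ ^ (-2)` tends to zero, and each bad event for
one block has probability `O(k ^ (-4))`. Summing over the blocks leaves `O(k ^ (-3))`, and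
Borel-Cantelli applies. -/

open MeasureTheory ProbabilityTheory Filter Topology

noncomputable section

/-! ### Sign patterns of linear functionals -/

section Patterns

open Finset

/-- The sets of indices on which a linear functional can be positive. -/
def linearPatterns {α ι : Type*} [Fintype α] [Fintype ι] (v : α → ι → ℝ) :
    Finset (Finset α) :=
  letI := Classical.decPred fun T : Finset α => ∃ θ : ι → ℝ, ∀ a, a ∈ T ↔ 0 < θ ⬝ᵥ v a
  Finset.univ.filter fun T => ∃ θ : ι → ℝ, ∀ a, a ∈ T ↔ 0 < θ ⬝ᵥ v a

theorem mem_linearPatterns {α ι : Type*} [Fintype α] [Fintype ι] {v : α → ι → ℝ}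
    {T : Finset α} : T ∈ linearPatterns v ↔ ∃ θ : ι → ℝ, ∀ a, a ∈ T ↔ 0 < θ ⬝ᵥ v a := by
  classical
  simp [linearPatterns]

/-- More than `card ι` vectors satisfy a nontrivial relation `∑ c i • v i = 0`. A functional that is
positive exactly where `c` is positive would make `∑ c i * (θ ⬝ᵥ v i)` a vanishing sum of
nonnegative terms, one of them positive. -/
theorem card_le_of_shatters_linearPatterns {α ι : Type*} [Fintype α] [DecidableEq α] [Fintype ι]
    {v : α → ι → ℝ} {T : Finset α} (hT : (linearPatterns v).Shatters T) :
    T.card ≤ Fintype.card ι := by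
  by_contra! hlt
  have hdep : ¬ LinearIndependent ℝ (fun a : T => v a) := by
    intro hli
    have := hli.fintype_card_le_finrank
    simp at this
    omega
  rw [Fintype.not_linearIndependent_iff] at hdep
  obtain ⟨c, hc, a₀, ha₀⟩ := hdep
  -- Patterns record strict positivity only, so the relation is normalised to have a positive
  -- coefficient.
  obtain ⟨c, hc, a₀, ha₀⟩ : ∃ c : T → ℝ, ∑ i, c i • v i = 0 ∧ ∃ i, 0 < c i := by
    rcases lt_or_gt_of_ne ha₀ with h | h
    · exact ⟨-c, by simp only [Pi.neg_apply, neg_smul, Finset.sum_neg_distrib, hc, neg_zero], a₀,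
        by simpa using h⟩
    · exact ⟨c, hc, a₀, h⟩
  obtain ⟨U, hU, hTU⟩ := hT (t := T.filter fun a => ∃ h : a ∈ T, 0 < c ⟨a, h⟩)
    (Finset.filter_subset _ _)
  obtain ⟨θ, hθ⟩ := mem_linearPatterns.1 hU
  have hiff : ∀ a : T, 0 < θ ⬝ᵥ v a ↔ 0 < c a := by
    intro a
    rw [← hθ]
    have := Finset.ext_iff.1 hTU a
    simp [a.2] at this
    exact this
  have h0 : ∑ i : T, c i * (θ ⬝ᵥ v i) = 0 := by
    have : θ ⬝ᵥ ∑ i : T, c i • v i = 0 := by rw [hc]; simp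
    rw [dotProduct_sum] at this
    simpa [dotProduct_smul] using this
  have hnn : ∀ i ∈ (univ : Finset T), 0 ≤ c i * (θ ⬝ᵥ v i) := by
    intro i _
    by_cases hi : 0 < c i
    · exact (mul_pos hi ((hiff i).2 hi)).le
    · exact mul_nonneg_of_nonpos_of_nonpos (not_lt.1 hi) (not_lt.1 (mt (hiff i).1 hi))
  have := (Finset.sum_eq_zero_iff_of_nonneg hnn).1 h0 a₀ (mem_univ _)
  exact (mul_pos ha₀ ((hiff a₀).2 ha₀)).ne' this

theorem sum_choose_le_pow (n V : ℕ) : ∑ k ∈ Finset.Iic V, n.choose k ≤ (n + 1) ^ V := by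
  rw [add_pow]
  have : Finset.Iic V = Finset.range (V + 1) := by ext; simp
  rw [this]
  refine Finset.sum_le_sum fun k hk => ?_
  have hk : k ≤ V := Nat.lt_succ_iff.1 (Finset.mem_range.1 hk)
  simp only [one_pow, mul_one, Nat.cast_id]
  exact (Nat.choose_le_pow n k).trans (Nat.le_mul_of_pos_right _ (Nat.choose_pos hk))

/-- Sauer-Shelah with VC dimension at most the number of coordinates. The same count serves the
uniform law for the sets and the tables of signs on a grid. -/
theorem card_linearPatterns_le {α ι : Type*} [Fintype α] [Fintype ι] (v : α → ι → ℝ) :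
    (linearPatterns v).card ≤ (Fintype.card α + 1) ^ Fintype.card ι := by
  classical
  calc (linearPatterns v).card ≤ (linearPatterns v).shatterer.card := card_le_card_shatterer _
    _ ≤ ∑ k ∈ Finset.Iic (linearPatterns v).vcDim, (Fintype.card α).choose k :=
        card_shatterer_le_sum_vcDim
    _ ≤ ∑ k ∈ Finset.Iic (Fintype.card ι), (Fintype.card α).choose k := by
        refine Finset.sum_le_sum_of_subset (Finset.Iic_subset_Iic.2 ?_)
        exact Finset.sup_le fun T hT =>
          card_le_of_shatters_linearPatterns (Finset.mem_shatterer.1 hT)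
    _ ≤ _ := sum_choose_le_pow _ _

end Patterns

/-! ### Signs of a polynomial and of its derivatives -/

section Tower

open Polynomial

/-- The polynomial `g` and its derivatives up to order `p` have the same signs at `a` and `b`. -/
def TowerAgree (p : ℕ) (g : ℝ[X]) (a b : ℝ) : Prop :=
  ∀ r ≤ p, SignType.sign ((derivative^[r] g).eval a) = SignType.sign ((derivative^[r] g).eval b)

/-- Both the polynomial on the interval and `sign` are monotone, so the sign in between is squeezed
by the equal signs at the ends. -/
theorem eval_pos_of_derivative_pos {g : ℝ[X]} {a b s : ℝ} (has : a ≤ s) (hsb : s ≤ b)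
    (hab : SignType.sign (g.eval a) = SignType.sign (g.eval b))
    (hd : ∀ x, a ≤ x → x ≤ b → 0 < g.derivative.eval x) :
    SignType.sign (g.eval a) = SignType.sign (g.eval s) := by
  have hmono : StrictMonoOn (fun x => g.eval x) (Set.Icc a b) := by
    refine strictMonoOn_of_deriv_pos (convex_Icc a b) g.continuous.continuousOn fun x hx => ?_
    rw [interior_Icc] at hx
    rw [Polynomial.deriv]
    exact hd x hx.1.le hx.2.le
  have hA : a ∈ Set.Icc a b := ⟨le_rfl, has.trans hsb⟩
  have hB : b ∈ Set.Icc a b := ⟨has.trans hsb, le_rfl⟩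
  have hS : s ∈ Set.Icc a b := ⟨has, hsb⟩
  have h1 : g.eval a ≤ g.eval s := hmono.monotoneOn hA hS has
  have h2 : g.eval s ≤ g.eval b := hmono.monotoneOn hS hB hsb
  exact le_antisymm (SignType.sign.monotone h1) (hab ▸ SignType.sign.monotone h2)

/-- Thom's lemma, by induction on the degree: the derivative keeps one sign on the interval, so `g`
is strictly monotone or constant there, and equal signs at the ends propagate inwards. Signs at two
end points thus control a whole interval. -/
theorem TowerAgree.of_le {p : ℕ} {g : ℝ[X]} {a b s : ℝ} (hg : g.natDegree ≤ p)
    (h : TowerAgree p g a b) (has : a ≤ s) (hsb : s ≤ b) : TowerAgree p g a s := by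
  induction p generalizing g s with
  | zero =>
    intro r hr
    obtain rfl : r = 0 := by omega
    rw [eq_C_of_natDegree_le_zero hg]
    simp
  | succ p ih =>
    have hd : ∀ s, a ≤ s → s ≤ b → TowerAgree p (derivative g) a s := by
      intro s h1 h2
      refine ih ((natDegree_derivative_le g).trans (by omega)) ?_ h1 h2
      intro r hr
      have := h (r + 1) (by omega)
      rwa [Function.iterate_succ_apply] at this
    rintro (_ | r) hr
    · simp only [Function.iterate_zero, id_eq]
      have h0 : SignType.sign (g.eval a) = SignType.sign (g.eval b) := h 0 (by omega)
      have hsg : ∀ x, a ≤ x → x ≤ b → SignType.sign ((derivative g).eval a)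
          = SignType.sign ((derivative g).eval x) := fun x h1 h2 => hd x h1 h2 0 (by omega)
      rcases lt_trichotomy ((derivative g).eval a) 0 with hn | hz | hp
      · have := eval_pos_of_derivative_pos (g := -g) has hsb
          (by simpa [Left.sign_neg] using h0) (fun x h1 h2 => by
            have h3 := hsg x h1 h2
            rw [sign_neg hn, eq_comm, sign_eq_neg_one_iff] at h3
            simpa using h3)
        simpa [Left.sign_neg] using this
      · have hc : g.eval s = g.eval a := by
          refine constant_of_derivWithin_zero (f := fun x => g.eval x) (a := a) (b := b)
            g.differentiable.differentiableOn (fun x hx => ?_) s ⟨has, hsb⟩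
          have h3 := hsg x hx.1 hx.2.le
          rw [hz, sign_zero, eq_comm, sign_eq_zero_iff] at h3
          rw [(g.hasDerivAt x).hasDerivWithinAt.derivWithin
            (uniqueDiffOn_Icc (hx.1.trans_lt hx.2) x ⟨hx.1, hx.2.le⟩), h3]
        rw [hc]
      · refine eval_pos_of_derivative_pos has hsb h0 fun x h1 h2 => ?_
        have h3 := hsg x h1 h2
        rwa [sign_pos hp, eq_comm, sign_eq_one_iff] at h3
    · rw [Function.iterate_succ_apply]
      exact hd s has hsb r (by omega)

theorem exists_root_of_sign_ne {g : ℝ[X]} {a b : ℝ} (hab : a ≤ b)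
    (h : SignType.sign (g.eval a) ≠ SignType.sign (g.eval b)) :
    ∃ x, a ≤ x ∧ x ≤ b ∧ g.eval x = 0 := by
  by_contra! hne
  apply h
  have hc : ContinuousOn (fun x => g.eval x) (Set.Icc a b) := g.continuous.continuousOn
  have ha := hne a le_rfl hab
  have hb := hne b hab le_rfl
  rcases lt_or_gt_of_ne ha with ha | ha <;> rcases lt_or_gt_of_ne hb with hb | hb
  · rw [sign_neg ha, sign_neg hb]
  · obtain ⟨x, hx, hx0⟩ := intermediate_value_Icc hab hc ⟨ha.le, hb.le⟩
    exact absurd hx0 (hne x hx.1 hx.2)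
  · obtain ⟨x, hx, hx0⟩ := intermediate_value_Icc' hab hc ⟨hb.le, ha.le⟩
    exact absurd hx0 (hne x hx.1 hx.2)
  · rw [sign_pos ha, sign_pos hb]

/-- A sign change forces a root in the closed cell, and a root `x` belongs to at most the two cells
`⌊x / t⌋₊` and, as a right end point, `⌊x / t⌋₊ - 1`. -/
theorem card_sign_change_le {p : ℕ} {g : ℝ[X]} (hg : g.natDegree ≤ p) {t : ℝ} (ht : 0 < t)
    (G : ℕ) [DecidablePred fun j : ℕ => SignType.sign (g.eval (j * t))
      ≠ SignType.sign (g.eval ((j + 1) * t))] :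
    ((Finset.range G).filter fun j : ℕ => SignType.sign (g.eval (j * t))
      ≠ SignType.sign (g.eval ((j + 1) * t))).card ≤ 2 * p := by
  classical
  by_cases h0 : g = 0
  · simp [h0]
  calc _ ≤ (g.roots.toFinset.biUnion
        fun x => ({⌊x / t⌋₊, ⌊x / t⌋₊ - 1} : Finset ℕ)).card := by
        refine Finset.card_le_card fun j hj => ?_
        obtain ⟨-, hj⟩ := Finset.mem_filter.1 hj
        obtain ⟨x, h1, h2, hx⟩ := exists_root_of_sign_ne
          (mul_le_mul_of_nonneg_right (by linarith : (j : ℝ) ≤ j + 1) ht.le) hj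
        refine Finset.mem_biUnion.2 ⟨x, by simp [h0, hx], ?_⟩
        have h3 : j ≤ ⌊x / t⌋₊ := Nat.le_floor (by rwa [le_div_iff₀ ht])
        have h4 : ⌊x / t⌋₊ ≤ j + 1 := by
          refine Nat.floor_le_of_le ?_
          rw [div_le_iff₀ ht]
          push_cast
          exact h2
        simp
        omega
    _ ≤ g.roots.toFinset.card * 2 := Finset.card_biUnion_le_card_mul _ _ _ fun x _ =>
        Finset.card_le_two
    _ ≤ p * 2 := by
        gcongr
        exact (Multiset.toFinset_card_le _).trans ((card_roots' g).trans hg)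
    _ = 2 * p := by ring

theorem natDegree_iterate_derivative_le' (g : ℝ[X]) (r : ℕ) :
    (derivative^[r] g).natDegree ≤ g.natDegree :=
  (natDegree_iterate_derivative g r).trans (by omega)

theorem card_not_towerAgree_le {p : ℕ} {g : ℝ[X]} (hg : g.natDegree ≤ p) {t : ℝ} (ht : 0 < t)
    (G : ℕ) [DecidablePred fun j : ℕ => ¬ TowerAgree p g (j * t) ((j + 1) * t)] :
    ((Finset.range G).filter fun j : ℕ => ¬ TowerAgree p g (j * t) ((j + 1) * t)).card
      ≤ (p + 1) * (2 * p) := by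
  classical
  calc _ ≤ ((Finset.range (p + 1)).biUnion fun r => (Finset.range G).filter fun j : ℕ =>
        SignType.sign ((derivative^[r] g).eval (j * t))
          ≠ SignType.sign ((derivative^[r] g).eval ((j + 1) * t))).card := by
        refine Finset.card_le_card fun j hj => ?_
        obtain ⟨hjG, hj⟩ := Finset.mem_filter.1 hj
        simp only [TowerAgree, not_forall] at hj
        obtain ⟨r, hr, hj⟩ := hj
        exact Finset.mem_biUnion.2 ⟨r, by simp; omega, Finset.mem_filter.2 ⟨hjG, hj⟩⟩
    _ ≤ (Finset.range (p + 1)).card * (2 * p) := Finset.card_biUnion_le_card_mul _ _ _ fun r _ =>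
        card_sign_change_le ((natDegree_iterate_derivative_le' g r).trans hg) ht G
    _ = _ := by simp

end Tower

/-! ### A small ball estimate for nearly diagonal systems of subset sums -/

section SmallBall

open Finset

variable {κ : Type*} [Fintype κ] [DecidableEq κ] {w : ℕ}

/-- The `k`-th value of the system of subset sums with weights `d`. -/
def subsetSums (c : κ → ℝ) (d : κ → Fin w → κ → ℝ) (A : κ → Finset (Fin w)) (k : κ) : ℝ :=
  c k + ∑ l, ∑ i ∈ A l, d l i k

theorem abs_sum_sub_sum_le {d : Fin w → ℝ} {τ : ℝ} (hd : ∀ i, |d i| ≤ τ) {A B : Finset (Fin w)}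
    (h : A ⊆ B) : |∑ i ∈ B, d i - ∑ i ∈ A, d i| ≤ τ * |(#B : ℝ) - #A| := by
  rw [← Finset.sum_sdiff h, add_sub_cancel_right, ← Nat.cast_sub (card_le_card h),
    ← card_sdiff_of_subset h, Nat.abs_cast, mul_comm]
  exact (abs_sum_le_sum_abs _ _).trans (by simpa using sum_le_card_nsmul _ _ _ fun i _ => hd i)

theorem le_sum_sub_sum {d : Fin w → ℝ} {β : ℝ} (hd : ∀ i, β ≤ d i) {A B : Finset (Fin w)}
    (h : A ⊆ B) : β * |(#B : ℝ) - #A| ≤ ∑ i ∈ B, d i - ∑ i ∈ A, d i := by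
  rw [← Finset.sum_sdiff h, add_sub_cancel_right, ← Nat.cast_sub (card_le_card h),
    ← card_sdiff_of_subset h, Nat.abs_cast, mul_comm]
  simpa using card_nsmul_le_sum (B \ A) _ _ fun i _ => hd i

/-- Diagonal dominance: in the coordinate `m` with the largest difference `Δ` of cardinalities, the
coordinate's own coins contribute at least `β * Δ`, and all others together at most `card κ * τ * Δ
≤ β / 2 * Δ`. So `β / 2 * Δ ≤ t`. Comparability of the sets excludes cancellation among the own
coins. -/
theorem card_diff_le_of_subsetSums_close {c : κ → ℝ} {d : κ → Fin w → κ → ℝ} {β τ t : ℝ}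
    (hβ : 0 < β) (hτ : 0 ≤ τ) (hdiag : ∀ k i, β ≤ d k i k)
    (hoff : ∀ l i k, l ≠ k → |d l i k| ≤ τ) (hsmall : Fintype.card κ * τ ≤ β / 2)
    {A B : κ → Finset (Fin w)} (hAB : ∀ k, A k ⊆ B k ∨ B k ⊆ A k)
    (hclose : ∀ k, |subsetSums c d A k - subsetSums c d B k| ≤ t) (k : κ) :
    |(#(A k) : ℝ) - #(B k)| ≤ 2 * t / β := by
  have hne : (univ : Finset κ).Nonempty := ⟨k, mem_univ k⟩
  obtain ⟨m, -, hm⟩ := exists_max_image univ (fun k => |(#(A k) : ℝ) - #(B k)|) hne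
  refine (hm k (mem_univ k)).trans ?_
  set Δ := |(#(A m) : ℝ) - #(B m)| with hΔ
  set e : κ → ℝ := fun l => ∑ i ∈ A l, d l i m - ∑ i ∈ B l, d l i m with he
  have hsum : subsetSums c d A m - subsetSums c d B m = e m + ∑ l ∈ univ.erase m, e l := by
    rw [add_sum_erase _ _ (mem_univ m)]
    simp [subsetSums, he]
  have h1 : β * Δ ≤ |e m| := by
    rcases hAB m with h | h
    · have := le_sum_sub_sum (hdiag m) h
      rw [abs_sub_comm] at this
      rw [he, abs_sub_comm]
      exact this.trans (le_abs_self _)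
    · exact (le_sum_sub_sum (hdiag m) h).trans (le_abs_self _)
  have h2 : |∑ l ∈ univ.erase m, e l| ≤ Fintype.card κ * (τ * Δ) := by
    refine (abs_sum_le_sum_abs _ _).trans ?_
    have : ∀ l ∈ univ.erase m, |e l| ≤ τ * Δ := by
      intro l hl
      have hlm : l ≠ m := (mem_erase.1 hl).1
      have : |e l| ≤ τ * |(#(A l) : ℝ) - #(B l)| := by
        rcases hAB l with h | h
        · rw [he, abs_sub_comm, abs_sub_comm (#(A l) : ℝ)]
          exact abs_sum_sub_sum_le (fun i => hoff l i m hlm) h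
        · exact abs_sum_sub_sum_le (fun i => hoff l i m hlm) h
      exact this.trans (mul_le_mul_of_nonneg_left (hm l (mem_univ l)) hτ)
    refine (sum_le_card_nsmul _ _ _ this).trans ?_
    rw [nsmul_eq_mul]
    gcongr
    exact card_le_univ _
  have h3 : |e m| ≤ t + Fintype.card κ * (τ * Δ) := by
    have := hclose m
    rw [hsum] at this
    have h4 := abs_sub_abs_le_abs_sub (e m) (-∑ l ∈ univ.erase m, e l)
    rw [sub_neg_eq_add, abs_neg] at h4
    linarith
  rw [le_div_iff₀ hβ]
  have h5 : (Fintype.card κ * τ) * Δ ≤ β / 2 * Δ :=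
    mul_le_mul_of_nonneg_right hsmall (abs_nonneg _)
  nlinarith

/-- The prefixes of a numbering form a chain, so a family of prefixes is determined by its
cardinalities, and each of these lies within `2 * t / β` of the smallest one. -/
theorem card_prefixed_subsetSums_le {c : κ → ℝ} {d : κ → Fin w → κ → ℝ} {β τ t : ℝ}
    (hβ : 0 < β) (hτ : 0 ≤ τ) (hdiag : ∀ k i, β ≤ d k i k)
    (hoff : ∀ l i k, l ≠ k → |d l i k| ≤ τ) (hsmall : Fintype.card κ * τ ≤ β / 2)
    {u : κ → ℝ} {E : Finset (κ → Finset (Fin w))}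
    (hE : ∀ A ∈ E, ∀ k, u k ≤ subsetSums c d A k ∧ subsetSums c d A k ≤ u k + t)
    {g : κ → Numbering (Fin w)} (hg : ∀ A ∈ E, ∀ k, (g k).IsPrefix (A k)) :
    #E ≤ (⌊2 * t / β⌋₊ + 1) ^ Fintype.card κ := by
  rcases E.eq_empty_or_nonempty with rfl | hne
  · simp
  have hcmp : ∀ A ∈ E, ∀ B ∈ E, ∀ k, #(A k) ≤ #(B k) → A k ⊆ B k := fun A hA B hB k h =>
    (hg A hA k).subset_of_card_le_card (hg B hB k) h
  have hinj : Set.InjOn (fun (A : κ → Finset (Fin w)) k => #(A k)) (E : Set _) := by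
    intro A hA B hB hAB
    funext k
    have hk : #(A k) = #(B k) := congrFun hAB k
    exact (hcmp A hA B hB k hk.le).antisymm (hcmp B hB A hA k hk.ge)
  rw [← card_image_of_injOn hinj]
  -- The minimiser may differ from coordinate to coordinate.
  have hmin : ∀ k, ∃ A ∈ E, ∀ B ∈ E, #(A k) ≤ #(B k) := fun k =>
    exists_min_image E (fun A => #(A k)) hne
  choose m hm hmin using hmin
  calc _ ≤ #(Fintype.piFinset fun k => Icc #(m k k) (#(m k k) + ⌊2 * t / β⌋₊)) := by
        refine card_le_card fun f hf => ?_
        obtain ⟨A, hA, rfl⟩ := mem_image.1 hf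
        refine Fintype.mem_piFinset.2 fun k => mem_Icc.2 ⟨hmin k A hA, ?_⟩
        have h1 := card_diff_le_of_subsetSums_close (c := c) (t := t) hβ hτ hdiag hoff hsmall
          (A := A) (B := m k) (fun l => (le_total #(A l) #(m k l)).imp
            (hcmp A hA _ (hm k) l) (hcmp _ (hm k) A hA l)) (fun l => by
              have h1 := hE A hA l
              have h2 := hE _ (hm k) l
              rw [abs_le]
              constructor <;> linarith) k
        have h2 : ((#(A k) - #(m k k) : ℕ) : ℝ) ≤ 2 * t / β := by
          rw [Nat.cast_sub (hmin k A hA)]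
          exact (le_abs_self _).trans h1
        have := Nat.le_floor h2
        omega
    _ = _ := by simp [Fintype.card_piFinset, add_assoc]

/-- Erdős' proof of the Littlewood-Offord bound in several coordinates, with the double counting of
Lubell, Yamamoto and Meshalkin: a tuple of numberings contains few members of `E` as prefixes, while
every member is a prefix of `∏ |A k|! (w - |A k|)!` tuples, each factor being at least `w! /
w.choose (w / 2)`. -/
theorem card_subsetSums_mem_Icc_le {c : κ → ℝ} {d : κ → Fin w → κ → ℝ} {β τ t : ℝ}
    (hβ : 0 < β) (hτ : 0 ≤ τ) (hdiag : ∀ k i, β ≤ d k i k)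
    (hoff : ∀ l i k, l ≠ k → |d l i k| ≤ τ) (hsmall : Fintype.card κ * τ ≤ β / 2)
    {u : κ → ℝ} {E : Finset (κ → Finset (Fin w))}
    (hE : ∀ A ∈ E, ∀ k, u k ≤ subsetSums c d A k ∧ subsetSums c d A k ≤ u k + t) :
    #E ≤ (w.choose (w / 2) * (⌊2 * t / β⌋₊ + 1)) ^ Fintype.card κ := by
  classical
  set D := ⌊2 * t / β⌋₊ + 1
  set K := Fintype.card κ with hK
  have hdouble : ∑ g : κ → Numbering (Fin w), #(E.filter fun A => ∀ k, (g k).IsPrefix (A k))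
      = ∑ A ∈ E, ∏ k, ((#(A k)).factorial * (w - #(A k)).factorial) := by
    simp_rw [card_filter]
    rw [sum_comm]
    refine sum_congr rfl fun A _ => ?_
    rw [← card_filter]
    have : (univ.filter fun g : κ → Numbering (Fin w) => ∀ k, (g k).IsPrefix (A k))
        = Fintype.piFinset fun k => Numbering.prefixed (A k) := by
      ext g
      simp [Fintype.mem_piFinset]
    rw [this, Fintype.card_piFinset]
    simp [Numbering.card_prefixed]
  have hupper : ∑ g : κ → Numbering (Fin w), #(E.filter fun A => ∀ k, (g k).IsPrefix (A k))
      ≤ w.factorial ^ K * D ^ K := by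
    refine (sum_le_card_nsmul _ _ (D ^ K) fun g _ => ?_).trans ?_
    · exact card_prefixed_subsetSums_le hβ hτ hdiag hoff hsmall
        (fun A hA => hE A (mem_filter.1 hA).1) (fun A hA => (mem_filter.1 hA).2)
    · simp [hK, Fintype.card_numbering]
  have hlower : #E * w.factorial ^ K
      ≤ w.choose (w / 2) ^ K * ∑ A ∈ E, ∏ k, ((#(A k)).factorial * (w - #(A k)).factorial) := by
    rw [mul_sum, ← smul_eq_mul, ← sum_const]
    refine sum_le_sum fun A _ => ?_
    rw [hK, ← card_univ, ← prod_const, ← prod_const, ← prod_mul_distrib]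
    refine prod_le_prod' fun k _ => ?_
    have hle : #(A k) ≤ w := by simpa using card_le_univ (A k)
    rw [← Nat.choose_mul_factorial_mul_factorial hle, mul_assoc]
    exact Nat.mul_le_mul_right _ (Nat.choose_le_middle _ _)
  have : #E * w.factorial ^ K ≤ (w.choose (w / 2) * D) ^ K * w.factorial ^ K := by
    refine hlower.trans ?_
    rw [← hdouble]
    calc _ ≤ w.choose (w / 2) ^ K * (w.factorial ^ K * D ^ K) := Nat.mul_le_mul_left _ hupper
      _ = _ := by rw [mul_pow]; ring
  exact Nat.le_of_mul_le_mul_right this (pow_pos (Nat.factorial_pos w) K)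

/-- The factor `2 * n + 1` becomes the decay `1 / √w` of the central binomial probability. The
induction step is `(2n + 1)(2n + 3) ≤ (2n + 2)²`. -/
theorem centralBinom_sq_mul_le (n : ℕ) : (2 * n + 1) * n.centralBinom ^ 2 ≤ 16 ^ n := by
  induction n with
  | zero => simp
  | succ n ih =>
    have h := Nat.succ_mul_centralBinom_succ n
    have h2 : (n + 1) ^ 2 * ((2 * (n + 1) + 1) * (n + 1).centralBinom ^ 2)
        ≤ (n + 1) ^ 2 * 16 ^ (n + 1) := by
      calc (n + 1) ^ 2 * ((2 * (n + 1) + 1) * (n + 1).centralBinom ^ 2)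
          = (2 * n + 3) * ((n + 1) * (n + 1).centralBinom) ^ 2 := by ring
        _ = (2 * n + 3) * (2 * (2 * n + 1) * n.centralBinom) ^ 2 := by rw [h]
        _ = ((2 * n + 3) * (4 * (2 * n + 1))) * ((2 * n + 1) * n.centralBinom ^ 2) := by ring
        _ ≤ ((2 * n + 3) * (4 * (2 * n + 1))) * 16 ^ n := Nat.mul_le_mul_left _ ih
        _ ≤ (16 * (n + 1) ^ 2) * 16 ^ n := by
            refine Nat.mul_le_mul_right _ ?_
            nlinarith
        _ = _ := by ring
    exact Nat.le_of_mul_le_mul_left h2 (by positivity)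

/-- The central binomial probability of `w` fair coins is at most `2 / √w`. -/
theorem choose_middle_div_le {w : ℕ} (hw : 0 < w) :
    (w.choose (w / 2) : ℝ) / 2 ^ w ≤ 2 / √w := by
  have key : ∀ n : ℕ, ((2 * n).choose n : ℝ) / 2 ^ (2 * n) ≤ 1 / √(2 * n + 1) := by
    intro n
    have h := centralBinom_sq_mul_le n
    rw [Nat.centralBinom_eq_two_mul_choose] at h
    have h' : (2 * n + 1 : ℝ) * ((2 * n).choose n : ℝ) ^ 2 ≤ 16 ^ n := by exact_mod_cast h
    rw [div_le_div_iff₀ (by positivity) (by positivity), one_mul]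
    refine abs_le_of_sq_le_sq' ?_ (by positivity) |>.2
    rw [mul_pow, Real.sq_sqrt (by positivity), ← pow_mul]
    calc _ = (2 * n + 1 : ℝ) * ((2 * n).choose n : ℝ) ^ 2 := by ring
      _ ≤ _ := h'
      _ = 2 ^ (2 * n * 2) := by rw [show (16 : ℝ) = 2 ^ 4 by norm_num, ← pow_mul]; ring_nf
  rcases Nat.even_or_odd' w with ⟨n, rfl | rfl⟩
  · rw [Nat.mul_div_cancel_left n (by norm_num)]
    refine (key n).trans ?_
    refine div_le_div₀ (by norm_num) (by norm_num) (Real.sqrt_pos.2 (by exact_mod_cast hw)) ?_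
    exact Real.sqrt_le_sqrt (by push_cast; linarith)
  · rw [show (2 * n + 1) / 2 = n by omega]
    have h1 : (2 * n + 1).choose n ≤ 2 * (2 * n).choose n := by
      rcases n with _ | n
      · simp
      · rw [show 2 * (n + 1) + 1 = (2 * (n + 1)).succ from rfl, Nat.choose_succ_succ,
          two_mul ((2 * (n + 1)).choose (n + 1))]
        refine Nat.add_le_add ?_ le_rfl
        have := Nat.choose_le_middle n (2 * (n + 1))
        rwa [Nat.mul_div_cancel_left _ (by norm_num)] at this
    have h2 : ((2 * n + 1).choose n : ℝ) ≤ 2 * ((2 * n).choose n : ℝ) := by exact_mod_cast h1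
    calc ((2 * n + 1).choose n : ℝ) / 2 ^ (2 * n + 1)
        ≤ 2 * ((2 * n).choose n : ℝ) / 2 ^ (2 * n + 1) := by gcongr
      _ = ((2 * n).choose n : ℝ) / 2 ^ (2 * n) := by rw [pow_succ]; field_simp
      _ ≤ 1 / √(2 * n + 1) := key n
      _ ≤ _ := by push_cast; gcongr; norm_num

end SmallBall

/-! ### Bivariate polynomials as polynomials in their second variable -/

section SectionPoly

open Polynomial

/-- The polynomial `s ↦ ∑ θ (a, b) * u ^ a * s ^ b`. -/
def sectionPoly {p : ℕ} (θ : Fin (p + 1) × Fin (p + 1) → ℝ) (u : ℝ) : ℝ[X] :=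
  ∑ j, C (θ j * u ^ (j.1 : ℕ)) * X ^ (j.2 : ℕ)

/-- The coefficients of the linear functional `θ ↦ (d/ds)^r ∑ θ (a, b) * u ^ a * s ^ b`. -/
def derivVec (p r : ℕ) (u s : ℝ) (j : Fin (p + 1) × Fin (p + 1)) : ℝ :=
  u ^ (j.1 : ℕ) * (derivative^[r] (X ^ (j.2 : ℕ) : ℝ[X])).eval s

theorem eval_iterate_derivative_sectionPoly {p : ℕ} (θ : Fin (p + 1) × Fin (p + 1) → ℝ)
    (r : ℕ) (u s : ℝ) :
    (derivative^[r] (sectionPoly θ u)).eval s = θ ⬝ᵥ derivVec p r u s := by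
  rw [sectionPoly, iterate_derivative_sum, eval_finsetSum]
  refine Finset.sum_congr rfl fun j _ => ?_
  rw [iterate_derivative_C_mul, eval_C_mul, derivVec]
  ring

theorem natDegree_sectionPoly_le {p : ℕ} (θ : Fin (p + 1) × Fin (p + 1) → ℝ) (u : ℝ) :
    (sectionPoly θ u).natDegree ≤ p := by
  refine natDegree_sum_le_of_forall_le _ _ fun j _ => ?_
  exact (natDegree_C_mul_X_pow_le _ _).trans (Nat.lt_succ_iff.1 j.2.2)

theorem TowerAgree.trans {p : ℕ} {g : ℝ[X]} {a b c : ℝ} (h₁ : TowerAgree p g a b)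
    (h₂ : TowerAgree p g b c) : TowerAgree p g a c :=
  fun r hr => (h₁ r hr).trans (h₂ r hr)

end SectionPoly

/-! ### Sums controlled by coins -/

section Coins

open Finset

variable {κ ι : Type*} [Fintype κ] [Fintype ι] [DecidableEq κ] [DecidableEq ι]

/-- The sum selected by the coins `c`. -/
def coinSum (a : κ → ι → Bool → ℝ) (c : ι → Bool) (k : κ) : ℝ := ∑ i, a k i (c i)

/-- Only the coins in the range of `e` are tossed anew. With the others frozen, the sums have the
form `subsetSums`, so the bound holds for each frozen state; counting pairs (state, new tosses)
averages over the states. -/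
theorem card_coinSum_mem_Icc_le {w : ℕ} {a : κ → ι → Bool → ℝ} {e : κ × Fin w → ι}
    (he : Function.Injective e) {β τ t : ℝ} (hβ : 0 < β) (hτ : 0 ≤ τ)
    (hdiag : ∀ k i, β ≤ a k (e (k, i)) true - a k (e (k, i)) false)
    (hoff : ∀ l i k, l ≠ k → |a k (e (l, i)) true - a k (e (l, i)) false| ≤ τ)
    (hsmall : Fintype.card κ * τ ≤ β / 2) (u : κ → ℝ)
    {E : Finset (ι → Bool)}
    (hE : ∀ c ∈ E, ∀ k, u k ≤ coinSum a c k ∧ coinSum a c k ≤ u k + t) :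
    #E * (2 ^ w) ^ Fintype.card κ ≤ 2 ^ Fintype.card ι *
      (w.choose (w / 2) * (⌊2 * t / β⌋₊ + 1)) ^ Fintype.card κ := by
  classical
  set upd : (ι → Bool) → (κ → Finset (Fin w)) → ι → Bool := fun c A =>
    Function.extend e (fun q => decide (q.2 ∈ A q.1)) c with hupd
  set d : κ → Fin w → κ → ℝ := fun l i k => a k (e (l, i)) true - a k (e (l, i)) false with hd
  have hsum : ∀ c A k, coinSum a (upd c A) k
      = subsetSums (fun k => coinSum a (upd c fun _ => ∅) k) d A k := by
    intro c A k
    rw [subsetSums, ← sub_eq_iff_eq_add', coinSum, coinSum, ← sum_sub_distrib]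
    have h1 : ∑ q : κ × Fin w, (if q.2 ∈ A q.1 then d q.1 q.2 k else 0)
        = ∑ i, (a k i (upd c A i) - a k i (upd c (fun _ => ∅) i)) := by
      refine sum_of_injOn e he.injOn (by simp) ?_ ?_
      · intro i _ hi
        have hi : ¬ ∃ q, e q = i := by simpa using hi
        simp [hupd, Function.extend_apply' _ _ _ hi]
      · intro q _
        simp only [hupd, he.extend_apply, hd]
        by_cases hq : q.2 ∈ A q.1 <;> simp [hq]
    rw [← h1, Fintype.sum_prod_type]
    refine sum_congr rfl fun l _ => ?_
    simp
  have hpairs : #E * (2 ^ w) ^ Fintype.card κ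
      ≤ #((univ : Finset ((ι → Bool) × (κ → Finset (Fin w)))).filter
          fun q => upd q.1 q.2 ∈ E) := by
    have hcard : #(E ×ˢ (univ : Finset (κ → Finset (Fin w)))) = #E * (2 ^ w) ^ Fintype.card κ := by
      simp
    rw [← hcard]
    set rd : (ι → Bool) → κ → Finset (Fin w) := fun c k => univ.filter fun i => c (e (k, i))
      with hrd
    have hrd_upd : ∀ c A, rd (upd c A) = A := by
      intro c A
      ext k i
      simp [hrd, hupd, he.extend_apply]
    have hupd_upd : ∀ c B, upd (upd c B) (rd c) = c := by
      intro c B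
      funext i
      by_cases hi : ∃ q, e q = i
      · obtain ⟨q, rfl⟩ := hi
        simp [hrd, hupd, he.extend_apply]
      · simp only [hupd, Function.extend_apply' _ _ _ hi]
    -- Overwriting forgets the old values of the coins in the range of `e`; storing them as the
    -- second component makes the map injective.
    refine card_le_card_of_injOn (fun q => (upd q.1 q.2, rd q.1)) ?_ ?_
    · intro q hq
      have hq : q.1 ∈ E := by simpa using hq
      simpa [hupd_upd] using hq
    · rintro ⟨c, B⟩ _ ⟨c', B'⟩ _ h
      obtain ⟨h1, h2⟩ := Prod.mk.inj h
      have h3 : c = c' := by rw [← hupd_upd c B, h1, h2, hupd_upd]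
      have h4 : B = B' := by rw [← hrd_upd c B, h1, hrd_upd]
      rw [h3, h4]
  refine hpairs.trans ?_
  have hfib : ∀ c : ι → Bool, #((univ : Finset (κ → Finset (Fin w))).filter
      fun A => upd c A ∈ E) ≤ (w.choose (w / 2) * (⌊2 * t / β⌋₊ + 1)) ^ Fintype.card κ := by
    intro c
    refine card_subsetSums_mem_Icc_le (c := fun k => coinSum a (upd c fun _ => ∅) k) (d := d)
      hβ hτ hdiag hoff hsmall (u := u) ?_
    intro A hA k
    rw [← hsum]
    exact hE _ (mem_filter.1 hA).2 k
  rw [card_filter, Fintype.sum_prod_type]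
  simp_rw [← card_filter]
  refine (sum_le_card_nsmul _ _ _ fun c _ => hfib c).trans ?_
  simp

end Coins

/-- The indices `i` whose coin moves the `k`-th sum by a fixed amount and hardly moves the
others. -/
def goodCoins {κ ι : Type*} [Fintype ι] (a : κ → ι → Bool → ℝ) (b τ : ℝ) (k : κ) : Finset ι :=
  letI := Classical.decPred fun i => b ≤ a k i true ∧ a k i false ≤ τ ∧
    ∀ l, l ≠ k → a l i true ≤ τ ∧ a l i false ≤ τ
  Finset.univ.filter fun i => b ≤ a k i true ∧ a k i false ≤ τ ∧
    ∀ l, l ≠ k → a l i true ≤ τ ∧ a l i false ≤ τ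

theorem mem_goodCoins {κ ι : Type*} [Fintype ι] {a : κ → ι → Bool → ℝ} {b τ : ℝ} {k : κ} {i : ι} :
    i ∈ goodCoins a b τ k ↔ b ≤ a k i true ∧ a k i false ≤ τ ∧
      ∀ l, l ≠ k → a l i true ≤ τ ∧ a l i false ≤ τ := by
  classical
  simp [goodCoins]

/-! ### Coin outcomes that put many sums into critical cells -/

section CoinsTower

open Finset Polynomial

/-- A coin cannot reach `b` at a point and stay below `τ < b` at the same point, so good coins of
different points are distinct, and `w` of them can be assigned to each point injectively. Their
differences are at least `b - τ ≥ b / 2` on the diagonal and at most `τ` off it. -/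
theorem card_coinSum_mem_cells_le {κ ι : Type*} [Fintype ι] [DecidableEq ι] [Fintype κ]
    [DecidableEq κ]
    {a : κ → ι → Bool → ℝ} {b τ t : ℝ} (ha0 : ∀ k i c, 0 ≤ a k i c) (hb : 0 < b) (hτ : 0 ≤ τ)
    (hτb : 4 * Fintype.card κ * τ ≤ b)
    {w : ℕ} (K₁ : Finset κ) (hw : ∀ k ∈ K₁, w ≤ #(goodCoins a b τ k)) (u : κ → ℝ)
    {E : Finset (ι → Bool)}
    (hE : ∀ c ∈ E, ∀ k ∈ K₁, u k ≤ coinSum a c k ∧ coinSum a c k ≤ u k + t) :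
    (#E : ℝ) ≤ 2 ^ Fintype.card ι *
      ((w.choose (w / 2) : ℝ) / 2 ^ w * (⌊2 * t / (b / 2)⌋₊ + 1)) ^ #K₁ := by
  classical
  have hcoin : ∀ k : K₁, ∃ f : Fin w → ι, Function.Injective f ∧ ∀ j, f j ∈ goodCoins a b τ k := by
    intro k
    have : Fintype.card (Fin w) ≤ Fintype.card (goodCoins a b τ (k : κ)) := by
      simpa using hw k k.2
    obtain ⟨f⟩ := Function.Embedding.nonempty_of_card_le this
    exact ⟨fun j => f j, fun i j h => f.injective (Subtype.ext h), fun j => (f j).2⟩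
  choose f hf hfm using hcoin
  have hτlt : ∀ k : K₁, 4 * τ ≤ b := by
    intro k
    have : (1 : ℝ) ≤ Fintype.card κ := by exact_mod_cast Fintype.card_pos_iff.2 ⟨(k : κ)⟩
    nlinarith
  have key := card_coinSum_mem_Icc_le (κ := K₁) (w := w) (a := fun k => a k)
    (e := fun q : K₁ × Fin w => f q.1 q.2) (β := b / 2) (τ := τ) (t := t) ?_ (by positivity) hτ
    ?_ ?_ ?_ (fun k => u k) (E := E) (fun c hc k => hE c hc k k.2)
  · rw [Fintype.card_coe] at key
    have key' : (#E : ℝ) * (2 ^ w) ^ #K₁ ≤ 2 ^ Fintype.card ι *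
        ((w.choose (w / 2) : ℝ) * (⌊2 * t / (b / 2)⌋₊ + 1)) ^ #K₁ := by exact_mod_cast key
    rw [div_mul_eq_mul_div, div_pow, ← mul_div_assoc, le_div_iff₀ (by positivity)]
    exact key'
  · rintro ⟨k, i⟩ ⟨l, j⟩ h
    have h : f k i = f l j := h
    by_cases hkl : k = l
    · subst hkl
      rw [hf k h]
    · exfalso
      have h1 := (mem_goodCoins.1 (hfm k i)).1
      have h2 := ((mem_goodCoins.1 (hfm l j)).2.2 k (fun h' => hkl (Subtype.ext h'))).1
      rw [h] at h1
      have := hτlt k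
      linarith
  · intro k i
    have h1 := mem_goodCoins.1 (hfm k i)
    have := hτlt k
    linarith [h1.1, h1.2.1]
  · intro l i k hlk
    have h1 := (mem_goodCoins.1 (hfm l i)).2.2 k (fun h' => hlk (Subtype.ext h'.symm))
    rw [abs_le]
    constructor <;> linarith [ha0 k (f l i) true, ha0 k (f l i) false, h1.1, h1.2]
  · have : (Fintype.card K₁ : ℝ) ≤ Fintype.card κ := by
      rw [Fintype.card_coe]; exact_mod_cast card_le_univ K₁
    nlinarith

/-- The vectors whose signs describe a family of polynomials and their derivatives on a grid. -/
def gridVec (κ : Type*) (p G : ℕ) (t : ℝ) (u : κ → ℝ)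
    (x : κ × Fin (G + 2) × Fin (p + 1) × Bool) : Fin (p + 1) × Fin (p + 1) → ℝ :=
  bif x.2.2.2 then derivVec p x.2.2.1 (u x.1) ((x.2.1 : ℕ) * t)
    else -derivVec p x.2.2.1 (u x.1) ((x.2.1 : ℕ) * t)

/-- A linear pattern sees strict positivity only; a vector together with its negative determines the
full sign, zero included. -/
theorem sign_eq_sign_of_pos_iff {x y : ℝ} (h₁ : 0 < x ↔ 0 < y) (h₂ : 0 < -x ↔ 0 < -y) :
    SignType.sign x = SignType.sign y := by
  rcases lt_trichotomy x 0 with h | h | h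
  · have : y < 0 := by simpa using h₂.1 (by simpa using h)
    rw [sign_neg h, sign_neg this]
  · subst h
    have : y = 0 := by
      have h1 := not_lt.1 (mt h₁.2 (lt_irrefl 0))
      have h2 := not_lt.1 (mt h₂.2 (by simp))
      linarith
    rw [this]
  · rw [sign_pos h, sign_pos (h₁.1 h)]

/-- Grid cells in which the polynomials may change sign, or whose right neighbour is such a
cell. -/
def criticalCells (p G : ℕ) (t : ℝ) (g : ℝ[X]) : Finset ℕ :=
  letI := Classical.decPred fun j : ℕ => ¬ TowerAgree p g (j * t) ((j + 1) * t)
  (range (G + 1)).filter (fun j : ℕ => ¬ TowerAgree p g (j * t) ((j + 1) * t)) ∪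
  ((range (G + 1)).filter (fun j : ℕ => ¬ TowerAgree p g (j * t) ((j + 1) * t))).image (· - 1)

theorem mem_criticalCells {p G : ℕ} {t : ℝ} {g : ℝ[X]} {x : ℕ} :
    x ∈ criticalCells p G t g ↔
      (x < G + 1 ∧ ¬ TowerAgree p g (x * t) ((x + 1) * t)) ∨
        ∃ j : ℕ, (j < G + 1 ∧ ¬ TowerAgree p g (j * t) ((j + 1) * t)) ∧ j - 1 = x := by
  classical
  simp [criticalCells]

theorem card_criticalCells_le {p G : ℕ} {t : ℝ} (ht : 0 < t) {g : ℝ[X]} (hg : g.natDegree ≤ p) :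
    #(criticalCells p G t g) ≤ 4 * p * (p + 1) := by
  classical
  refine (card_union_le _ _).trans ?_
  have h := @card_not_towerAgree_le p g hg t ht (G + 1) (Classical.decPred _)
  calc _ ≤ (p + 1) * (2 * p) + (p + 1) * (2 * p) := add_le_add h (card_image_le.trans h)
    _ = _ := by ring

/-- If `s` lies in cell `j`, then `s + t` lies in cell `j + 1`. Were the signs the same at the three
grid points bounding these cells, Thom's lemma would give the same signs at `s` and `s + t`. This is
why left neighbours of bad cells count as critical, and why the cells run up to the index `G`. -/
theorem floor_mem_criticalCells {p G : ℕ} {t : ℝ} (ht : 0 < t) {g : ℝ[X]} (hg : g.natDegree ≤ p)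
    {s : ℝ} (hs : 0 ≤ s) (hsG : s < G * t) (h : ¬ TowerAgree p g s (s + t)) :
    ⌊s / t⌋₊ ∈ criticalCells p G t g := by
  classical
  set j := ⌊s / t⌋₊ with hj
  have h1 : (j : ℝ) * t ≤ s := by
    rw [← le_div_iff₀ ht]
    exact Nat.floor_le (by positivity)
  have h2 : s < (j + 1 : ℝ) * t := by
    rw [← div_lt_iff₀ ht]
    exact Nat.lt_floor_add_one _
  have hjG : j < G := by
    have : (j : ℝ) * t < G * t := h1.trans_lt hsG
    exact_mod_cast lt_of_mul_lt_mul_right this ht.le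
  by_contra hmem
  rw [mem_criticalCells, not_or] at hmem
  have hA : TowerAgree p g (j * t) ((j + 1) * t) := by
    by_contra hn
    exact hmem.1 ⟨by omega, hn⟩
  have hB : TowerAgree p g ((j + 1) * t) ((j + 1 + 1) * t) := by
    by_contra hn
    exact hmem.2 ⟨j + 1, ⟨by omega, by push_cast; exact hn⟩, by simp⟩
  have hC := hA.trans hB
  refine h (fun r hr => ?_)
  exact (hC.of_le hg h1 (by linarith) r hr).symm.trans
    (hC.of_le hg (by linarith) (by linarith) r hr)

/-- Union bound over the sign patterns on the grid, the sets of `R` points with enough good coins,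
and the choices of one critical cell for each of them. The three counts are the three factors in
front of the small ball probability. -/
theorem card_coins_not_towerAgree_le {κ ι : Type*} [Fintype ι] [DecidableEq ι] [Fintype κ]
    [DecidableEq κ] {a : κ → ι → Bool → ℝ} {b τ t M : ℝ} (ha0 : ∀ k i c, 0 ≤ a k i c)
    (haM : ∀ k i c, a k i c ≤ M) (hb : 0 < b) (hτ : 0 ≤ τ) (ht : 0 < t)
    (hτb : 4 * Fintype.card κ * τ ≤ b) {p G w ρ R : ℕ} (hG : Fintype.card ι * M < G * t)
    (u : κ → ℝ)
    [DecidablePred fun k : κ => #(goodCoins a b τ k) < w]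
    (hρ : #(univ.filter fun k => #(goodCoins a b τ k) < w) ≤ ρ)
    {E : Finset (ι → Bool)}
    (hE : ∀ c ∈ E, ∃ θ : Fin (p + 1) × Fin (p + 1) → ℝ, ∃ B : Finset κ, ρ + R ≤ #B ∧
      ∀ k ∈ B, ¬ TowerAgree p (sectionPoly θ (u k)) (coinSum a c k) (coinSum a c k + t)) :
    (#E : ℝ) ≤ 2 ^ Fintype.card ι *
      ((2 * Fintype.card κ * (G + 2) * (p + 1) + 1) ^ ((p + 1) ^ 2) * 2 ^ Fintype.card κ *
        (4 * p * (p + 1) *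
          ((w.choose (w / 2) : ℝ) / 2 ^ w * (⌊2 * t / (b / 2)⌋₊ + 1))) ^ R) := by
  classical
  set v := gridVec κ p G t u with hv
  -- The parameter `θ` varies in a continuum, but the critical cells depend only on its sign pattern
  -- on the grid. One representative per pattern makes the union finite.
  have hchoose : ∀ T : Finset (κ × Fin (G + 2) × Fin (p + 1) × Bool),
      ∃ θ : Fin (p + 1) × Fin (p + 1) → ℝ, T ∈ linearPatterns v → ∀ x, x ∈ T ↔ 0 < θ ⬝ᵥ v x := by
    intro T
    by_cases hT : T ∈ linearPatterns v
    · obtain ⟨θ, hθ⟩ := mem_linearPatterns.1 hT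
      exact ⟨θ, fun _ => hθ⟩
    · exact ⟨0, fun h => absurd h hT⟩
  choose rep hrep using hchoose
  set cells : Finset (κ × Fin (G + 2) × Fin (p + 1) × Bool) → κ → Finset ℕ :=
    fun T k => criticalCells p G t (sectionPoly (rep T) (u k)) with hcells
  -- The condition on the number of good coins does not involve the outcome `c`; as part of the set
  -- it is available whenever the set is nonempty.
  set F : Finset (κ × Fin (G + 2) × Fin (p + 1) × Bool) → (K₁ : Finset κ) →
      (∀ k ∈ K₁, ℕ) → Finset (ι → Bool) := fun T K₁ f => univ.filter fun c =>
        (∀ k ∈ K₁, w ≤ #(goodCoins a b τ k)) ∧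
        ∀ k (hk : k ∈ K₁), f k hk * t ≤ coinSum a c k ∧ coinSum a c k ≤ f k hk * t + t with hF
  set q : ℝ := (w.choose (w / 2) : ℝ) / 2 ^ w * (⌊2 * t / (b / 2)⌋₊ + 1) with hq
  have hFcard : ∀ T K₁ f, (#(F T K₁ f) : ℝ) ≤ 2 ^ Fintype.card ι * q ^ #K₁ := by
    intro T K₁ f
    rcases (F T K₁ f).eq_empty_or_nonempty with h | ⟨c, hc⟩
    · rw [h]
      simp only [card_empty, Nat.cast_zero]
      positivity
    · refine card_coinSum_mem_cells_le (t := t) ha0 hb hτ hτb K₁ (mem_filter.1 hc).2.1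
        (fun k => if hk : k ∈ K₁ then f k hk * t else 0) ?_
      intro c hc k hk
      simp only [hk, dite_true]
      exact (mem_filter.1 hc).2.2 k hk
  have hcover : E ⊆ (linearPatterns v).biUnion fun T => (powersetCard R univ).biUnion fun K₁ =>
      (K₁.pi fun k => cells T k).biUnion fun f => F T K₁ f := by
    intro c hc
    obtain ⟨θ, B, hB, hBt⟩ := hE c hc
    set T := univ.filter fun x => 0 < θ ⬝ᵥ v x with hT
    have hTmem : T ∈ linearPatterns v := mem_linearPatterns.2 ⟨θ, fun x => by simp [hT]⟩
    have hiff : ∀ x, 0 < θ ⬝ᵥ v x ↔ 0 < rep T ⬝ᵥ v x := by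
      intro x
      rw [← hrep T hTmem x]
      simp [hT]
    have hsign : ∀ k (j : ℕ), j < G + 2 → ∀ r ≤ p,
        SignType.sign ((derivative^[r] (sectionPoly θ (u k))).eval (j * t))
        = SignType.sign ((derivative^[r] (sectionPoly (rep T) (u k))).eval (j * t)) := by
      intro k j hj r hr
      rw [eval_iterate_derivative_sectionPoly, eval_iterate_derivative_sectionPoly]
      have h1 := hiff (k, ⟨j, hj⟩, ⟨r, by omega⟩, true)
      have h2 := hiff (k, ⟨j, hj⟩, ⟨r, by omega⟩, false)
      simp only [hv, gridVec, cond_true, cond_false, dotProduct_neg] at h1 h2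
      exact sign_eq_sign_of_pos_iff h1 h2
    have hagree : ∀ k (j : ℕ), j < G + 1 →
        (TowerAgree p (sectionPoly θ (u k)) (j * t) ((j + 1) * t) ↔
          TowerAgree p (sectionPoly (rep T) (u k)) (j * t) ((j + 1) * t)) := by
      intro k j hj
      refine forall₂_congr fun r hr => ?_
      have h1 := hsign k j (by omega) r hr
      have h2 := hsign k (j + 1) (by omega) r hr
      push_cast at h2
      rw [h1, h2]
    have hcell : ∀ k, criticalCells p G t (sectionPoly θ (u k)) = cells T k := by
      intro k
      ext x
      rw [mem_criticalCells, mem_criticalCells]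
      exact or_congr (and_congr_right fun hx => not_congr (hagree k x hx))
        (exists_congr fun j => and_congr_left fun _ => and_congr_right fun hj =>
          not_congr (hagree k j hj))
    -- At most `ρ` of the `ρ + R` unstable points lack good coins, and the other `R` are kept.
    have hcardB : R ≤ #(B.filter fun k => w ≤ #(goodCoins a b τ k)) := by
      have h1 := card_filter_add_card_filter_not (s := B) (fun k => w ≤ #(goodCoins a b τ k))
      have h2 : #(B.filter fun k => ¬ w ≤ #(goodCoins a b τ k)) ≤ ρ := by
        refine (card_le_card ?_).trans hρ
        intro k hk
        have := (mem_filter.1 hk).2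
        simpa using this
      omega
    obtain ⟨K₁, hK₁, hK₁R⟩ := exists_subset_card_eq hcardB
    have hS : ∀ k, 0 ≤ coinSum a c k ∧ coinSum a c k < G * t := by
      intro k
      refine ⟨sum_nonneg fun i _ => ha0 _ _ _, lt_of_le_of_lt ?_ hG⟩
      refine (sum_le_card_nsmul _ _ _ fun i _ => haM k i (c i)).trans ?_
      simp
    refine mem_biUnion.2 ⟨T, hTmem, mem_biUnion.2 ⟨K₁, mem_powersetCard.2 ⟨subset_univ _, hK₁R⟩,
      mem_biUnion.2 ⟨fun k _ => ⌊coinSum a c k / t⌋₊, mem_pi.2 fun k hk => ?_,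
        mem_filter.2 ⟨mem_univ _, fun k hk => (mem_filter.1 (hK₁ hk)).2, fun k hk => ?_⟩⟩⟩⟩
    · rw [← hcell]
      exact floor_mem_criticalCells ht (natDegree_sectionPoly_le _ _) (hS k).1 (hS k).2
        (hBt k (mem_filter.1 (hK₁ hk)).1)
    · have h1 := Nat.floor_le (div_nonneg (hS k).1 ht.le)
      have h2 := (Nat.lt_floor_add_one (coinSum a c k / t)).le
      rw [le_div_iff₀ ht] at h1
      rw [div_le_iff₀ ht] at h2
      constructor <;> linarith
  have hq0 : 0 ≤ q := by positivity
  have hpi : ∀ T, ∀ K₁ ∈ powersetCard R (univ : Finset κ),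
      ((#(K₁.pi fun k => cells T k) : ℕ) : ℝ) ≤ (4 * p * (p + 1)) ^ R := by
    intro T K₁ hK₁
    rw [card_pi]
    have : ∏ k ∈ K₁, #(cells T k) ≤ (4 * p * (p + 1)) ^ R := by
      rw [← (mem_powersetCard.1 hK₁).2]
      exact prod_le_pow_card _ _ _ fun k _ =>
        card_criticalCells_le ht (natDegree_sectionPoly_le _ _)
    exact_mod_cast this
  have hpat : ((#(linearPatterns v) : ℕ) : ℝ)
      ≤ (2 * Fintype.card κ * (G + 2) * (p + 1) + 1) ^ ((p + 1) ^ 2) := by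
    have := card_linearPatterns_le v
    simp only [Fintype.card_prod, Fintype.card_fin, Fintype.card_bool] at this
    calc ((#(linearPatterns v) : ℕ) : ℝ)
        ≤ (((Fintype.card κ * ((G + 2) * ((p + 1) * 2)) + 1) ^ ((p + 1) * (p + 1)) : ℕ) : ℝ) := by
          exact_mod_cast this
      _ = _ := by push_cast; rw [sq]; congr 1; ring
  have hpow : ((#(powersetCard R (univ : Finset κ)) : ℕ) : ℝ) ≤ 2 ^ Fintype.card κ := by
    rw [card_powersetCard, card_univ]
    exact_mod_cast Nat.choose_le_two_pow _ _
  calc (#E : ℝ) ≤ ∑ T ∈ linearPatterns v, ∑ K₁ ∈ powersetCard R univ,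
        ∑ f ∈ K₁.pi fun k => cells T k, (#(F T K₁ f) : ℝ) := by
        have h1 := card_le_card hcover
        have h2 : #E ≤ ∑ T ∈ linearPatterns v, ∑ K₁ ∈ powersetCard R univ,
            ∑ f ∈ K₁.pi fun k => cells T k, #(F T K₁ f) :=
          h1.trans (card_biUnion_le.trans (sum_le_sum fun T _ => card_biUnion_le.trans
            (sum_le_sum fun K₁ _ => card_biUnion_le)))
        exact_mod_cast h2
    _ ≤ ∑ T ∈ linearPatterns v, ∑ K₁ ∈ powersetCard R (univ : Finset κ),
        (4 * p * (p + 1)) ^ R * (2 ^ Fintype.card ι * q ^ R) := by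
        refine sum_le_sum fun T _ => sum_le_sum fun K₁ hK₁ => ?_
        refine (sum_le_card_nsmul _ _ (2 ^ Fintype.card ι * q ^ R) fun f _ => ?_).trans ?_
        · rw [← (mem_powersetCard.1 hK₁).2]
          exact hFcard T K₁ f
        · rw [nsmul_eq_mul]
          exact mul_le_mul_of_nonneg_right (hpi T K₁ hK₁) (by positivity)
    _ = #(linearPatterns v) * (#(powersetCard R (univ : Finset κ)) *
        ((4 * p * (p + 1)) ^ R * (2 ^ Fintype.card ι * q ^ R))) := by
        rw [sum_const, sum_const, nsmul_eq_mul, nsmul_eq_mul]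
    _ ≤ (2 * Fintype.card κ * (G + 2) * (p + 1) + 1) ^ ((p + 1) ^ 2) * (2 ^ Fintype.card κ *
        ((4 * p * (p + 1)) ^ R * (2 ^ Fintype.card ι * q ^ R))) := by gcongr
    _ = _ := by rw [mul_pow (4 * (p : ℝ) * (p + 1)) q]; ring

end CoinsTower

/-! ### Uniform deviations of empirical measures -/

section Hits

variable {κ Z : Type*} [Fintype κ]

/-- The number of sample points in `A`. -/
def hits (A : Set Z) (x : κ → Z) : ℝ := ∑ k, A.indicator (fun _ => (1 : ℝ)) (x k)

theorem hits_eq_card (A : Set Z) (x : κ → Z) [DecidablePred fun k => x k ∈ A] :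
    hits A x = (Finset.univ.filter fun k => x k ∈ A).card := by
  classical
  simp [hits, Set.indicator_apply, Finset.sum_boole]

theorem hits_nonneg (A : Set Z) (x : κ → Z) : 0 ≤ hits A x :=
  Finset.sum_nonneg fun _ _ => Set.indicator_nonneg (by simp) _

theorem hits_mono {A B : Set Z} (h : A ⊆ B) (x : κ → Z) : hits A x ≤ hits B x :=
  Finset.sum_le_sum fun _ _ => Set.indicator_le_indicator_of_subset h (fun _ => zero_le_one) _

theorem hits_union_le (A B : Set Z) (x : κ → Z) : hits (A ∪ B) x ≤ hits A x + hits B x := by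
  rw [hits, hits, hits, ← Finset.sum_add_distrib]
  refine Finset.sum_le_sum fun k _ => ?_
  by_cases hA : x k ∈ A <;> by_cases hB : x k ∈ B <;> simp [hA, hB]

variable [MeasurableSpace Z]

theorem measurable_hits {A : Set Z} (hA : MeasurableSet A) :
    Measurable (hits A : (κ → Z) → ℝ) :=
  Finset.measurable_sum _ fun k _ =>
    (measurable_const.indicator hA).comp (measurable_pi_apply k)

/-- Chebyshev, the variance of an indicator being at most `1 / 4`. -/
theorem measure_hits_dev_le (ν : Measure Z) [IsProbabilityMeasure ν] {A : Set Z}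
    (hA : MeasurableSet A) {s : ℝ} (hs : 0 < s) :
    Measure.pi (fun _ : κ => ν) {x | s ≤ |hits A x - Fintype.card κ * ν.real A|}
      ≤ ENNReal.ofReal (Fintype.card κ / (4 * s ^ 2)) := by
  set μ := Measure.pi fun _ : κ => ν with hμ
  set X : κ → (κ → Z) → ℝ := fun k x => A.indicator (fun _ => (1 : ℝ)) (x k) with hX
  have hmeas : Measurable (A.indicator fun _ => (1 : ℝ)) := measurable_const.indicator hA
  have hXm : ∀ k, Measurable (X k) := fun k => hmeas.comp (measurable_pi_apply k)
  have hbd : ∀ k x, X k x ∈ Set.Icc (0 : ℝ) 1 := by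
    intro k x
    by_cases h : x k ∈ A <;> simp [hX, h]
  have hL2 : ∀ k, MemLp (X k) 2 μ := fun k =>
    memLp_of_bounded (Eventually.of_forall (hbd k)) (hXm k).aestronglyMeasurable 2
  have hind : iIndepFun X μ :=
    iIndepFun_pi (X := fun _ => A.indicator fun _ => (1 : ℝ)) fun _ => hmeas.aemeasurable
  have hint : ∀ k, ∫ x, X k x ∂μ = ν.real A := by
    intro k
    have h2 : ∫ x, X k x ∂μ = ∫ z, A.indicator (fun _ => (1 : ℝ)) z ∂(μ.map (Function.eval k)) := by
      rw [integral_map (measurable_pi_apply k).aemeasurable hmeas.aestronglyMeasurable]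
    rw [h2, (measurePreserving_eval (fun _ : κ => ν) k).map_eq, integral_indicator_const _ hA]
    simp
  have hvar : variance (fun x => hits A x) μ ≤ Fintype.card κ / 4 := by
    have h1 : variance (fun x => hits A x) μ = ∑ k, variance (X k) μ := by
      have : (fun x => hits A x) = ∑ k, X k := by
        funext x
        simp [hits, hX]
      rw [this, IndepFun.variance_sum (fun k _ => hL2 k)]
      intro i _ j _ hij
      exact hind.indepFun hij
    rw [h1]
    have h2 : ∀ k ∈ Finset.univ, variance (X k) μ ≤ 1 / 4 := by
      intro k _
      have := variance_le_sq_of_bounded (μ := μ) (a := 0) (b := 1)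
        (Eventually.of_forall (hbd k)) (hXm k).aemeasurable
      norm_num at this ⊢
      exact this
    refine (Finset.sum_le_card_nsmul _ _ _ h2).trans ?_
    simp [div_eq_mul_inv]
  have hmean : ∫ x, hits A x ∂μ = Fintype.card κ * ν.real A := by
    simp only [hits]
    rw [integral_finsetSum _ fun k _ => (hL2 k).integrable (by norm_num)]
    rw [Finset.sum_congr rfl fun k _ => hint k]
    simp
  have hhL2 : MemLp (fun x => hits A x) 2 μ := by
    have := memLp_finsetSum Finset.univ fun k (_ : k ∈ Finset.univ) => hL2 k
    exact this
  have := meas_ge_le_variance_div_sq hhL2 hs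
  rw [hmean] at this
  refine this.trans (ENNReal.ofReal_le_ofReal ?_)
  rw [div_le_div_iff₀ (by positivity) (by positivity)]
  nlinarith [sq_nonneg s]

end Hits

section Rademacher

open Finset

/-- Chernoff's method with parameter `s / card κ`; each factor is a hyperbolic cosine, and `cosh x ≤
exp (x ^ 2 / 2)`. -/
theorem card_signs_sum_gt_le {κ : Type*} [Fintype κ] [DecidableEq κ] {a : κ → ℝ}
    (ha : ∀ k, |a k| ≤ 1) {s : ℝ} (hs : 0 ≤ s) (hκ : 0 < Fintype.card κ)
    [DecidablePred fun σ : κ → Bool => s < ∑ k, bif σ k then a k else -a k] :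
    ((univ.filter fun σ : κ → Bool => s < ∑ k, bif σ k then a k else -a k).card : ℝ)
      ≤ 2 ^ Fintype.card κ * Real.exp (-(s ^ 2 / (2 * Fintype.card κ))) := by
  set m : ℝ := (Fintype.card κ : ℝ) with hm
  have hm0 : 0 < m := Nat.cast_pos.2 hκ
  set l := s / m with hl
  have hl0 : 0 ≤ l := by positivity
  have h1 : ((univ.filter fun σ : κ → Bool => s < ∑ k, bif σ k then a k else -a k).card : ℝ)
      * Real.exp (l * s) ≤ ∑ σ : κ → Bool, Real.exp (l * ∑ k, bif σ k then a k else -a k) := by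
    rw [← nsmul_eq_mul, ← sum_const]
    refine (sum_le_sum fun σ hσ => ?_).trans (sum_le_sum_of_subset_of_nonneg (filter_subset _ _)
      fun _ _ _ => (Real.exp_pos _).le)
    exact Real.exp_le_exp.2 (mul_le_mul_of_nonneg_left (mem_filter.1 hσ).2.le hl0)
  have h2 : ∑ σ : κ → Bool, Real.exp (l * ∑ k, bif σ k then a k else -a k)
      = ∏ k, (Real.exp (l * a k) + Real.exp (-(l * a k))) := by
    have h3 : ∀ k, Real.exp (l * a k) + Real.exp (-(l * a k))
        = ∑ c : Bool, Real.exp (l * (bif c then a k else -a k)) := by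
      intro k
      simp
    simp_rw [h3]
    rw [prod_univ_sum, Fintype.piFinset_univ]
    refine sum_congr rfl fun σ _ => ?_
    rw [mul_sum, Real.exp_sum]
  have h4 : ∏ k, (Real.exp (l * a k) + Real.exp (-(l * a k)))
      ≤ 2 ^ Fintype.card κ * Real.exp (m * (l ^ 2 / 2)) := by
    calc _ ≤ ∏ _k : κ, 2 * Real.exp (l ^ 2 / 2) := by
          refine prod_le_prod (fun k _ => by positivity) fun k _ => ?_
          have h5 := Real.cosh_le_exp_half_sq (l * a k)
          rw [Real.cosh_eq] at h5
          have h6 : (l * a k) ^ 2 ≤ l ^ 2 := by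
            rw [mul_pow]
            have : a k ^ 2 ≤ 1 := by
              rw [← sq_abs]
              exact pow_le_one₀ (abs_nonneg _) (ha k)
            nlinarith [sq_nonneg l]
          have h7 : Real.exp ((l * a k) ^ 2 / 2) ≤ Real.exp (l ^ 2 / 2) :=
            Real.exp_le_exp.2 (by linarith)
          linarith
      _ = _ := by
          rw [prod_const, mul_pow, ← Real.exp_nat_mul, card_univ]
  have h8 : l * s - m * (l ^ 2 / 2) = s ^ 2 / (2 * m) := by
    rw [hl]
    field_simp
    ring
  have h9 : Real.exp (-(s ^ 2 / (2 * m))) = Real.exp (m * (l ^ 2 / 2)) / Real.exp (l * s) := by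
    rw [← Real.exp_sub]
    congr 1
    linarith
  rw [h9, ← mul_div_assoc, le_div_iff₀ (Real.exp_pos _)]
  exact h1.trans (h2.le.trans h4)

theorem card_signs_abs_sum_gt_le {κ : Type*} [Fintype κ] [DecidableEq κ] {a : κ → ℝ}
    (ha : ∀ k, |a k| ≤ 1) {s : ℝ} (hs : 0 ≤ s) (hκ : 0 < Fintype.card κ)
    [DecidablePred fun σ : κ → Bool => s < |∑ k, bif σ k then a k else -a k|] :
    ((univ.filter fun σ : κ → Bool => s < |∑ k, bif σ k then a k else -a k|).card : ℝ)
      ≤ 2 * (2 ^ Fintype.card κ * Real.exp (-(s ^ 2 / (2 * Fintype.card κ)))) := by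
  classical
  have h1 := card_signs_sum_gt_le ha hs hκ
  have h2 := card_signs_sum_gt_le (a := fun k => -a k) (fun k => by simpa using ha k) hs hκ
  have h3 : (univ.filter fun σ : κ → Bool => s < |∑ k, bif σ k then a k else -a k|) ⊆
      (univ.filter fun σ : κ → Bool => s < ∑ k, bif σ k then a k else -a k) ∪
      (univ.filter fun σ : κ → Bool => s < ∑ k, bif σ k then -a k else - -a k) := by
    intro σ hσ
    have hσ := (mem_filter.1 hσ).2
    have h4 : ∑ k, (bif σ k then -a k else - -a k) = -∑ k, (bif σ k then a k else -a k) := by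
      rw [← sum_neg_distrib]
      refine sum_congr rfl fun k _ => ?_
      cases σ k <;> simp
    rw [mem_union, mem_filter, mem_filter, h4]
    exact (lt_abs.1 hσ).imp (fun h => ⟨mem_univ _, h⟩) fun h => ⟨mem_univ _, h⟩
  have h5 := (card_le_card h3).trans (card_union_le _ _)
  have h6 : ((univ.filter fun σ : κ → Bool => s < |∑ k, bif σ k then a k else -a k|).card : ℝ)
      ≤ (univ.filter fun σ : κ → Bool => s < ∑ k, bif σ k then a k else -a k).card +
      (univ.filter fun σ : κ → Bool => s < ∑ k, bif σ k then -a k else - -a k).card := by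
    exact_mod_cast h5
  linarith

end Rademacher

section UniformDeviation

variable {κ Z : Type*} [Fintype κ] [DecidableEq κ] [MeasurableSpace Z]

/-- Swapping the members of any of the pairs preserves the law, so the probability may be averaged
over all swaps. For fixed pairs the swaps act as random signs, and the sets leave at most `N` traces
on the points, which permits a union bound. -/
theorem measure_exists_symmetrized_dev_le (ν : Measure Z) [IsProbabilityMeasure ν]
    {Θ : Type*} [Countable Θ] {A : Θ → Set Z} (hA : ∀ θ, MeasurableSet (A θ)) {N : ℝ}
    (hN : ∀ z : κ × Bool → Z, ∃ 𝒜 : Finset (Finset (κ × Bool)), (𝒜.card : ℝ) ≤ N ∧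
      ∀ θ, ∃ T ∈ 𝒜, ∀ x, x ∈ T ↔ z x ∈ A θ) {s : ℝ} (hs : 0 ≤ s) (hκ : 0 < Fintype.card κ) :
    Measure.pi (fun _ : κ => ν.prod ν)
      {v | ∃ θ, s < |hits (A θ) (fun k => (v k).1) - hits (A θ) (fun k => (v k).2)|}
      ≤ ENNReal.ofReal (2 * N * Real.exp (-(s ^ 2 / (2 * Fintype.card κ)))) := by
  classical
  set ρ := Measure.pi fun _ : κ => ν.prod ν with hρ
  set B : Set (κ → Z × Z) :=
    {v | ∃ θ, s < |hits (A θ) (fun k => (v k).1) - hits (A θ) (fun k => (v k).2)|} with hB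
  have hBm : MeasurableSet B := by
    rw [hB, Set.ofPred_exists]
    refine MeasurableSet.iUnion fun θ => measurableSet_lt measurable_const ?_
    have h1 : Measurable fun v : κ → Z × Z => hits (A θ) (fun k => (v k).1) :=
      (measurable_hits (hA θ)).comp (measurable_pi_lambda _ fun k =>
        measurable_fst.comp (measurable_pi_apply k))
    have h2 : Measurable fun v : κ → Z × Z => hits (A θ) (fun k => (v k).2) :=
      (measurable_hits (hA θ)).comp (measurable_pi_lambda _ fun k =>
        measurable_snd.comp (measurable_pi_apply k))
    exact (h1.sub h2).abs
  set sw : (κ → Bool) → (κ → Z × Z) → κ → Z × Z :=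
    fun σ v k => bif σ k then v k else (v k).swap with hsw
  have hmp : ∀ σ, MeasurePreserving (sw σ) ρ ρ := by
    intro σ
    refine measurePreserving_pi (fun _ => ν.prod ν) (fun _ => ν.prod ν)
      (f := fun k q => bif σ k then q else q.swap) fun k => ?_
    cases σ k
    · exact Measure.measurePreserving_swap
    · exact MeasurePreserving.id _
  set q := 2 * N * Real.exp (-(s ^ 2 / (2 * Fintype.card κ))) with hq
  have hpt : ∀ v, ((Finset.univ.filter fun σ => sw σ v ∈ B).card : ℝ)
      ≤ 2 ^ Fintype.card κ * q := by
    intro v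
    obtain ⟨𝒜, h𝒜, hT⟩ := hN fun x => bif x.2 then (v x.1).1 else (v x.1).2
    set a : Finset (κ × Bool) → κ → ℝ := fun T k =>
      (if (k, true) ∈ T then 1 else 0) - (if (k, false) ∈ T then 1 else 0) with ha
    have ha1 : ∀ T k, |a T k| ≤ 1 := by
      intro T k
      by_cases h1 : (k, true) ∈ T <;> by_cases h2 : (k, false) ∈ T <;> simp [ha, h1, h2]
    have hsub : (Finset.univ.filter fun σ => sw σ v ∈ B) ⊆ 𝒜.biUnion fun T =>
        Finset.univ.filter fun σ : κ → Bool => s < |∑ k, bif σ k then a T k else -a T k| := by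
      intro σ hσ
      obtain ⟨θ, hθ⟩ := (Finset.mem_filter.1 hσ).2
      obtain ⟨T, hT𝒜, hTθ⟩ := hT θ
      refine Finset.mem_biUnion.2 ⟨T, hT𝒜, Finset.mem_filter.2 ⟨Finset.mem_univ _, ?_⟩⟩
      convert hθ using 2
      rw [hits, hits, ← Finset.sum_sub_distrib]
      refine Finset.sum_congr rfl fun k _ => ?_
      have h1 := hTθ (k, true)
      have h2 := hTθ (k, false)
      simp only [cond_true, cond_false] at h1 h2
      cases hk : σ k <;> simp [ha, hsw, hk, Set.indicator_apply, h1, h2]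
    have h1 : ((Finset.univ.filter fun σ => sw σ v ∈ B).card : ℝ) ≤ ∑ T ∈ 𝒜, ((Finset.univ.filter
        fun σ : κ → Bool => s < |∑ k, bif σ k then a T k else -a T k|).card : ℝ) := by
      exact_mod_cast (Finset.card_le_card hsub).trans Finset.card_biUnion_le
    refine h1.trans ((Finset.sum_le_card_nsmul _ _ _ fun T _ =>
      card_signs_abs_sum_gt_le (ha1 T) hs hκ).trans ?_)
    rw [nsmul_eq_mul]
    calc _ ≤ N * (2 * (2 ^ Fintype.card κ * Real.exp (-(s ^ 2 / (2 * Fintype.card κ))))) := by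
          gcongr
      _ = _ := by rw [hq]; ring
  have hsum : (2 ^ Fintype.card κ : ENNReal) * ρ B = ∑ σ, ρ (sw σ ⁻¹' B) := by
    have : ∀ σ, ρ (sw σ ⁻¹' B) = ρ B := fun σ =>
      (hmp σ).measure_preimage hBm.nullMeasurableSet
    rw [Finset.sum_congr rfl fun σ _ => this σ]
    simp
  have hle : (2 ^ Fintype.card κ : ENNReal) * ρ B
      ≤ 2 ^ Fintype.card κ * ENNReal.ofReal q := by
    rw [hsum]
    calc ∑ σ, ρ (sw σ ⁻¹' B)
        = ∑ σ, ∫⁻ v, (sw σ ⁻¹' B).indicator 1 v ∂ρ := by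
          refine Finset.sum_congr rfl fun σ _ => ?_
          rw [lintegral_indicator_one ((hmp σ).measurable hBm)]
      _ = ∫⁻ v, ∑ σ, (sw σ ⁻¹' B).indicator 1 v ∂ρ := by
          rw [lintegral_finsetSum]
          exact fun σ _ => measurable_one.indicator ((hmp σ).measurable hBm)
      _ ≤ ∫⁻ _, ENNReal.ofReal (2 ^ Fintype.card κ * q) ∂ρ := by
          refine lintegral_mono fun v => ?_
          have h1 : ∑ σ, (sw σ ⁻¹' B).indicator (1 : (κ → Z × Z) → ENNReal) v
              = ((Finset.univ.filter fun σ => sw σ v ∈ B).card : ENNReal) := by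
            simp [Set.indicator_apply, Finset.sum_boole]
          rw [h1, ← ENNReal.ofReal_natCast]
          exact ENNReal.ofReal_le_ofReal (hpt v)
      _ = _ := by
          rw [lintegral_const, measure_univ, mul_one, ENNReal.ofReal_mul (by positivity),
            ENNReal.ofReal_pow (by norm_num)]
          simp
  have h2 : (2 ^ Fintype.card κ : ENNReal) ≠ 0 := by simp
  have h3 : (2 ^ Fintype.card κ : ENNReal) ≠ ⊤ := by simp
  exact (ENNReal.mul_le_mul_iff_right h2 h3).1 hle

/-- Vapnik-Chervonenkis: given a set with a large deviation in the sample, an independent second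
sample has, with probability at least one half, a count that differs from the first by more than
half that deviation. This is Chebyshev, and it needs `2 ≤ ε ^ 2 * card κ`. The two samples are
compared by symmetrisation. -/
theorem measure_exists_hits_dev_le (ν : Measure Z) [IsProbabilityMeasure ν]
    {Θ : Type*} [Countable Θ] {A : Θ → Set Z} (hA : ∀ θ, MeasurableSet (A θ)) {N : ℝ}
    (hN : ∀ z : κ × Bool → Z, ∃ 𝒜 : Finset (Finset (κ × Bool)), (𝒜.card : ℝ) ≤ N ∧
      ∀ θ, ∃ T ∈ 𝒜, ∀ x, x ∈ T ↔ z x ∈ A θ) {ε : ℝ} (hε : 0 < ε)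
    (hκ : 2 ≤ ε ^ 2 * Fintype.card κ) :
    Measure.pi (fun _ : κ => ν)
      {x | ∃ θ, ε * Fintype.card κ < |hits (A θ) x - Fintype.card κ * ν.real (A θ)|}
      ≤ ENNReal.ofReal (4 * N * Real.exp (-(ε ^ 2 * Fintype.card κ / 8))) := by
  set m : ℝ := (Fintype.card κ : ℝ) with hm
  have hm0 : 0 < m := by
    by_contra h
    nlinarith [sq_nonneg ε]
  set μ := Measure.pi fun _ : κ => ν with hμ
  set B := {x : κ → Z | ∃ θ, ε * m < |hits (A θ) x - m * ν.real (A θ)|} with hB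
  have hBm : MeasurableSet B := by
    rw [hB, Set.ofPred_exists]
    exact MeasurableSet.iUnion fun θ => measurableSet_lt measurable_const
      ((measurable_hits (hA θ)).sub_const _).abs
  set C : Set ((κ → Z) × (κ → Z)) :=
    {v | ∃ θ, ε * m / 2 < |hits (A θ) v.1 - hits (A θ) v.2|} with hC
  have hCm : MeasurableSet C := by
    rw [hC, Set.ofPred_exists]
    exact MeasurableSet.iUnion fun θ => measurableSet_lt measurable_const
      (((measurable_hits (hA θ)).comp measurable_fst).sub
        ((measurable_hits (hA θ)).comp measurable_snd)).abs
  have hsym : μ.prod μ C ≤ ENNReal.ofReal (2 * N * Real.exp (-(ε ^ 2 * m / 8))) := by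
    have h1 := measure_exists_symmetrized_dev_le ν hA hN (s := ε * m / 2) (by positivity)
      (Nat.cast_pos.1 hm0)
    have h2 := (measurePreserving_arrowProdEquivProdArrow Z Z κ (fun _ => ν)
      (fun _ => ν)).measure_preimage hCm.nullMeasurableSet
    have h3 : (ε * m / 2) ^ 2 / (2 * m) = ε ^ 2 * m / 8 := by
      field_simp
      norm_num
    rw [← hm, h3] at h1
    rw [← h2]
    exact h1
  have hhalf : ∀ x ∈ B, (2 : ENNReal)⁻¹ ≤ μ (Prod.mk x ⁻¹' C) := by
    rintro x ⟨θ, hθ⟩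
    have h1 := measure_hits_dev_le (κ := κ) ν (hA θ) (s := ε * m / 2) (by positivity)
    rw [← hμ, ← hm] at h1
    have h2 : ENNReal.ofReal (m / (4 * (ε * m / 2) ^ 2)) ≤ 2⁻¹ := by
      have : (2 : ENNReal)⁻¹ = ENNReal.ofReal (1 / 2) := by
        rw [one_div, ENNReal.ofReal_inv_of_pos (by norm_num)]; simp
      rw [this]
      refine ENNReal.ofReal_le_ofReal ?_
      rw [div_le_div_iff₀ (by positivity) (by norm_num)]
      nlinarith
    have hS : MeasurableSet {y : κ → Z | ε * m / 2 ≤ |hits (A θ) y - m * ν.real (A θ)|} :=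
      measurableSet_le measurable_const ((measurable_hits (hA θ)).sub_const _).abs
    have h3 : {y : κ → Z | ε * m / 2 ≤ |hits (A θ) y - m * ν.real (A θ)|}ᶜ
        ⊆ Prod.mk x ⁻¹' C := by
      intro y hy
      simp only [Set.mem_compl_iff, Set.mem_ofPred_eq, not_le] at hy
      refine ⟨θ, ?_⟩
      have := abs_sub_abs_le_abs_sub (hits (A θ) x - m * ν.real (A θ))
        (hits (A θ) y - m * ν.real (A θ))
      rw [sub_sub_sub_cancel_right] at this
      simp only
      linarith
    refine le_trans ?_ (measure_mono h3)
    rw [prob_compl_eq_one_sub hS]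
    calc (2 : ENNReal)⁻¹ = 1 - 2⁻¹ := by rw [ENNReal.one_sub_inv_two]
      _ ≤ _ := tsub_le_tsub_left (h1.trans h2) 1
  have hprod : 2⁻¹ * μ B ≤ μ.prod μ C := by
    rw [Measure.prod_apply hCm, ← lintegral_indicator_const hBm]
    refine lintegral_mono fun x => ?_
    by_cases hx : x ∈ B
    · simpa [hx] using hhalf x hx
    · simp [hx]
  calc μ B = 2 * (2⁻¹ * μ B) := by
        rw [← mul_assoc, ENNReal.mul_inv_cancel (by norm_num) (by norm_num), one_mul]
    _ ≤ 2 * ENNReal.ofReal (2 * N * Real.exp (-(ε ^ 2 * m / 8))) := by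
        gcongr
        exact hprod.trans hsym
    _ = _ := by
        rw [show (2 : ENNReal) = ENNReal.ofReal 2 by simp, ← ENNReal.ofReal_mul (by norm_num)]
        congr 1
        ring

end UniformDeviation

/-! ### Anticoncentration of kernel sums -/

section LowerTail

/-- Chernoff with `exp (-hits)`: one factor has mean at most `1 - q / 2 ≤ exp (-(q / 2))`, because
`exp (-1) ≤ 1 / 2`. -/
theorem measure_hits_le_le {κ Z : Type*} [Fintype κ] [MeasurableSpace Z] (ν : Measure Z)
    [IsProbabilityMeasure ν] {Q : Set Z} (hQ : MeasurableSet Q) {q a : ℝ} (hq : q ≤ ν.real Q) :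
    Measure.pi (fun _ : κ => ν) {x | hits Q x ≤ a}
      ≤ ENNReal.ofReal (Real.exp (a - Fintype.card κ * q / 2)) := by
  set μ := Measure.pi fun _ : κ => ν with hμ
  set f : Z → ℝ := fun z => Real.exp (-Q.indicator (fun _ => (1 : ℝ)) z) with hf
  have hfm : Measurable f := (measurable_const.indicator hQ).neg.exp
  have hprod : ∀ x : κ → Z, Real.exp (-hits Q x) = ∏ k, f (x k) := by
    intro x
    rw [hits, ← Finset.sum_neg_distrib, Real.exp_sum]
  have hint1 : ∫ z, f z ∂ν ≤ Real.exp (-(q / 2)) := by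
    have h1 : ∀ z, f z = 1 - Q.indicator (fun _ => 1 - Real.exp (-1)) z := by
      intro z
      by_cases hz : z ∈ Q <;> simp [hf, hz]
    simp_rw [h1]
    rw [integral_sub (integrable_const _) ((integrable_const _).indicator hQ),
      integral_indicator_const _ hQ]
    simp only [integral_const, probReal_univ, smul_eq_mul, one_mul]
    have h2 : Real.exp (-1) ≤ 1 / 2 := by
      rw [Real.exp_neg, one_div]
      exact inv_anti₀ (by norm_num) (by have := Real.add_one_le_exp (1 : ℝ); linarith)
    have h3 : ν.real Q * (1 / 2) ≤ ν.real Q * (1 - Real.exp (-1)) :=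
      mul_le_mul_of_nonneg_left (by linarith) measureReal_nonneg
    have h4 := Real.add_one_le_exp (-(q / 2))
    linarith
  have hint : ∫ x, Real.exp (-hits Q x) ∂μ ≤ Real.exp (-(Fintype.card κ * q / 2)) := by
    simp_rw [hprod]
    rw [hμ, integral_fintype_prod_eq_pow]
    calc _ ≤ Real.exp (-(q / 2)) ^ Fintype.card κ := by
          refine pow_le_pow_left₀ (integral_nonneg fun z => (Real.exp_pos _).le) hint1 _
      _ = _ := by
          rw [← Real.exp_nat_mul]
          congr 1
          ring
  have hInt : Integrable (fun x => Real.exp (-hits Q x)) μ := by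
    refine Integrable.of_bound (C := 1) (measurable_hits hQ).neg.exp.aestronglyMeasurable
      (Eventually.of_forall fun x => ?_)
    rw [Real.norm_of_nonneg (Real.exp_pos _).le]
    exact Real.exp_le_one_iff.2 (by simpa using hits_nonneg Q x)
  have hmark := mul_meas_ge_le_integral_of_nonneg (μ := μ)
    (Eventually.of_forall fun x => (Real.exp_pos (-hits Q x)).le) hInt (Real.exp (-a))
  have hset : {x : κ → Z | hits Q x ≤ a} = {x | Real.exp (-a) ≤ Real.exp (-hits Q x)} := by
    ext x
    simp
  rw [hset, ← ofReal_measureReal]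
  refine ENNReal.ofReal_le_ofReal ?_
  have : Real.exp (a - Fintype.card κ * q / 2)
      = Real.exp (-(Fintype.card κ * q / 2)) / Real.exp (-a) := by
    rw [← Real.exp_sub]
    congr 1
    ring
  rw [this, le_div_iff₀ (Real.exp_pos _), mul_comm]
  exact hmark.trans hint

end LowerTail

section TowerMeasurable

theorem measurable_dotProduct_derivVec {p : ℕ} (θ : Fin (p + 1) × Fin (p + 1) → ℝ) (r : ℕ) :
    Measurable fun q : ℝ × ℝ => θ ⬝ᵥ derivVec p r q.1 q.2 := by
  unfold dotProduct derivVec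
  refine Finset.measurable_sum _ fun j _ => ?_
  refine measurable_const.mul ((measurable_fst.pow_const _).mul ?_)
  exact (Polynomial.continuous _).measurable.comp measurable_snd

theorem sign_eq_sign_iff_pos_iff {x y : ℝ} :
    SignType.sign x = SignType.sign y ↔ (0 < x ↔ 0 < y) ∧ (0 < -x ↔ 0 < -y) := by
  refine ⟨fun h => ⟨?_, ?_⟩, fun h => sign_eq_sign_of_pos_iff h.1 h.2⟩
  · rw [← sign_eq_one_iff, ← sign_eq_one_iff, h]
  · rw [neg_pos, neg_pos, ← sign_eq_neg_one_iff, ← sign_eq_neg_one_iff, h]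

theorem measurableSet_towerAgree {p : ℕ} (θ : Fin (p + 1) × Fin (p + 1) → ℝ) (t : ℝ) :
    MeasurableSet {q : ℝ × ℝ | TowerAgree p (sectionPoly θ q.1) q.2 (q.2 + t)} := by
  have h : {q : ℝ × ℝ | TowerAgree p (sectionPoly θ q.1) q.2 (q.2 + t)}
      = ⋂ r ∈ Set.Iic p, {q : ℝ × ℝ | SignType.sign (θ ⬝ᵥ derivVec p r q.1 q.2)
        = SignType.sign (θ ⬝ᵥ derivVec p r q.1 (q.2 + t))} := by
    ext q
    simp [TowerAgree, eval_iterate_derivative_sectionPoly]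
  rw [h]
  refine MeasurableSet.biInter (Set.to_countable _) fun r _ => ?_
  have h1 : Measurable fun q : ℝ × ℝ => θ ⬝ᵥ derivVec p r q.1 q.2 :=
    measurable_dotProduct_derivVec θ r
  have h2 : Measurable fun q : ℝ × ℝ => θ ⬝ᵥ derivVec p r q.1 (q.2 + t) :=
    h1.comp (measurable_fst.prodMk (measurable_snd.add_const t))
  simp only [sign_eq_sign_iff_pos_iff]
  refine MeasurableSet.inter (MeasurableSet.iff ?_ ?_) (MeasurableSet.iff ?_ ?_)
  · exact measurableSet_lt measurable_const h1
  · exact measurableSet_lt measurable_const h2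
  · exact measurableSet_lt measurable_const h1.neg
  · exact measurableSet_lt measurable_const h2.neg

end TowerMeasurable

section Anticoncentration

variable {E : Type*} [MeasurableSpace E]

/-- The pairs of observations that form a coin for the `k`-th point. -/
def coinPairs {κ : Type*} (kern : E → E → ℝ) (b τ : ℝ) (x : κ → E) (k : κ) : Set (E × E) :=
  {q | b ≤ kern (x k) q.1 ∧ kern (x k) q.2 ≤ τ ∧
    ∀ l, l ≠ k → kern (x l) q.1 ≤ τ ∧ kern (x l) q.2 ≤ τ}

theorem measurableSet_coinPairs {κ : Type*} [Countable κ] {kern : E → E → ℝ}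
    (hk : ∀ x, Measurable (kern x)) (b τ : ℝ) (x : κ → E) (k : κ) :
    MeasurableSet (coinPairs kern b τ x k) := by
  have h1 : ∀ l, Measurable fun q : E × E => kern (x l) q.1 := fun l => (hk _).comp measurable_fst
  have h2 : ∀ l, Measurable fun q : E × E => kern (x l) q.2 := fun l => (hk _).comp measurable_snd
  refine (measurableSet_le measurable_const (h1 k)).inter
    ((measurableSet_le (h2 k) measurable_const).inter ?_)
  have hm : MeasurableSet {q : E × E | ∀ l, l ≠ k → kern (x l) q.1 ≤ τ ∧ kern (x l) q.2 ≤ τ} := by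
    simp only [Set.ofPred_forall]
    exact MeasurableSet.iInter fun l => MeasurableSet.iInter fun _ =>
      (measurableSet_le (h1 l) measurable_const).inter (measurableSet_le (h2 l) measurable_const)
  exact hm

-- Applying the lower tail to the points one by one would only give a factor independent of `ρ`. The
-- sets of coins of different points are disjoint, so `ρ + 1` poor points together leave a set of
-- mass `(ρ + 1) * q` with too few hits, and the exponent gains the factor `ρ + 1` that must beat
-- the `2 ^ card κ` choices of these points.
open scoped Classical in
theorem measure_few_goodCoins_le {κ ι : Type*} [Fintype κ] [Fintype ι] (ν : Measure E)
    [IsProbabilityMeasure ν] {kern : E → E → ℝ} (hk : ∀ x, Measurable (kern x))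
    {b τ : ℝ} (hτb : τ < b) {x : κ → E} {q : ℝ}
    (hq : ∀ k, q ≤ (ν.prod ν).real (coinPairs kern b τ x k)) {w ρ : ℕ}
    (hw : (w : ℝ) ≤ Fintype.card ι * q / 4) :
    Measure.pi (fun _ : ι => ν.prod ν)
      {v | ρ < (Finset.univ.filter fun k =>
        (goodCoins (fun k i c => kern (x k) (bif c then (v i).1 else (v i).2)) b τ k).card
          < w).card}
      ≤ ENNReal.ofReal (2 ^ Fintype.card κ *
          Real.exp (-((ρ + 1) * (Fintype.card ι * q / 4)))) := by
  classical
  set μ := Measure.pi fun _ : ι => ν.prod ν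
  have hcov : {v : ι → E × E | ρ < (Finset.univ.filter fun k =>
        (goodCoins (fun k i c => kern (x k) (bif c then (v i).1 else (v i).2)) b τ k).card
          < w).card} ⊆ ⋃ S ∈ Finset.powersetCard (ρ + 1) (Finset.univ : Finset κ),
        {v | hits (⋃ k ∈ S, coinPairs kern b τ x k) v ≤ (ρ + 1) * w} := by
    intro v hv
    obtain ⟨S, hS, hScard⟩ := Finset.exists_subset_card_eq (Nat.succ_le_of_lt hv)
    refine Set.mem_iUnion₂.2 ⟨S, Finset.mem_powersetCard.2 ⟨Finset.subset_univ _, hScard⟩, ?_⟩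
    have h1 : hits (⋃ k ∈ S, coinPairs kern b τ x k) v ≤ ∑ k ∈ S, hits (coinPairs kern b τ x k) v := by
      simp only [hits]
      rw [Finset.sum_comm]
      refine Finset.sum_le_sum fun i _ => ?_
      by_cases hi : v i ∈ ⋃ k ∈ S, coinPairs kern b τ x k
      · obtain ⟨k, hkS, hik⟩ := Set.mem_iUnion₂.1 hi
        rw [Set.indicator_of_mem hi]
        refine le_trans ?_ (Finset.single_le_sum (f := fun k =>
          (coinPairs kern b τ x k).indicator (fun _ => (1 : ℝ)) (v i))
          (fun _ _ => Set.indicator_nonneg (fun _ _ => zero_le_one) _) hkS)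
        simp [hik]
      · rw [Set.indicator_of_notMem hi]
        exact Finset.sum_nonneg fun _ _ => Set.indicator_nonneg (fun _ _ => zero_le_one) _
    have h2 : ∀ k ∈ S, hits (coinPairs kern b τ x k) v ≤ w := by
      intro k hkS
      have h3 := (Finset.mem_filter.1 (hS hkS)).2
      rw [hits_eq_card]
      refine Nat.cast_le.2 (le_trans (Finset.card_le_card ?_) h3.le)
      intro i hi
      exact mem_goodCoins.2 (Finset.mem_filter.1 hi).2
    refine h1.trans ((Finset.sum_le_card_nsmul _ _ _ h2).trans ?_)
    rw [hScard, nsmul_eq_mul]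
    push_cast
    rfl
  have hone : ∀ S ∈ Finset.powersetCard (ρ + 1) (Finset.univ : Finset κ),
      μ {v | hits (⋃ k ∈ S, coinPairs kern b τ x k) v ≤ (ρ + 1) * w}
        ≤ ENNReal.ofReal (Real.exp (-((ρ + 1) * (Fintype.card ι * q / 4)))) := by
    intro S hS
    have hScard := (Finset.mem_powersetCard.1 hS).2
    have hm := measurableSet_coinPairs hk b τ x
    have hdisj : Set.PairwiseDisjoint (S : Set κ) (coinPairs kern b τ x) := by
      intro k _ l _ hkl
      refine Set.disjoint_left.2 fun z hz hz' => ?_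
      have h1 := hz.1
      have h2 := (hz'.2.2 k hkl).1
      linarith
    have hreal : (ρ + 1) * q ≤ (ν.prod ν).real (⋃ k ∈ S, coinPairs kern b τ x k) := by
      rw [measureReal_biUnion_finset hdisj fun k _ => hm k]
      have := Finset.card_nsmul_le_sum S _ q fun k _ => hq k
      rw [hScard, nsmul_eq_mul] at this
      push_cast at this
      exact this
    refine (measure_hits_le_le (κ := ι) (ν.prod ν)
      (MeasurableSet.biUnion (Finset.countable_toSet S) fun k _ => hm k) hreal).trans ?_
    refine ENNReal.ofReal_le_ofReal (Real.exp_le_exp.2 ?_)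
    have : (ρ + 1 : ℝ) * w ≤ (ρ + 1) * (Fintype.card ι * q / 4) := by gcongr
    linarith
  refine (measure_mono hcov).trans ((measure_biUnion_finset_le _ _).trans
    ((Finset.sum_le_card_nsmul _ _ _ hone).trans ?_))
  rw [nsmul_eq_mul, ENNReal.ofReal_mul (by positivity)]
  gcongr
  rw [Finset.card_powersetCard, Finset.card_univ, ENNReal.ofReal_pow (by norm_num)]
  simp only [ENNReal.ofReal_ofNat]
  exact_mod_cast Nat.choose_le_two_pow _ _

/-- A bound for the probability that too many sums fall into critical cells. -/
def coinBound (p m G w R : ℕ) (b t : ℝ) : ℝ :=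
  (2 * m * (G + 2) * (p + 1) + 1) ^ ((p + 1) ^ 2) * 2 ^ m *
    (4 * p * (p + 1) * ((w.choose (w / 2) : ℝ) / 2 ^ w * (⌊2 * t / (b / 2)⌋₊ + 1))) ^ R

theorem coinBound_nonneg (p m G w R : ℕ) (b t : ℝ) : 0 ≤ coinBound p m G w R b t := by
  unfold coinBound
  positivity

theorem coinBound_mono {p m m' G w R : ℕ} {b t : ℝ} (h : m ≤ m') :
    coinBound p m G w R b t ≤ coinBound p m' G w R b t := by
  unfold coinBound
  gcongr
  norm_num

/-- A sample chosen from i.i.d. pairs by any fixed outcome of the coins is again i.i.d. with law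
`ν`. Averaging over the outcomes reduces the probability to a count of bad outcomes for fixed pairs,
outside the event that many points have few good coins. -/
theorem measure_exists_not_towerAgree_le {κ ι : Type*} [Fintype κ] [Fintype ι] (ν : Measure E)
    [IsProbabilityMeasure ν] {kern : E → E → ℝ} (hk : ∀ x, Measurable (kern x)) {M : ℝ}
    (hk0 : ∀ x y, 0 ≤ kern x y) (hkM : ∀ x y, kern x y ≤ M)
    {b τ t : ℝ} (hb : 0 < b) (hτ : 0 ≤ τ) (hτb : τ < b) (ht : 0 < t)
    (hτb' : 4 * Fintype.card κ * τ ≤ b) {x : κ → E} {q : ℝ}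
    (hq : ∀ k, q ≤ (ν.prod ν).real (coinPairs kern b τ x k)) {p G w ρ R : ℕ}
    (hw : (w : ℝ) ≤ Fintype.card ι * q / 4) (hG : Fintype.card ι * M < G * t)
    (u : κ → ℝ) {Θ : Type*} [Countable Θ] (θ : Θ → Fin (p + 1) × Fin (p + 1) → ℝ) :
    Measure.pi (fun _ : ι => ν) {y | ∃ j, ∃ B : Finset κ, ρ + R ≤ B.card ∧ ∀ k ∈ B,
        ¬ TowerAgree p (sectionPoly (θ j) (u k)) (∑ i, kern (x k) (y i))
          (∑ i, kern (x k) (y i) + t)}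
      ≤ ENNReal.ofReal (2 ^ Fintype.card κ * Real.exp (-((ρ + 1) * (Fintype.card ι * q / 4)))
        + coinBound p (Fintype.card κ) G w R b t) := by
  classical
  set Bad : Set (ι → E) := {y | ∃ j, ∃ B : Finset κ, ρ + R ≤ B.card ∧ ∀ k ∈ B,
        ¬ TowerAgree p (sectionPoly (θ j) (u k)) (∑ i, kern (x k) (y i))
          (∑ i, kern (x k) (y i) + t)} with hBad
  have hBadm : MeasurableSet Bad := by
    rw [hBad, Set.ofPred_exists]
    refine MeasurableSet.iUnion fun j => ?_
    rw [Set.ofPred_exists]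
    refine MeasurableSet.iUnion fun B => ?_
    refine (MeasurableSet.const _).inter ?_
    have hm : MeasurableSet {y : ι → E | ∀ k ∈ B, ¬ TowerAgree p (sectionPoly (θ j) (u k))
        (∑ i, kern (x k) (y i)) (∑ i, kern (x k) (y i) + t)} := by
      simp only [Set.ofPred_forall]
      refine MeasurableSet.iInter fun k => MeasurableSet.iInter fun _ => MeasurableSet.compl ?_
      have hS : Measurable fun y : ι → E => (u k, ∑ i, kern (x k) (y i)) :=
        measurable_const.prodMk (Finset.measurable_sum _ fun i _ =>
          (hk _).comp (measurable_pi_apply i))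
      exact hS (measurableSet_towerAgree (θ j) t)
    exact hm
  set μ := Measure.pi fun _ : ι => ν.prod ν with hμ
  set sel : (ι → Bool) → (ι → E × E) → ι → E := fun c v i => bif c i then (v i).1 else (v i).2
    with hsel
  have hmp : ∀ c, MeasurePreserving (sel c) μ (Measure.pi fun _ : ι => ν) := by
    intro c
    refine measurePreserving_pi (fun _ => ν.prod ν) (fun _ => ν)
      (f := fun i q => bif c i then q.1 else q.2) fun i => ?_
    cases c i
    · exact measurePreserving_snd
    · exact measurePreserving_fst
  set a : (ι → E × E) → κ → ι → Bool → ℝ := fun v k i c =>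
    kern (x k) (bif c then (v i).1 else (v i).2) with ha
  set few : Set (ι → E × E) := {v | ρ < (Finset.univ.filter fun k =>
    (goodCoins (a v) b τ k).card < w).card} with hfew
  set δ := coinBound p (Fintype.card κ) G w R b t with hδ
  have hδ0 : 0 ≤ δ := coinBound_nonneg _ _ _ _ _ _ _
  have hpt : ∀ v, v ∉ few → ((Finset.univ.filter fun c => sel c v ∈ Bad).card : ℝ)
      ≤ 2 ^ Fintype.card ι * δ := by
    intro v hv
    refine card_coins_not_towerAgree_le (a := a v) (fun _ _ _ => hk0 _ _) (fun _ _ _ => hkM _ _)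
      hb hτ ht hτb' (G := G) (w := w) (ρ := ρ) (R := R) hG u (not_lt.1 hv) ?_
    intro c hc
    obtain ⟨j, B, hB, hBt⟩ := (Finset.mem_filter.1 hc).2
    exact ⟨θ j, B, hB, hBt⟩
  have hptE : ∀ v, ∑ c, (sel c ⁻¹' Bad).indicator (1 : (ι → E × E) → ENNReal) v
      ≤ 2 ^ Fintype.card ι * (few.indicator 1 v + ENNReal.ofReal δ) := by
    intro v
    have h1 : ∑ c, (sel c ⁻¹' Bad).indicator (1 : (ι → E × E) → ENNReal) v
        = ((Finset.univ.filter fun c => sel c v ∈ Bad).card : ENNReal) := by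
      simp [Set.indicator_apply, Finset.sum_boole]
    rw [h1]
    by_cases hv : v ∈ few
    · rw [Set.indicator_of_mem hv]
      calc ((Finset.univ.filter fun c => sel c v ∈ Bad).card : ENNReal)
          ≤ ((Finset.univ : Finset (ι → Bool)).card : ENNReal) := by
            exact_mod_cast Finset.card_filter_le _ _
        _ = 2 ^ Fintype.card ι * 1 := by simp
        _ ≤ _ := by
            gcongr
            simp
    · rw [Set.indicator_of_notMem hv, zero_add, ← ENNReal.ofReal_natCast]
      refine (ENNReal.ofReal_le_ofReal (hpt v hv)).trans ?_
      rw [ENNReal.ofReal_mul (by positivity), ENNReal.ofReal_pow (by norm_num)]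
      simp
  have hsum : (2 ^ Fintype.card ι : ENNReal) * Measure.pi (fun _ : ι => ν) Bad
      = ∑ c, μ (sel c ⁻¹' Bad) := by
    have : ∀ c, μ (sel c ⁻¹' Bad) = Measure.pi (fun _ : ι => ν) Bad := fun c =>
      (hmp c).measure_preimage hBadm.nullMeasurableSet
    rw [Finset.sum_congr rfl fun c _ => this c]
    simp
  have hle : (2 ^ Fintype.card ι : ENNReal) * Measure.pi (fun _ : ι => ν) Bad
      ≤ 2 ^ Fintype.card ι * (μ few + ENNReal.ofReal δ) := by
    rw [hsum]
    calc ∑ c, μ (sel c ⁻¹' Bad) = ∑ c, ∫⁻ v, (sel c ⁻¹' Bad).indicator 1 v ∂μ := by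
          refine Finset.sum_congr rfl fun c _ => ?_
          rw [lintegral_indicator_one ((hmp c).measurable hBadm)]
      _ = ∫⁻ v, ∑ c, (sel c ⁻¹' Bad).indicator 1 v ∂μ := by
          rw [lintegral_finsetSum]
          exact fun c _ => measurable_one.indicator ((hmp c).measurable hBadm)
      _ ≤ ∫⁻ v, 2 ^ Fintype.card ι * (few.indicator 1 v + ENNReal.ofReal δ) ∂μ :=
          lintegral_mono hptE
      _ = 2 ^ Fintype.card ι * (∫⁻ v, few.indicator 1 v ∂μ + ENNReal.ofReal δ) := by
          rw [lintegral_const_mul' _ _ (by simp), lintegral_add_right _ measurable_const,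
            lintegral_const, measure_univ, mul_one]
      _ ≤ _ := by
          gcongr
          exact lintegral_indicator_one_le _
  have h2 : (2 ^ Fintype.card ι : ENNReal) ≠ 0 := by simp
  have h3 : (2 ^ Fintype.card ι : ENNReal) ≠ ⊤ := by simp
  refine ((ENNReal.mul_le_mul_iff_right h2 h3).1 hle).trans ?_
  rw [ENNReal.ofReal_add (by positivity) hδ0]
  gcongr
  exact measure_few_goodCoins_le ν hk hτb hq hw

end Anticoncentration

/-! ### The mass of the unstable set -/

section Unstable

variable {E : Type*} [MeasurableSpace E]

/-- The sum of the kernels centred at the sample points. -/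
def kernSum {ι : Type*} [Fintype ι] (kern : E → E → ℝ) (y : ι → E) (z : E) : ℝ :=
  ∑ i, kern z (y i)

/-- The points at which a sign of the polynomial or of one of its derivatives changes when the
sum increases by `t`. -/
def unstableSet {p : ℕ} (θ : Fin (p + 1) × Fin (p + 1) → ℝ) (ψ s : E → ℝ) (t : ℝ) : Set E :=
  {z | ¬ TowerAgree p (sectionPoly θ (ψ z)) (s z) (s z + t)}

theorem measurable_kernSum {ι : Type*} [Fintype ι] {kern : E → E → ℝ}
    (hk : Measurable (Function.uncurry kern)) :
    Measurable fun q : (ι → E) × E => kernSum kern q.1 q.2 :=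
  Finset.measurable_sum _ fun i _ =>
    hk.comp (measurable_snd.prodMk ((measurable_pi_apply i).comp measurable_fst))

theorem measurableSet_unstableSet_prod {ι : Type*} [Fintype ι] {kern : E → E → ℝ}
    (hk : Measurable (Function.uncurry kern)) {p : ℕ} (θ : Fin (p + 1) × Fin (p + 1) → ℝ)
    {ψ : E → ℝ} (hψ : Measurable ψ) (t : ℝ) :
    MeasurableSet {q : (ι → E) × E | q.2 ∈ unstableSet θ ψ (kernSum kern q.1) t} := by
  have h : Measurable fun q : (ι → E) × E => (ψ q.2, kernSum kern q.1 q.2) :=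
    (hψ.comp measurable_snd).prodMk (measurable_kernSum hk)
  exact (h (measurableSet_towerAgree θ t)).compl

theorem measurableSet_unstableSet {p : ℕ} (θ : Fin (p + 1) × Fin (p + 1) → ℝ) {ψ s : E → ℝ}
    (hψ : Measurable ψ) (hs : Measurable s) (t : ℝ) : MeasurableSet (unstableSet θ ψ s t) :=
  ((hψ.prodMk hs) (measurableSet_towerAgree θ t)).compl

theorem measurable_hits_prod {Y κ : Type*} [Fintype κ] [MeasurableSpace Y] {A : Y → Set E}
    (hA : MeasurableSet {q : Y × E | q.2 ∈ A q.1}) :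
    Measurable fun q : Y × (κ → E) => hits (A q.1) q.2 := by
  refine Finset.measurable_sum _ fun k _ => ?_
  have h1 : Measurable fun q : Y × (κ → E) => (q.1, q.2 k) :=
    measurable_fst.prodMk ((measurable_pi_apply k).comp measurable_snd)
  have h2 : (fun q : Y × (κ → E) => (A q.1).indicator (fun _ => (1 : ℝ)) (q.2 k))
      = ({q : Y × E | q.2 ∈ A q.1}.indicator fun _ => (1 : ℝ)) ∘ fun q => (q.1, q.2 k) := by
    funext q
    by_cases h : q.2 k ∈ A q.1
    · have h' : (q.1, q.2 k) ∈ {q : Y × E | q.2 ∈ A q.1} := h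
      rw [Function.comp_apply, Set.indicator_of_mem h, Set.indicator_of_mem h']
    · have h' : (q.1, q.2 k) ∉ {q : Y × E | q.2 ∈ A q.1} := h
      rw [Function.comp_apply, Set.indicator_of_notMem h, Set.indicator_of_notMem h']
  rw [h2]
  exact (measurable_const.indicator hA).comp h1

theorem measure_pi_pair_le {κ : Type*} [Fintype κ] [DecidableEq κ] (ν : Measure E)
    [IsProbabilityMeasure ν]
    {D : Set (E × E)} (hD : MeasurableSet D) :
    Measure.pi (fun _ : κ => ν) {x | ∃ k l, k ≠ l ∧ (x k, x l) ∈ D}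
      ≤ (Fintype.card κ : ENNReal) ^ 2 * (ν.prod ν) D := by
  have hcov : {x : κ → E | ∃ k l, k ≠ l ∧ (x k, x l) ∈ D}
      ⊆ ⋃ k, ⋃ l, {x : κ → E | k ≠ l ∧ (x k, x l) ∈ D} := by
    rintro x ⟨k, l, h⟩
    exact Set.mem_iUnion₂.2 ⟨k, l, h⟩
  have hone : ∀ k l, Measure.pi (fun _ : κ => ν) {x : κ → E | k ≠ l ∧ (x k, x l) ∈ D}
      ≤ (ν.prod ν) D := by
    intro k l
    by_cases hkl : k = l
    · simp [hkl]
    have hind := (iIndepFun_pi (μ := fun _ : κ => ν) (X := fun _ => (id : E → E))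
      fun _ => measurable_id.aemeasurable).indepFun hkl
    have hmap := (indepFun_iff_map_prod_eq_prod_map_map (measurable_pi_apply k).aemeasurable
      (measurable_pi_apply l).aemeasurable).1 hind
    have hk := (measurePreserving_eval (fun _ : κ => ν) k).map_eq
    have hl := (measurePreserving_eval (fun _ : κ => ν) l).map_eq
    have hmap' : (Measure.pi fun _ : κ => ν).map (fun x => (x k, x l)) = ν.prod ν := by
      refine hmap.trans ?_
      change ((Measure.pi fun _ : κ => ν).map (Function.eval k)).prod
        ((Measure.pi fun _ : κ => ν).map (Function.eval l)) = _
      rw [hk, hl]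
    rw [← hmap', Measure.map_apply
      ((measurable_pi_apply k).prodMk (measurable_pi_apply l)) hD]
    exact measure_mono fun x hx => hx.2
  refine (measure_mono hcov).trans ((measure_iUnion_fintype_le _ _).trans ?_)
  calc _ ≤ ∑ _k : κ, ∑ _l : κ, (ν.prod ν) D :=
        Finset.sum_le_sum fun k _ => (measure_iUnion_fintype_le _ _).trans
          (Finset.sum_le_sum fun l _ => hone k l)
    _ = _ := by simp [sq, mul_assoc]

/-- Independent ghost points turn mass into counts: an unstable set of mass more than `ε / 2` inside
`Γ` is hit by at least `ρ + R` of `m` ghost points with probability at least one half. For fixed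
ghost points without close pairs this is improbable by the coin argument, and Fubini connects the
two views. The restriction to `Γ` secures enough coins at each ghost point that is used. -/
theorem measure_exists_unstable_gt_le {ι : Type*} [Fintype ι] (ν : Measure E)
    [IsProbabilityMeasure ν] {kern : E → E → ℝ} (hk : Measurable (Function.uncurry kern)) {M : ℝ}
    (hk0 : ∀ x y, 0 ≤ kern x y) (hkM : ∀ x y, kern x y ≤ M)
    {b τ t : ℝ} (hb : 0 < b) (hτ : 0 ≤ τ) (hτb : τ < b) (ht : 0 < t) {m : ℕ}
    (hτb' : 4 * m * τ ≤ b) {q : ℝ} {Γ : Set E} (hΓm : MeasurableSet Γ)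
    {D : Set (E × E)} (hDm : MeasurableSet D)
    (hD : (m : ENNReal) ^ 2 * (ν.prod ν) D ≤ ENNReal.ofReal (1 / 4))
    (hq : ∀ x : Fin m → E, (∀ k l, k ≠ l → (x k, x l) ∉ D) → ∀ k : {k // x k ∈ Γ},
      q ≤ (ν.prod ν).real (coinPairs kern b τ (fun l : {l // x l ∈ Γ} => x l) k))
    {p G w ρ R : ℕ}
    (hw : (w : ℝ) ≤ Fintype.card ι * q / 4) (hG : Fintype.card ι * M < G * t)
    {ψ : E → ℝ} (hψ : Measurable ψ) {Θ : Type*} [Countable Θ]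
    (θ : Θ → Fin (p + 1) × Fin (p + 1) → ℝ)
    {ε : ℝ} (hε : 0 < ε) (hΓ : ν.real Γᶜ ≤ ε / 2) (hm : 16 ≤ ε ^ 2 * m)
    (hρR : (ρ + R : ℝ) ≤ ε * m / 4) :
    Measure.pi (fun _ : ι => ν)
      {y | ∃ j, ε < ν.real (unstableSet (θ j) ψ (kernSum kern y) t)}
      ≤ ENNReal.ofReal (2 * (2 ^ m * Real.exp (-((ρ + 1) * (Fintype.card ι * q / 4)))
        + coinBound p m G w R b t)) := by
  classical
  have hm0 : (0 : ℝ) < m := by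
    by_contra h
    nlinarith [sq_nonneg ε]
  set δ := 2 ^ m * Real.exp (-((ρ + 1) * (Fintype.card ι * q / 4))) + coinBound p m G w R b t
    with hδ
  set U : Θ → (ι → E) → Set E := fun j y => unstableSet (θ j) ψ (kernSum kern y) t ∩ Γ with hU
  have hUm : ∀ j, MeasurableSet {r : (ι → E) × E | r.2 ∈ U j r.1} := fun j =>
    (measurableSet_unstableSet_prod hk (θ j) hψ t).inter (measurable_snd hΓm)
  set μ := Measure.pi fun _ : ι => ν with hμ
  set μ' := Measure.pi fun _ : Fin m => ν with hμ'
  set B : Set (ι → E) := {y | ∃ j, ε / 2 < ν.real (U j y)} with hB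
  have hBm : MeasurableSet B := by
    rw [hB, Set.ofPred_exists]
    refine MeasurableSet.iUnion fun j => measurableSet_lt measurable_const ?_
    exact (measurable_measure_prodMk_left (hUm j)).ennreal_toReal
  have hsub : {y | ∃ j, ε < ν.real (unstableSet (θ j) ψ (kernSum kern y) t)} ⊆ B := by
    rintro y ⟨j, hj⟩
    refine ⟨j, ?_⟩
    have h1 : ν.real (unstableSet (θ j) ψ (kernSum kern y) t) ≤ ν.real (U j y) + ν.real Γᶜ := by
      refine (measureReal_mono ?_ (measure_ne_top _ _)).trans (measureReal_union_le _ _)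
      intro z hz
      by_cases hzΓ : z ∈ Γ
      · exact Or.inl ⟨hz, hzΓ⟩
      · exact Or.inr hzΓ
    linarith
  set N : Set (Fin m → E) := {x | ∃ k l, k ≠ l ∧ (x k, x l) ∈ D} with hN
  have hNm : MeasurableSet N := by
    rw [hN]
    simp only [Set.ofPred_exists]
    refine MeasurableSet.iUnion fun k => MeasurableSet.iUnion fun l => ?_
    exact (MeasurableSet.const _).inter
      (((measurable_pi_apply k).prodMk (measurable_pi_apply l)) hDm)
  have hNle : μ' N ≤ ENNReal.ofReal (1 / 4) := by
    refine (measure_pi_pair_le ν hDm).trans ?_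
    simpa using hD
  set C : Set ((ι → E) × (Fin m → E)) := {r | r.2 ∉ N ∧ ∃ j, (ρ + R : ℝ) ≤ hits (U j r.1) r.2}
    with hC
  have hCm : MeasurableSet C := by
    refine (measurable_snd hNm).compl.inter ?_
    have : MeasurableSet {r : (ι → E) × (Fin m → E) | ∃ j, (ρ + R : ℝ) ≤ hits (U j r.1) r.2} := by
      rw [Set.ofPred_exists]
      exact MeasurableSet.iUnion fun j => measurableSet_le measurable_const
        (measurable_hits_prod (hUm j))
    exact this
  have hupper : μ.prod μ' C ≤ ENNReal.ofReal δ := by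
    rw [Measure.prod_apply_symm hCm]
    calc _ ≤ ∫⁻ _, ENNReal.ofReal δ ∂μ' := by
          refine lintegral_mono fun x => ?_
          by_cases hx : x ∈ N
          · have : (fun y => (y, x)) ⁻¹' C = ∅ := by
              ext y
              simp [hC, hx]
            simp only [this, measure_empty, zero_le]
          have hx' : ∀ k l, k ≠ l → (x k, x l) ∉ D := fun k l hkl h => hx ⟨k, l, hkl, h⟩
          have hcard : Fintype.card {k // x k ∈ Γ} ≤ m := by
            simpa using Fintype.card_subtype_le fun k => x k ∈ Γ
          have hcard' : (Fintype.card {k // x k ∈ Γ} : ℝ) ≤ m := by exact_mod_cast hcard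
          have key := measure_exists_not_towerAgree_le (κ := {k // x k ∈ Γ}) (ι := ι) ν
            (fun z => hk.of_uncurry_left) hk0 hkM hb hτ hτb ht
            (le_trans (by gcongr) hτb') (hq x hx') (p := p) (ρ := ρ) (R := R) hw hG
            (fun k => ψ (x k)) θ
          refine le_trans (measure_mono ?_) (key.trans (ENNReal.ofReal_le_ofReal ?_))
          · rintro y ⟨-, j, hj⟩
            refine ⟨j, Finset.univ.filter fun k => x k ∈ unstableSet (θ j) ψ (kernSum kern y) t,
              ?_, fun k hk => (Finset.mem_filter.1 hk).2⟩
            have h1 : hits (U j y) x = ((Finset.univ.filter fun k : {k // x k ∈ Γ} =>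
                x k ∈ unstableSet (θ j) ψ (kernSum kern y) t).card : ℝ) := by
              rw [hits_eq_card]
              congr 1
              symm
              refine Finset.card_bij (fun k _ => (k : Fin m)) ?_ ?_ ?_
              · intro k hk
                exact Finset.mem_filter.2 ⟨Finset.mem_univ _, (Finset.mem_filter.1 hk).2, k.2⟩
              · intro k _ l _ h
                exact Subtype.ext h
              · intro k hk
                obtain ⟨h1, h2⟩ := (Finset.mem_filter.1 hk).2
                exact ⟨⟨k, h2⟩, Finset.mem_filter.2 ⟨Finset.mem_univ _, h1⟩, rfl⟩
            have hj' : (ρ + R : ℝ) ≤ hits (U j y) x := hj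
            rw [h1] at hj'
            exact_mod_cast hj'
          · rw [hδ]
            gcongr
            · norm_num
            · exact coinBound_mono hcard
      _ = _ := by simp
  have hlower : ∀ y ∈ B, (2 : ENNReal)⁻¹ ≤ μ' (Prod.mk y ⁻¹' C) := by
    rintro y ⟨j, hj⟩
    have hUj : MeasurableSet (U j y) := measurable_prodMk_left (hUm j)
    have h1 := measure_hits_dev_le (κ := Fin m) ν hUj (s := ε * m / 4) (by positivity)
    rw [Fintype.card_fin, ← hμ'] at h1
    have h2 : ENNReal.ofReal (m / (4 * (ε * m / 4) ^ 2)) ≤ ENNReal.ofReal (1 / 4) := by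
      refine ENNReal.ofReal_le_ofReal ?_
      rw [div_le_div_iff₀ (by positivity) (by norm_num)]
      nlinarith
    set F := {x : Fin m → E | ε * m / 4 ≤ |hits (U j y) x - m * ν.real (U j y)|} with hF
    have hFm : MeasurableSet F :=
      measurableSet_le measurable_const ((measurable_hits hUj).sub_const _).abs
    have h3 : (F ∪ N)ᶜ ⊆ Prod.mk y ⁻¹' C := by
      intro x hx
      simp only [Set.mem_compl_iff, Set.mem_union, not_or, hF, Set.mem_ofPred_eq, not_le] at hx
      refine ⟨hx.2, j, ?_⟩
      have h4 := (abs_lt.1 hx.1).1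
      have h5 : ε / 2 * m ≤ m * ν.real (U j y) := by
        rw [mul_comm]
        exact mul_le_mul_of_nonneg_left hj.le hm0.le
      change (ρ + R : ℝ) ≤ hits (U j y) x
      linarith
    refine le_trans ?_ (measure_mono h3)
    rw [prob_compl_eq_one_sub (hFm.union hNm)]
    -- One quarter for the Chebyshev deviation, one quarter for a close pair of ghost points.
    have h4 : μ' (F ∪ N) ≤ 2⁻¹ := by
      refine (measure_union_le _ _).trans ((add_le_add (h1.trans h2) hNle).trans ?_)
      rw [← ENNReal.ofReal_add (by norm_num) (by norm_num),
        show (1 / 4 + 1 / 4 : ℝ) = 2⁻¹ by norm_num, ENNReal.ofReal_inv_of_pos (by norm_num)]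
      simp
    calc (2 : ENNReal)⁻¹ = 1 - 2⁻¹ := by rw [ENNReal.one_sub_inv_two]
      _ ≤ _ := tsub_le_tsub_left h4 1
  have hprod : 2⁻¹ * μ B ≤ μ.prod μ' C := by
    rw [Measure.prod_apply hCm, ← lintegral_indicator_const hBm]
    refine lintegral_mono fun x => ?_
    by_cases hx : x ∈ B
    · simpa [hx] using hlower x hx
    · simp [hx]
  calc _ ≤ μ B := measure_mono hsub
    _ = 2 * (2⁻¹ * μ B) := by
        rw [← mul_assoc, ENNReal.mul_inv_cancel (by norm_num) (by norm_num), one_mul]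
    _ ≤ 2 * ENNReal.ofReal δ := by
        gcongr
        exact hprod.trans hupper
    _ = _ := by
        rw [show (2 : ENNReal) = ENNReal.ofReal 2 by simp, ← ENNReal.ofReal_mul (by norm_num)]

end Unstable

/-! ### Crowded points of a sample -/

section Sequential

variable {κ E : Type*} [Fintype κ] [DecidableEq κ] [MeasurableSpace E]

/-- A substitute for independence. The event of highest rank is integrated first, over its own
coordinate, on which the other events do not depend; this yields one factor `q`, and induction does
the rest. -/
theorem measure_forall_mem_le_pow (ν : Measure E) [IsProbabilityMeasure ν] {Q : κ → Set (κ → E)}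
    (hQm : ∀ k, MeasurableSet (Q k)) {rank : κ → ℕ} (hrank : Function.Injective rank)
    (hdep : ∀ k l, rank l < rank k → ∀ x z, Function.update x k z ∈ Q l ↔ x ∈ Q l)
    {q : ENNReal} (hq : ∀ k x, ν {z | Function.update x k z ∈ Q k} ≤ q) (T : Finset κ) :
    Measure.pi (fun _ : κ => ν) (⋂ k ∈ T, Q k) ≤ q ^ T.card := by
  induction hn : T.card generalizing T with
  | zero =>
    rw [Finset.card_eq_zero.1 hn]
    simp
  | succ n ih =>
    have hne : T.Nonempty := Finset.card_pos.1 (by omega)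
    obtain ⟨k, hkT, hkmax⟩ := Finset.exists_max_image T rank hne
    have hT' : (T.erase k).card = n := by rw [Finset.card_erase_of_mem hkT]; omega
    set R : Set (κ → E) := ⋂ l ∈ T.erase k, Q l with hR
    have hRm : MeasurableSet R := MeasurableSet.biInter (Finset.countable_toSet _) fun l _ => hQm l
    have hsplit : (⋂ l ∈ T, Q l) = Q k ∩ R := by
      rw [hR, ← Finset.set_biInter_insert, Finset.insert_erase hkT]
    have hRdep : ∀ x z, Function.update x k z ∈ R ↔ x ∈ R := by
      intro x z
      simp only [hR, Set.mem_iInter]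
      refine forall₂_congr fun l hl => hdep k l ?_ x z
      exact lt_of_le_of_ne (hkmax l (Finset.mem_of_mem_erase hl))
        fun h => Finset.ne_of_mem_erase hl (hrank h)
    have hle : ∫⁻ x, (Q k ∩ R).indicator 1 x ∂Measure.pi (fun _ : κ => ν)
        ≤ ∫⁻ x, q * R.indicator 1 x ∂Measure.pi (fun _ : κ => ν) := by
      refine lintegral_le_of_lmarginal_le {k} (measurable_one.indicator ((hQm k).inter hRm))
        ((measurable_one.indicator hRm).const_mul q) fun x => ?_
      rw [lmarginal_singleton, lmarginal_singleton]
      by_cases hx : x ∈ R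
      · have h1 : ∀ z, (Q k ∩ R).indicator (1 : (κ → E) → ENNReal) (Function.update x k z)
            = {z | Function.update x k z ∈ Q k}.indicator 1 z := by
          intro z
          have h2 : Function.update x k z ∈ R := (hRdep x z).2 hx
          by_cases hz : Function.update x k z ∈ Q k
          · rw [Set.indicator_of_mem (show Function.update x k z ∈ Q k ∩ R from ⟨hz, h2⟩),
              Set.indicator_of_mem (by exact hz)]; rfl
          · rw [Set.indicator_of_notMem (fun h : Function.update x k z ∈ Q k ∩ R => hz h.1),
              Set.indicator_of_notMem (by exact hz)]
        have h3 : ∀ z, R.indicator (1 : (κ → E) → ENNReal) (Function.update x k z) = 1 :=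
          fun z => Set.indicator_of_mem ((hRdep x z).2 hx) _
        simp_rw [h1, h3]
        have hms : MeasurableSet {z | Function.update x k z ∈ Q k} := measurable_update x (hQm k)
        rw [lintegral_indicator_one hms]
        simpa using hq k x
      · have h1 : ∀ z, (Q k ∩ R).indicator (1 : (κ → E) → ENNReal) (Function.update x k z) = 0 :=
          fun z => Set.indicator_of_notMem (fun h => hx ((hRdep x z).1 h.2)) _
        simp_rw [h1]
        simp
    rw [lintegral_indicator_one ((hQm k).inter hRm), lintegral_const_mul _
      (measurable_one.indicator hRm), lintegral_indicator_one hRm] at hle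
    rw [hsplit]
    calc _ ≤ q * Measure.pi (fun _ : κ => ν) R := hle
      _ ≤ q * q ^ n := by gcongr; exact ih _ hT'
      _ = _ := by rw [pow_succ, mul_comm]

open scoped Classical in
theorem measure_card_mem_ge_le (ν : Measure E) [IsProbabilityMeasure ν] {Q : κ → Set (κ → E)}
    (hQm : ∀ k, MeasurableSet (Q k)) {rank : κ → ℕ} (hrank : Function.Injective rank)
    (hdep : ∀ k l, rank l < rank k → ∀ x z, Function.update x k z ∈ Q l ↔ x ∈ Q l)
    {q : ENNReal} (hq : ∀ k x, ν {z | Function.update x k z ∈ Q k} ≤ q) (c : ℕ) :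
    Measure.pi (fun _ : κ => ν) {x | c ≤ (Finset.univ.filter fun k => x ∈ Q k).card}
      ≤ 2 ^ Fintype.card κ * q ^ c := by
  have hcov : {x | c ≤ (Finset.univ.filter fun k => x ∈ Q k).card}
      ⊆ ⋃ T ∈ Finset.powersetCard c (Finset.univ : Finset κ), ⋂ k ∈ T, Q k := by
    intro x hx
    obtain ⟨T, hT, hTc⟩ := Finset.exists_subset_card_eq (show c ≤ _ from hx)
    exact Set.mem_iUnion₂.2 ⟨T, Finset.mem_powersetCard.2 ⟨Finset.subset_univ _, hTc⟩,
      Set.mem_iInter₂.2 fun k hk => (Finset.mem_filter.1 (hT hk)).2⟩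
  refine (measure_mono hcov).trans ((measure_biUnion_finset_le _ _).trans
    ((Finset.sum_le_card_nsmul _ _ (q ^ c) fun T hT => ?_).trans ?_))
  · rw [← (Finset.mem_powersetCard.1 hT).2]
    exact measure_forall_mem_le_pow ν hQm hrank hdep hq T
  · rw [nsmul_eq_mul, Finset.card_powersetCard, Finset.card_univ]
    gcongr
    exact_mod_cast Nat.choose_le_two_pow _ _

end Sequential

section Crowding

variable {E : Type*} [MeasurableSpace E]

-- The terms of `kernSum kern x (x k)` come from predecessors of `k`, from successors, and from `k`
-- itself, the last at most `M`. If the sum exceeds `t`, then predecessors or successors contribute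
-- more than `(t - M) / 2`, and each of these two alternatives is a sequential event for one order
-- of the indices.
open scoped Classical in
theorem measure_crowded_le {m : ℕ} (ν : Measure E) [IsProbabilityMeasure ν] {kern : E → E → ℝ}
    (hk : Measurable (Function.uncurry kern)) {M : ℝ} (hkM : ∀ x y, kern x y ≤ M) {t : ℝ}
    {q : ENNReal}
    (hq : ∀ (a : Fin m → E) (T : Finset (Fin m)), ν {z | (t - M) / 2 < ∑ l ∈ T, kern z (a l)} ≤ q)
    {c : ℕ} :
    Measure.pi (fun _ : Fin m => ν)
      {x | 2 * c ≤ (Finset.univ.filter fun k => t < kernSum kern x (x k)).card}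
      ≤ 2 * (2 ^ m * q ^ c) := by
  have hmain : ∀ (rank : Fin m → ℕ), Function.Injective rank → Measure.pi (fun _ : Fin m => ν)
      {x | c ≤ (Finset.univ.filter fun k => x ∈ {x : Fin m → E | (t - M) / 2 <
        ∑ l with rank l < rank k, kern (x k) (x l)}).card} ≤ 2 ^ m * q ^ c := by
    intro rank hrank
    have h := measure_card_mem_ge_le ν (Q := fun k => {x : Fin m → E | (t - M) / 2 <
        ∑ l with rank l < rank k, kern (x k) (x l)}) (q := q) ?_ hrank ?_ ?_ c
    · simpa using h
    · intro k
      refine measurableSet_lt measurable_const (Finset.measurable_sum _ fun l _ => ?_)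
      have : Measurable fun x : Fin m → E => Function.uncurry kern (x k, x l) :=
        hk.comp ((measurable_pi_apply k).prodMk (measurable_pi_apply l))
      exact this
    · intro k l hlk x z
      have hl : l ≠ k := fun h => by simp [h] at hlk
      have : ∑ i with rank i < rank l, kern (Function.update x k z l) (Function.update x k z i)
          = ∑ i with rank i < rank l, kern (x l) (x i) := by
        refine Finset.sum_congr rfl fun i hi => ?_
        have hi : rank i < rank l := (Finset.mem_filter.1 hi).2
        have hik : i ≠ k := fun h => by rw [h] at hi; omega
        rw [Function.update_of_ne hl, Function.update_of_ne hik]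
      simp only [Set.mem_ofPred_eq, this]
    · intro k x
      refine le_of_eq_of_le ?_ (hq x (Finset.univ.filter fun l => rank l < rank k))
      congr 1
      ext z
      have : ∑ i with rank i < rank k, kern (Function.update x k z k) (Function.update x k z i)
          = ∑ i with rank i < rank k, kern z (x i) := by
        refine Finset.sum_congr rfl fun i hi => ?_
        have hi : rank i < rank k := (Finset.mem_filter.1 hi).2
        have hik : i ≠ k := fun h => by rw [h] at hi; omega
        rw [Function.update_self, Function.update_of_ne hik]
      simp only [Set.mem_ofPred_eq, this]
  -- The natural order and the reversed one; `m - k` is injective because all indices are below `m`.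
  obtain ⟨r₁, hr₁⟩ : ∃ r : Fin m → ℕ, ∀ k, r k = k := ⟨fun k => k, fun _ => rfl⟩
  obtain ⟨r₂, hr₂⟩ : ∃ r : Fin m → ℕ, ∀ k, r k = m - k := ⟨fun k => m - k, fun _ => rfl⟩
  have h1 := hmain r₁ fun k l h => Fin.ext (by rwa [hr₁, hr₁] at h)
  have h2 := hmain r₂ fun k l h => Fin.ext (by rw [hr₂, hr₂] at h; omega)
  rw [two_mul (2 ^ m * q ^ c)]
  refine le_trans (measure_mono ?_) ((measure_union_le _ _).trans (add_le_add h1 h2))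
  intro x hx
  by_contra hn
  simp only [Set.mem_union, Set.mem_ofPred_eq, not_or, not_le] at hn hx
  have hsub : (Finset.univ.filter fun k => t < kernSum kern x (x k)) ⊆
      (Finset.univ.filter fun k => (t - M) / 2 < ∑ l with r₁ l < r₁ k, kern (x k) (x l)) ∪
      (Finset.univ.filter fun k => (t - M) / 2 < ∑ l with r₂ l < r₂ k, kern (x k) (x l)) := by
    intro k hk
    have hk := (Finset.mem_filter.1 hk).2
    rw [Finset.mem_union, Finset.mem_filter, Finset.mem_filter]
    by_contra hnot
    simp only [Finset.mem_univ, true_and, not_or, not_lt] at hnot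
    have hsum : kernSum kern x (x k) = ∑ l with r₁ l < r₁ k, kern (x k) (x l)
        + ∑ l with r₂ l < r₂ k, kern (x k) (x l) + kern (x k) (x k) := by
      rw [kernSum, ← Finset.sum_filter_add_sum_filter_not Finset.univ fun l => r₁ l < r₁ k,
        add_assoc]
      congr 1
      have : (Finset.univ.filter fun l => ¬ r₁ l < r₁ k)
          = insert k (Finset.univ.filter fun l => r₂ l < r₂ k) := by
        ext l
        simp only [Finset.mem_filter, Finset.mem_univ, true_and, Finset.mem_insert, Fin.ext_iff,
          hr₁, hr₂]
        have := l.2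
        have := k.2
        omega
      rw [this, Finset.sum_insert (by simp), add_comm]
    have := hkM (x k) (x k)
    linarith
  have := (Finset.card_le_card hsub).trans (Finset.card_union_le _ _)
  omega

end Crowding

/-! ### Deviations on a block that contributes to its own kernel sum -/

section Block

variable {E : Type*} [MeasurableSpace E]

/-- The points at which the polynomial is positive. -/
def posSet {p : ℕ} (θ : Fin (p + 1) × Fin (p + 1) → ℝ) (ψ s : E → ℝ) : Set E :=
  {z | 0 < (sectionPoly θ (ψ z)).eval (s z)}

theorem mem_posSet {E : Type*} {p : ℕ} {θ : Fin (p + 1) × Fin (p + 1) → ℝ} {ψ s : E → ℝ} {z : E} :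
    z ∈ posSet θ ψ s ↔ 0 < θ ⬝ᵥ derivVec p 0 (ψ z) (s z) := by
  rw [← eval_iterate_derivative_sectionPoly]
  rfl

theorem measurableSet_posSet {p : ℕ} (θ : Fin (p + 1) × Fin (p + 1) → ℝ) {ψ s : E → ℝ}
    (hψ : Measurable ψ) (hs : Measurable s) : MeasurableSet (posSet θ ψ s) := by
  have : posSet θ ψ s = {z | 0 < θ ⬝ᵥ derivVec p 0 (ψ z) (s z)} := Set.ext fun z => mem_posSet
  rw [this]
  exact measurableSet_lt measurable_const ((measurable_dotProduct_derivVec θ 0).comp (hψ.prodMk hs))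

theorem mem_posSet_iff_of_notMem_unstableSet {E : Type*} {p : ℕ} {θ : Fin (p + 1) × Fin (p + 1) → ℝ}
    {ψ s s' : E → ℝ} {t : ℝ} {z : E} (h : z ∉ unstableSet θ ψ s t) (h₁ : s z ≤ s' z)
    (h₂ : s' z ≤ s z + t) : z ∈ posSet θ ψ s ↔ z ∈ posSet θ ψ s' := by
  have h := (not_not.1 h : TowerAgree p (sectionPoly θ (ψ z)) (s z) (s z + t)).of_le
    (natDegree_sectionPoly_le θ _) h₁ h₂ 0 (Nat.zero_le _)
  exact (sign_eq_sign_iff_pos_iff.1 h).1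

/-- The positive sets for `s` and `s'` agree off the unstable set and off the points where the
increment exceeds `t`. The constant `6` consists of `1` for the deviation with `s`, `2` and `1` for
frequency and mass of the unstable set, and `1` each for frequency and mass of the large increments.
-/
theorem abs_hits_posSet_sub_le {κ : Type*} [Fintype κ] (ν : Measure E) [IsProbabilityMeasure ν]
    {p : ℕ} {θ : Fin (p + 1) × Fin (p + 1) → ℝ} {ψ s s' : E → ℝ} (hs : ∀ z, s z ≤ s' z) {x : κ → E}
    {δ t : ℝ}
    (h₁ : |hits (posSet θ ψ s) x - Fintype.card κ * ν.real (posSet θ ψ s)|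
      ≤ δ * Fintype.card κ)
    (h₂ : |hits (unstableSet θ ψ s t) x - Fintype.card κ * ν.real (unstableSet θ ψ s t)|
      ≤ δ * Fintype.card κ)
    (h₃ : ν.real (unstableSet θ ψ s t) ≤ δ)
    (h₄ : hits {z | s z + t < s' z} x ≤ δ * Fintype.card κ)
    (h₅ : ν.real {z | s z + t < s' z} ≤ δ) :
    |hits (posSet θ ψ s') x - Fintype.card κ * ν.real (posSet θ ψ s')|
      ≤ 6 * δ * Fintype.card κ := by
  set A := posSet θ ψ s
  set A' := posSet θ ψ s'
  set U := unstableSet θ ψ s t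
  set V := {z | s z + t < s' z}
  have key : ∀ z, z ∉ U ∪ V → (z ∈ A ↔ z ∈ A') := fun z hz => by
    simp only [Set.mem_union, not_or] at hz
    exact mem_posSet_iff_of_notMem_unstableSet hz.1 (hs z) (not_lt.1 hz.2)
  have hAA' : A ⊆ A' ∪ (U ∪ V) := fun z hz => by
    by_cases h : z ∈ U ∪ V
    · exact Or.inr h
    · exact Or.inl ((key z h).1 hz)
  have hA'A : A' ⊆ A ∪ (U ∪ V) := fun z hz => by
    by_cases h : z ∈ U ∪ V
    · exact Or.inr h
    · exact Or.inl ((key z h).2 hz)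
  have e1 : hits A x ≤ hits A' x + (hits U x + hits V x) :=
    (hits_mono hAA' x).trans ((hits_union_le _ _ x).trans (by gcongr; exact hits_union_le _ _ x))
  have e2 : hits A' x ≤ hits A x + (hits U x + hits V x) :=
    (hits_mono hA'A x).trans ((hits_union_le _ _ x).trans (by gcongr; exact hits_union_le _ _ x))
  have e3 : ν.real A ≤ ν.real A' + (ν.real U + ν.real V) :=
    (measureReal_mono hAA').trans ((measureReal_union_le _ _).trans
      (by gcongr; exact measureReal_union_le _ _))
  have e4 : ν.real A' ≤ ν.real A + (ν.real U + ν.real V) :=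
    (measureReal_mono hA'A).trans ((measureReal_union_le _ _).trans
      (by gcongr; exact measureReal_union_le _ _))
  have hc : (0 : ℝ) ≤ Fintype.card κ := Nat.cast_nonneg _
  rw [abs_le] at *
  have e3' := mul_le_mul_of_nonneg_left e3 hc
  have e4' := mul_le_mul_of_nonneg_left e4 hc
  have h3' := mul_le_mul_of_nonneg_left h₃ hc
  have h5' := mul_le_mul_of_nonneg_left h₅ hc
  constructor <;> linarith [h₁.1, h₁.2, h₂.1, h₂.2]

theorem exists_patterns_posSet {E : Type*} {α : Type*} [Fintype α] {p : ℕ} (ψ s : E → ℝ) (z : α → E) :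
    ∃ 𝒜 : Finset (Finset α), 𝒜.card ≤ (Fintype.card α + 1) ^ ((p + 1) ^ 2) ∧
      ∀ θ : Fin (p + 1) × Fin (p + 1) → ℝ, ∃ T ∈ 𝒜, ∀ x, x ∈ T ↔ z x ∈ posSet θ ψ s := by
  classical
  refine ⟨linearPatterns fun a => derivVec p 0 (ψ (z a)) (s (z a)), ?_, fun θ => ?_⟩
  · refine (card_linearPatterns_le _).trans_eq ?_
    simp [sq]
  · refine ⟨Finset.univ.filter fun a => 0 < θ ⬝ᵥ derivVec p 0 (ψ (z a)) (s (z a)),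
      mem_linearPatterns.2 ⟨θ, fun a => by simp⟩, fun x => ?_⟩
    rw [mem_posSet]
    simp

/-- Whether a point is unstable is a Boolean function of the positivity of `4 * (p + 1)` linear
functionals of `θ`: each derivative, at two arguments, with both signs. -/
theorem exists_patterns_unstableSet {E : Type*} {α : Type*} [Fintype α] {p : ℕ} (ψ s : E → ℝ) (t : ℝ)
    (z : α → E) :
    ∃ 𝒜 : Finset (Finset α), 𝒜.card ≤ (4 * (p + 1) * Fintype.card α + 1) ^ ((p + 1) ^ 2) ∧
      ∀ θ : Fin (p + 1) × Fin (p + 1) → ℝ, ∃ T ∈ 𝒜, ∀ x, x ∈ T ↔ z x ∈ unstableSet θ ψ s t := by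
  classical
  let v : α × Fin (p + 1) × Bool × Bool → (Fin (p + 1) × Fin (p + 1)) → ℝ := fun a =>
    (if a.2.2.2 then 1 else -1 : ℝ) • derivVec p a.2.1 (ψ (z a.1))
      (if a.2.2.1 then s (z a.1) + t else s (z a.1))
  let F : Finset (α × Fin (p + 1) × Bool × Bool) → Finset α := fun T =>
    Finset.univ.filter fun a => ¬ ∀ r : Fin (p + 1), ∀ σ : Bool,
      (a, r, false, σ) ∈ T ↔ (a, r, true, σ) ∈ T
  refine ⟨(linearPatterns v).image F, ?_, fun θ => ?_⟩
  · refine Finset.card_image_le.trans ((card_linearPatterns_le _).trans_eq ?_)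
    simp only [Fintype.card_prod, Fintype.card_fin, Fintype.card_bool, sq]
    congr 2
    ring
  · refine ⟨F (Finset.univ.filter fun a => 0 < θ ⬝ᵥ v a), Finset.mem_image_of_mem _
      (mem_linearPatterns.2 ⟨θ, fun a => by simp⟩), fun x => ?_⟩
    simp only [F, Finset.mem_filter, Finset.mem_univ, true_and, unstableSet, Set.mem_ofPred_eq,
      TowerAgree, eval_iterate_derivative_sectionPoly, sign_eq_sign_iff_pos_iff, Bool.forall_bool,
      v, dotProduct_smul, if_true, Bool.false_eq_true, if_false, smul_eq_mul, neg_mul, one_mul]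
    refine not_congr ⟨fun h r hr => ?_, fun h r => ?_⟩
    · have := h ⟨r, Nat.lt_succ_of_le hr⟩
      exact ⟨this.2, this.1⟩
    · have := h r (Nat.lt_succ_iff.1 r.2)
      exact ⟨this.2, this.1⟩

theorem prod_exists_hits_dev_le {Y κ Θ : Type*} [MeasurableSpace Y] [Fintype κ] [Countable Θ]
    (μ : Measure Y) [IsProbabilityMeasure μ] (ν : Measure E) [IsProbabilityMeasure ν]
    {A : Θ → Y → Set E} (hA : ∀ j, MeasurableSet {q : Y × E | q.2 ∈ A j q.1}) {s : ℝ}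
    {β : ENNReal} (h : ∀ y, Measure.pi (fun _ : κ => ν)
      {x | ∃ j, s < |hits (A j y) x - Fintype.card κ * ν.real (A j y)|} ≤ β) :
    (μ.prod (Measure.pi fun _ : κ => ν))
      {r | ∃ j, s < |hits (A j r.1) r.2 - Fintype.card κ * ν.real (A j r.1)|} ≤ β := by
  have hm : MeasurableSet {r : Y × (κ → E) |
      ∃ j, s < |hits (A j r.1) r.2 - Fintype.card κ * ν.real (A j r.1)|} := by
    simp only [Set.ofPred_exists]
    refine MeasurableSet.iUnion fun j => measurableSet_lt measurable_const ?_
    have h1 : Measurable fun r : Y × (κ → E) => ν.real (A j r.1) :=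
      (measurable_measure_prodMk_left (hA j)).ennreal_toReal.comp measurable_fst
    exact continuous_abs.measurable.comp
      ((measurable_hits_prod (hA j)).sub (measurable_const.mul h1))
  rw [Measure.prod_apply hm]
  refine (lintegral_mono fun y => h y).trans ?_
  simp

/-- The bound for the deviation of the class-conditional frequencies within one block. -/
def blockBound (p m : ℕ) (δ : ℝ) : ℝ :=
  8 * (8 * (p + 1) * m + 1) ^ ((p + 1) ^ 2) * Real.exp (-(δ ^ 2 * m / 8))

/-- Given the outside sample, the sets built from its kernel sum are fixed, so the uniform law
applies to them and to their unstable sets on the independent block. The other two terms account for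
an unstable set that is too large and for crowding inside the block. -/
theorem measure_block_dev_le {ι : Type*} [Fintype ι] {m : ℕ} (ν : Measure E)
    [IsProbabilityMeasure ν] {kern : E → E → ℝ} (hk : Measurable (Function.uncurry kern)) {M : ℝ}
    (hk0 : ∀ x y, 0 ≤ kern x y) (hM : 0 ≤ M) (hkM : ∀ x y, kern x y ≤ M) {t : ℝ} {q : ENNReal}
    (hq : ∀ (a : Fin m → E) (T : Finset (Fin m)), ν {z | (t - M) / 2 < ∑ l ∈ T, kern z (a l)} ≤ q)
    (ht : 0 < t)
    {p : ℕ} {ψ : E → ℝ} (hψ : Measurable ψ) {Θ : Type*} [Countable Θ]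
    (θ : Θ → Fin (p + 1) × Fin (p + 1) → ℝ) {δ : ℝ} (hδ : 0 < δ) (hqδ : q ≤ ENNReal.ofReal δ)
    (hm : 2 ≤ δ ^ 2 * m) {c : ℕ} (hc : 2 * c ≤ δ * m) {η : ENNReal}
    (hη : Measure.pi (fun _ : ι => ν)
      {y | ∃ j, δ < ν.real (unstableSet (θ j) ψ (kernSum kern y) t)} ≤ η) :
    ((Measure.pi fun _ : ι => ν).prod (Measure.pi fun _ : Fin m => ν))
      {r | ∃ j, 6 * δ * m <
        |hits (posSet (θ j) ψ fun z => kernSum kern r.1 z + kernSum kern r.2 z) r.2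
        - m * ν.real (posSet (θ j) ψ fun z => kernSum kern r.1 z + kernSum kern r.2 z)|}
      ≤ ENNReal.ofReal (blockBound p m δ) + η + 2 * (2 ^ m * q ^ c) := by
  classical
  set μ := Measure.pi fun _ : ι => ν
  set μ' := Measure.pi fun _ : Fin m => ν
  set N : ℝ := (8 * (p + 1) * m + 1) ^ ((p + 1) ^ 2) with hN
  have hcard : Fintype.card (Fin m) = m := Fintype.card_fin m
  have hcard' : Fintype.card (Fin m × Bool) = 2 * m := by simp [mul_comm]
  have hmeas : Measurable fun r : (ι → E) × E => (ψ r.2, kernSum kern r.1 r.2) :=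
    (hψ.comp measurable_snd).prodMk (measurable_kernSum hk)
  have hsm : ∀ y : ι → E, Measurable (kernSum kern y) := fun y =>
    (measurable_kernSum hk).comp measurable_prodMk_left
  have hNle : ∀ k : ℕ, (k : ℝ) ≤ 8 * (p + 1) * m + 1 → (k : ℝ) ^ ((p + 1) ^ 2) ≤ N := fun k hk =>
    pow_le_pow_left₀ (Nat.cast_nonneg _) hk _
  have b1 : (μ.prod μ') {r | ∃ j, δ * m < |hits (posSet (θ j) ψ (kernSum kern r.1)) r.2
      - Fintype.card (Fin m) * ν.real (posSet (θ j) ψ (kernSum kern r.1))|}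
      ≤ ENNReal.ofReal (4 * N * Real.exp (-(δ ^ 2 * m / 8))) := by
    refine prod_exists_hits_dev_le μ ν (A := fun j y => posSet (θ j) ψ (kernSum kern y))
      (fun j => ?_) fun y => ?_
    · have : {r : (ι → E) × E | r.2 ∈ posSet (θ j) ψ (kernSum kern r.1)}
          = (fun r : (ι → E) × E => (ψ r.2, kernSum kern r.1 r.2)) ⁻¹'
            {q | 0 < θ j ⬝ᵥ derivVec p 0 q.1 q.2} := Set.ext fun r => mem_posSet
      rw [this]
      exact hmeas (measurableSet_lt measurable_const (measurable_dotProduct_derivVec (θ j) 0))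
    · have := measure_exists_hits_dev_le (κ := Fin m) ν
        (A := fun j => posSet (θ j) ψ (kernSum kern y))
        (fun j => measurableSet_posSet _ hψ (hsm y)) (N := N) (fun z => ?_) hδ (by rwa [hcard])
      · simpa only [hcard] using this
      · obtain ⟨𝒜, h𝒜, hp⟩ := exists_patterns_posSet (p := p) ψ (kernSum kern y) z
        refine ⟨𝒜, ?_, fun j => hp (θ j)⟩
        refine le_trans (Nat.cast_le.2 h𝒜) ?_
        rw [hcard', Nat.cast_pow]
        refine hNle _ ?_
        push_cast
        nlinarith [(Nat.cast_nonneg m : (0 : ℝ) ≤ m), (Nat.cast_nonneg p : (0 : ℝ) ≤ p),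
          mul_nonneg (Nat.cast_nonneg m : (0 : ℝ) ≤ m) (Nat.cast_nonneg p : (0 : ℝ) ≤ p)]
  have b2 : (μ.prod μ') {r | ∃ j, δ * m < |hits (unstableSet (θ j) ψ (kernSum kern r.1) t) r.2
      - Fintype.card (Fin m) * ν.real (unstableSet (θ j) ψ (kernSum kern r.1) t)|}
      ≤ ENNReal.ofReal (4 * N * Real.exp (-(δ ^ 2 * m / 8))) := by
    refine prod_exists_hits_dev_le μ ν (A := fun j y => unstableSet (θ j) ψ (kernSum kern y) t)
      (fun j => measurableSet_unstableSet_prod hk (θ j) hψ t) fun y => ?_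
    have := measure_exists_hits_dev_le (κ := Fin m) ν
      (A := fun j => unstableSet (θ j) ψ (kernSum kern y) t)
      (fun j => measurableSet_unstableSet _ hψ (hsm y) t) (N := N) (fun z => ?_) hδ (by rwa [hcard])
    · simpa only [hcard] using this
    · obtain ⟨𝒜, h𝒜, hp⟩ := exists_patterns_unstableSet (p := p) ψ (kernSum kern y) t z
      refine ⟨𝒜, ?_, fun j => hp (θ j)⟩
      refine le_trans (Nat.cast_le.2 h𝒜) ?_
      rw [hcard', Nat.cast_pow]
      refine hNle _ ?_
      push_cast
      nlinarith
  have b3 : (μ.prod μ') ({y | ∃ j, δ < ν.real (unstableSet (θ j) ψ (kernSum kern y) t)} ×ˢ Set.univ)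
      ≤ η := by
    rw [Measure.prod_prod]
    simpa using hη
  have b4 : (μ.prod μ') (Set.univ ×ˢ
      {x | 2 * c ≤ (Finset.univ.filter fun k => t < kernSum kern x (x k)).card})
      ≤ 2 * (2 ^ m * q ^ c) := by
    rw [Measure.prod_prod]
    simpa using measure_crowded_le ν hk hkM hq
  have hsum : ENNReal.ofReal (blockBound p m δ)
      = ENNReal.ofReal (4 * N * Real.exp (-(δ ^ 2 * m / 8)))
        + ENNReal.ofReal (4 * N * Real.exp (-(δ ^ 2 * m / 8))) := by
    rw [← ENNReal.ofReal_add (by positivity) (by positivity), blockBound]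
    congr 1
    ring
  rw [hsum]
  refine le_trans (measure_mono ?_) ((measure_union_le _ _).trans (add_le_add
    ((measure_union_le _ _).trans (add_le_add ((measure_union_le _ _).trans (add_le_add b1 b2)) b3))
    b4))
  rintro ⟨y, x⟩ ⟨j, hj⟩
  by_contra hn
  simp only [Set.mem_union, Set.mem_ofPred_eq, Set.mem_prod, Set.mem_univ, and_true, true_and,
    not_or, not_exists, not_lt, not_le] at hn
  obtain ⟨⟨⟨n1, n2⟩, n3⟩, n4⟩ := hn
  have hnn : ∀ z, 0 ≤ kernSum kern x z := fun z => Finset.sum_nonneg fun _ _ => hk0 _ _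
  have := abs_hits_posSet_sub_le (κ := Fin m) ν (θ := θ j) (ψ := ψ) (s := kernSum kern y)
    (s' := fun z => kernSum kern y z + kernSum kern x z) (x := x) (δ := δ) (t := t)
    (fun z => le_add_of_nonneg_right (hnn z)) (by simpa only [hcard] using n1 j)
    (by simpa only [hcard] using n2 j) (n3 j) ?_ ?_
  · rw [hcard] at this
    exact absurd hj (not_lt.2 this)
  · rw [hits_eq_card, hcard]
    refine le_trans ?_ hc
    have : (Finset.univ.filter fun k => x k ∈ {z | kernSum kern y z + t
        < kernSum kern y z + kernSum kern x z}).card ≤ 2 * c := by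
      simpa using n4.le
    exact_mod_cast this
  · have h1 : ν {z | kernSum kern y z + t < kernSum kern y z + kernSum kern x z}
        ≤ ENNReal.ofReal δ := by
      refine le_trans (measure_mono fun z hz => ?_) ((hq x Finset.univ).trans hqδ)
      have hz : kernSum kern y z + t < kernSum kern y z + kernSum kern x z := hz
      have : kernSum kern x z = ∑ l, kern z (x l) := rfl
      simp only [Set.mem_ofPred_eq]
      linarith
    exact ENNReal.toReal_le_of_le_ofReal hδ.le h1

end Block

/-! ### From one block to the whole sample -/

section CyclicBlocks

variable {E : Type*} [MeasurableSpace E]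

/-- The cyclic block of length `m` that starts at `c`, and its complement. -/
def cyclicSplit {n m : ℕ} [NeZero n] (hmn : m ≤ n) (c : Fin n) : Fin m ⊕ Fin (n - m) ≃ Fin n :=
  (finSumFinEquiv.trans (finCongr (Nat.add_sub_cancel' hmn))).trans (Equiv.addRight c)

theorem sum_cyclicSplit_inl {n m : ℕ} [NeZero n] (hmn : m ≤ n) (f : Fin n → ℝ) :
    ∑ c, ∑ k, f (cyclicSplit hmn c (Sum.inl k)) = m * ∑ i, f i := by
  rw [Finset.sum_comm]
  have : ∀ k : Fin m, ∑ c, f (cyclicSplit hmn c (Sum.inl k)) = ∑ i, f i := fun k =>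
    Equiv.sum_comp (Equiv.addLeft (finCongr (Nat.add_sub_cancel' hmn) (finSumFinEquiv (Sum.inl k))))
      f
  simp [this]

theorem measurePreserving_cyclicSplit {n m : ℕ} [NeZero n] (hmn : m ≤ n) (c : Fin n)
    (ν : Measure E) [IsProbabilityMeasure ν] :
    MeasurePreserving (fun x : Fin n → E => (fun l => x (cyclicSplit hmn c (Sum.inr l)),
      fun k => x (cyclicSplit hmn c (Sum.inl k)))) (Measure.pi fun _ => ν)
      ((Measure.pi fun _ => ν).prod (Measure.pi fun _ => ν)) := by
  have h1 := (measurePreserving_piCongrLeft (fun _ : Fin n => ν) (cyclicSplit hmn c)).symm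
  have h2 := measurePreserving_sumPiEquivProdPi (fun _ : Fin m ⊕ Fin (n - m) => ν)
  exact Measure.measurePreserving_swap.comp (h2.comp h1)

/-- Every index lies in exactly `m` of the `n` cyclic blocks, so the deviation of the whole sample
is an average of block deviations; `m` need not divide `n`. The sum over block and complement is the
full kernel sum, whatever the block, so all blocks are tested with the same set. -/
theorem measure_hits_posSet_dev_le {n m : ℕ} (hn : 0 < n) (hm : 0 < m) (hmn : m ≤ n)
    (ν : Measure E) [IsProbabilityMeasure ν] {kern : E → E → ℝ} {p : ℕ} {ψ : E → ℝ}
    {Θ : Type*} (θ : Θ → Fin (p + 1) × Fin (p + 1) → ℝ) {ε : ℝ} {β : ENNReal}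
    (hβ : ((Measure.pi fun _ : Fin (n - m) => ν).prod (Measure.pi fun _ : Fin m => ν))
      {r | ∃ j, ε * m <
        |hits (posSet (θ j) ψ fun z => kernSum kern r.1 z + kernSum kern r.2 z) r.2
        - m * ν.real (posSet (θ j) ψ fun z => kernSum kern r.1 z + kernSum kern r.2 z)|} ≤ β) :
    Measure.pi (fun _ : Fin n => ν)
      {x | ∃ j, ε * n < |hits (posSet (θ j) ψ (kernSum kern x)) x
        - n * ν.real (posSet (θ j) ψ (kernSum kern x))|} ≤ n * β := by
  have : NeZero n := ⟨hn.ne'⟩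
  set B := {r : (Fin (n - m) → E) × (Fin m → E) | ∃ j, ε * m <
        |hits (posSet (θ j) ψ fun z => kernSum kern r.1 z + kernSum kern r.2 z) r.2
        - m * ν.real (posSet (θ j) ψ fun z => kernSum kern r.1 z + kernSum kern r.2 z)|}
  let S : Fin n → (Fin n → E) → (Fin (n - m) → E) × (Fin m → E) := fun c x =>
    (fun l => x (cyclicSplit hmn c (Sum.inr l)), fun k => x (cyclicSplit hmn c (Sum.inl k)))
  have hS : ∀ c, MeasurePreserving (S c) (Measure.pi fun _ => ν)
      ((Measure.pi fun _ => ν).prod (Measure.pi fun _ => ν)) := fun c =>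
    measurePreserving_cyclicSplit hmn c ν
  have hle : ∀ c, Measure.pi (fun _ : Fin n => ν) (S c ⁻¹' B) ≤ β := fun c => by
    -- The bad event is not known to be measurable here and is replaced by a measurable hull of the
    -- same measure.
    refine le_trans (measure_mono (Set.preimage_mono (subset_toMeasurable
      ((Measure.pi fun _ : Fin (n - m) => ν).prod (Measure.pi fun _ : Fin m => ν)) B))) ?_
    rw [(hS c).measure_preimage (measurableSet_toMeasurable _ _).nullMeasurableSet,
      measure_toMeasurable]
    exact hβ
  have hcov : {x | ∃ j, ε * n < |hits (posSet (θ j) ψ (kernSum kern x)) x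
        - n * ν.real (posSet (θ j) ψ (kernSum kern x))|} ⊆ ⋃ c, S c ⁻¹' B := by
    rintro x ⟨j, hj⟩
    by_contra hnot
    simp only [Set.mem_iUnion, Set.mem_preimage, not_exists] at hnot
    set A := posSet (θ j) ψ (kernSum kern x) with hA
    have hker : ∀ c, (fun z => kernSum kern (S c x).1 z + kernSum kern (S c x).2 z)
        = kernSum kern x := by
      intro c
      funext z
      simp only [kernSum, S]
      rw [← Equiv.sum_comp (cyclicSplit hmn c) fun i => kern z (x i), Fintype.sum_sum_type, add_comm]
    have hone : ∀ c, |hits A (S c x).2 - m * ν.real A| ≤ ε * m := by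
      intro c
      have := hnot c
      simp only [B, Set.mem_ofPred_eq, not_exists, not_lt] at this
      have := this j
      rwa [hker c] at this
    have hsum : ∑ c, hits A (S c x).2 = m * hits A x :=
      sum_cyclicSplit_inl hmn fun i => A.indicator (fun _ => (1 : ℝ)) (x i)
    have htot : |m * hits A x - n * (m * ν.real A)| ≤ n * (ε * m) := by
      rw [← hsum]
      have : ∑ c, hits A (S c x).2 - n * (m * ν.real A)
          = ∑ c, (hits A (S c x).2 - m * ν.real A) := by
        simp [Finset.sum_sub_distrib]
      rw [this]
      refine (Finset.abs_sum_le_sum_abs _ _).trans ((Finset.sum_le_sum fun c _ => hone c).trans ?_)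
      simp
    have hm' : (0 : ℝ) < m := Nat.cast_pos.2 hm
    have : (m : ℝ) * hits A x - n * (m * ν.real A) = m * (hits A x - n * ν.real A) := by ring
    rw [this, abs_mul, abs_of_pos hm'] at htot
    nlinarith
  refine (measure_mono hcov).trans ((measure_iUnion_fintype_le _ _).trans
    ((Finset.sum_le_sum fun c _ => hle c).trans ?_))
  simp

end CyclicBlocks

/-! ### Decay of the error bounds -/

section Numerics

theorem eventually_mul_pow_le_exp (C : ℝ) (D : ℕ) {c : ℝ} (hc : 0 < c) :
    ∀ᶠ x : ℝ in atTop, C * x ^ D ≤ Real.exp (c * x) := by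
  have h1 := (Real.tendsto_pow_mul_exp_neg_atTop_nhds_zero D).comp
    (tendsto_id.const_mul_atTop hc)
  have h2 := h1.const_mul (C / c ^ D)
  rw [mul_zero] at h2
  filter_upwards [h2.eventually (eventually_le_nhds zero_lt_one)] with x hx
  simp only [Function.comp_apply, id_eq] at hx
  have h3 : C * x ^ D * Real.exp (-(c * x)) ≤ 1 := by
    refine le_trans (le_of_eq ?_) hx
    simp only [mul_pow]
    field_simp
  calc C * x ^ D = C * x ^ D * Real.exp (-(c * x)) * Real.exp (c * x) := by
        rw [mul_assoc, ← Real.exp_add]; simp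
    _ ≤ 1 * Real.exp (c * x) := by gcongr
    _ = _ := one_mul _

theorem eventually_blockBound_le (p : ℕ) {δ : ℝ} (hδ : 0 < δ) {α : Type*} {l : Filter α}
    {m : α → ℕ} (hm : Tendsto m l atTop) {k : α → ℕ} (hk : ∀ᶠ a in l, 0 < k a)
    (hkm : ∀ᶠ a in l, k a ≤ m a ^ 8) :
    ∀ᶠ a in l, blockBound p (m a) δ ≤ 1 / (k a : ℝ) ^ 4 := by
  set V := (p + 1) ^ 2 with hV
  have hmr : Tendsto (fun a => (m a : ℝ)) l atTop := tendsto_natCast_atTop_atTop.comp hm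
  have h := hmr.eventually (eventually_mul_pow_le_exp (8 * (8 * (p + 1) + 1) ^ V) (V + 32)
    (show 0 < δ ^ 2 / 8 by positivity))
  filter_upwards [h, hk, hkm, hmr.eventually_ge_atTop 1] with a ha hka hkma h1
  have hk0 : (0 : ℝ) < k a := Nat.cast_pos.2 hka
  rw [le_div_iff₀ (by positivity), blockBound, Real.exp_neg, ← hV]
  have h2 : (8 * (p + 1) * m a + 1 : ℝ) ≤ (8 * (p + 1) + 1) * m a := by nlinarith
  have h3 : (k a : ℝ) ≤ (m a : ℝ) ^ 8 := by exact_mod_cast hkma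
  have h4 : (k a : ℝ) ^ 4 ≤ (m a : ℝ) ^ 32 := by
    refine (pow_le_pow_left₀ hk0.le h3 4).trans_eq ?_
    rw [← pow_mul]
  rw [show δ ^ 2 * (m a : ℝ) / 8 = δ ^ 2 / 8 * m a by ring, mul_right_comm,
    mul_inv_le_iff₀ (Real.exp_pos _), one_mul]
  refine le_trans ?_ ha
  calc 8 * (8 * (p + 1) * m a + 1 : ℝ) ^ V * (k a : ℝ) ^ 4
      ≤ 8 * ((8 * (p + 1) + 1) * m a : ℝ) ^ V * (m a : ℝ) ^ 32 := by gcongr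
    _ = _ := by rw [mul_pow, pow_add]; ring

/-- As `⌊δ m / 2⌋₊ ≥ δ m / 4` for large `m`, the power is at most `exp (-2 m)` and beats `2 ^ m`.
This explains the constant `8 / δ`. -/
theorem eventually_two_pow_mul_pow_le {δ : ℝ} (hδ : 0 < δ) {α : Type*} {l : Filter α}
    {m : α → ℕ} (hm : Tendsto m l atTop) {k : α → ℕ} (hk : ∀ᶠ a in l, 0 < k a)
    (hkm : ∀ᶠ a in l, k a ≤ m a ^ 8) :
    ∀ᶠ a in l, 2 * (2 ^ m a * Real.exp (-(8 / δ)) ^ ⌊δ * m a / 2⌋₊) ≤ 1 / (k a : ℝ) ^ 4 := by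
  have hmr : Tendsto (fun a => (m a : ℝ)) l atTop := tendsto_natCast_atTop_atTop.comp hm
  have h := hmr.eventually (eventually_mul_pow_le_exp 2 32 zero_lt_one)
  filter_upwards [h, hk, hkm, hmr.eventually_ge_atTop (4 / δ)] with a ha hka hkma h1
  have hk0 : (0 : ℝ) < k a := Nat.cast_pos.2 hka
  rw [le_div_iff₀ (by positivity)]
  have h3 : (k a : ℝ) ≤ (m a : ℝ) ^ 8 := by exact_mod_cast hkma
  have h4 : (k a : ℝ) ^ 4 ≤ (m a : ℝ) ^ 32 := by
    refine (pow_le_pow_left₀ hk0.le h3 4).trans_eq ?_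
    rw [← pow_mul]
  have h5 : δ * m a / 4 ≤ (⌊δ * m a / 2⌋₊ : ℝ) := by
    have := Nat.lt_floor_add_one (δ * m a / 2)
    have : 4 ≤ m a * δ := (div_le_iff₀ hδ).1 h1
    linarith
  have h6 : Real.exp (-(8 / δ)) ^ ⌊δ * m a / 2⌋₊ ≤ Real.exp (-(2 * m a)) := by
    rw [← Real.exp_nat_mul]
    refine Real.exp_le_exp.2 ?_
    have : 8 / δ * (δ * m a / 4) ≤ 8 / δ * (⌊δ * m a / 2⌋₊ : ℝ) := by gcongr
    have e : 8 / δ * (δ * m a / 4) = 2 * m a := by field_simp; ring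
    linarith
  have h7 : (2 : ℝ) ^ m a ≤ Real.exp (m a) := by
    rw [← Real.exp_one_pow]
    exact pow_le_pow_left₀ zero_le_two (by linarith [Real.add_one_le_exp 1]) _
  calc 2 * (2 ^ m a * Real.exp (-(8 / δ)) ^ ⌊δ * m a / 2⌋₊) * (k a : ℝ) ^ 4
      ≤ 2 * (Real.exp (m a) * Real.exp (-(2 * m a))) * (m a : ℝ) ^ 32 := by gcongr
    _ = (2 * (m a : ℝ) ^ 32) * Real.exp (-m a) := by
        rw [← Real.exp_add]
        ring_nf
    _ ≤ Real.exp (1 * m a) * Real.exp (-m a) := by gcongr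
    _ = 1 := by rw [← Real.exp_add]; simp

theorem eventually_two_pow_mul_exp_le {α : Type*} {l : Filter α} {m : α → ℕ}
    (hm : Tendsto m l atTop) {N k : α → ℝ} (hN : Tendsto N l atTop) (hk : ∀ᶠ a in l, 0 < k a)
    (hkm : ∀ᶠ a in l, k a ≤ N a * m a ^ 8) {ε c : ℝ} (hε : 0 < ε) (hc : 0 < c) :
    ∀ᶠ a in l, 2 * (2 ^ m a * Real.exp (-((⌊ε * m a⌋₊ + 1) * (c * N a)))) ≤ 1 / k a ^ 4 := by
  have hmr : Tendsto (fun a => (m a : ℝ)) l atTop := tendsto_natCast_atTop_atTop.comp hm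
  have h := (hmr.atTop_mul_atTop₀ hN).eventually (eventually_mul_pow_le_exp 2 32
    (show 0 < ε * c / 2 by positivity))
  filter_upwards [h, hk, hkm, hmr.eventually_ge_atTop 1, hN.eventually_ge_atTop 1,
    hN.eventually_ge_atTop (2 / (ε * c))] with a ha hka hkma hm1 hN1 hN2
  rw [le_div_iff₀ (by positivity)]
  have h4 : k a ^ 4 ≤ (m a * N a) ^ 32 := by
    refine (pow_le_pow_left₀ hka.le hkma 4).trans ?_
    have : N a ^ 4 ≤ N a ^ 32 := pow_le_pow_right₀ hN1 (by norm_num)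
    calc (N a * (m a : ℝ) ^ 8) ^ 4 = N a ^ 4 * (m a : ℝ) ^ 32 := by ring
      _ ≤ N a ^ 32 * (m a : ℝ) ^ 32 := by gcongr
      _ = _ := by ring
  have h7 : (2 : ℝ) ^ m a ≤ Real.exp (m a) := by
    rw [← Real.exp_one_pow]
    exact pow_le_pow_left₀ zero_le_two (by linarith [Real.add_one_le_exp 1]) _
  have h8 : ε * m a ≤ (⌊ε * m a⌋₊ : ℝ) + 1 := (Nat.lt_floor_add_one _).le
  have hcN : 0 ≤ c * N a := by positivity
  have h9 : Real.exp (-((⌊ε * m a⌋₊ + 1) * (c * N a))) ≤ Real.exp (-(ε * m a * (c * N a))) := by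
    refine Real.exp_le_exp.2 (neg_le_neg ?_)
    gcongr
  have h10 : (m a : ℝ) ≤ ε * c / 2 * (m a * N a) := by
    have : 2 ≤ N a * (ε * c) := (div_le_iff₀ (by positivity)).1 hN2
    nlinarith
  calc 2 * (2 ^ m a * Real.exp (-((⌊ε * m a⌋₊ + 1) * (c * N a)))) * k a ^ 4
      ≤ 2 * (Real.exp (m a) * Real.exp (-(ε * m a * (c * N a)))) * (m a * N a) ^ 32 := by gcongr
    _ = (2 * (m a * N a) ^ 32) * Real.exp (m a - ε * m a * (c * N a)) := by
        rw [← Real.exp_add]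
        ring_nf
    _ ≤ Real.exp (ε * c / 2 * (m a * N a)) * Real.exp (-(ε * c / 2 * (m a * N a))) := by
        gcongr
        linarith
    _ = 1 := by rw [← Real.exp_add]; simp

theorem exp_le_pow_of_le {ε x L : ℝ} {R : ℕ} (hε : 0 < ε) (hR : ε * x / 2 ≤ R)
    (hL : Real.exp (4 / ε) ≤ L) : Real.exp (2 * x) ≤ L ^ R := by
  have h : 2 * x ≤ R * (4 / ε) := by
    rw [mul_div_assoc', le_div_iff₀ hε]
    linarith
  calc Real.exp (2 * x) ≤ Real.exp (R * (4 / ε)) := Real.exp_le_exp.2 h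
    _ = Real.exp (4 / ε) ^ R := Real.exp_nat_mul _ _
    _ ≤ L ^ R := pow_le_pow_left₀ (Real.exp_pos _).le hL _

/-- Here `Q ^ V` counts patterns, `y` counts subsets, and `X` is the factor for one critical cell.
Of the `R` powers of `L⁻¹`, `8 * V + 32` cancel the powers of `L` in `Q ^ V` and `k ^ 4`; the
remaining `R'` beat everything exponential in `x`. -/
theorem mul_le_one_of_polynomial_of_exp {Q C L x y X k : ℝ} {V R R' : ℕ} (hQ0 : 0 ≤ Q)
    (hQ : Q ≤ C * (L ^ 8 * x ^ 9)) (hy0 : 0 ≤ y) (hy : y ≤ Real.exp x) (hX0 : 0 ≤ X) (hX : X ≤ L⁻¹)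
    (hk4 : k ^ 4 ≤ L ^ 32 * x ^ 32) (hC : 0 ≤ C) (hL : 0 < L) (hx : 0 < x)
    (hR : R = 8 * V + 32 + R') (hexp : 2 * C ^ V * x ^ (9 * V + 32) ≤ Real.exp (1 * x))
    (hLR : Real.exp (2 * x) ≤ L ^ R') : 2 * (Q ^ V * y * X ^ R) * k ^ 4 ≤ 1 := by
  calc 2 * (Q ^ V * y * X ^ R) * k ^ 4
      ≤ 2 * ((C * (L ^ 8 * x ^ 9)) ^ V * Real.exp x * L⁻¹ ^ R) * (L ^ 32 * x ^ 32) := by gcongr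
    _ = (2 * C ^ V * x ^ (9 * V + 32)) * Real.exp x * (L ^ R')⁻¹ := by
        rw [hR, inv_pow, pow_add _ (8 * V + 32), mul_pow, mul_pow, ← pow_mul, ← pow_mul,
          pow_add L, pow_add x]
        field_simp
    _ ≤ Real.exp (1 * x) * Real.exp x * (Real.exp (2 * x))⁻¹ := by gcongr
    _ = 1 := by
        rw [← Real.exp_add, ← Real.exp_neg, ← Real.exp_add]
        ring_nf
        exact Real.exp_zero

-- With `w` of order `L ^ 8` and `t = L ^ 2`, the factor for one critical cell is of order `t / √w =
-- L ^ (-2)`. One power of `L` is spent on the constants, which leaves `L⁻¹`. Since `R` grows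
-- linearly in `m`, this outweighs patterns, subsets and `k ^ 4`.
set_option maxHeartbeats 1000000 in
theorem eventually_coinBound_le (p : ℕ) {α : Type*} {l : Filter α} {m G : α → ℕ}
    (hm : Tendsto m l atTop) {L k : α → ℝ} (hL : Tendsto L l atTop) (hk : ∀ᶠ a in l, 0 < k a)
    (hkm : ∀ᶠ a in l, k a ≤ L a ^ 8 * m a ^ 8) {ε c b M : ℝ} (hε : 0 < ε) (hc : 0 < c)
    (hb : 0 < b) (hM : 0 ≤ M) (hG : ∀ᶠ a in l, (G a : ℝ) + 2 ≤ M * k a) :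
    ∀ᶠ a in l, 2 * coinBound p (m a) (G a) ⌊c * L a ^ 8⌋₊ ⌊ε * m a⌋₊ b (L a ^ 2)
      ≤ 1 / k a ^ 4 := by
  set V := (p + 1) ^ 2 with hV
  set C₁ : ℝ := 4 * p * (p + 1) * (2 / √(c / 2) * (4 / b + 1)) with hC₁
  set C₂ : ℝ := 2 * M * (p + 1) + 1 with hC₂
  have hmr : Tendsto (fun a => (m a : ℝ)) l atTop := tendsto_natCast_atTop_atTop.comp hm
  have h := hmr.eventually (eventually_mul_pow_le_exp (2 * C₂ ^ V) (9 * V + 32) zero_lt_one)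
  filter_upwards [h, hk, hkm, hG, hmr.eventually_ge_atTop 1, hL.eventually_ge_atTop 1,
    hL.eventually_ge_atTop C₁, hL.eventually_ge_atTop (2 / c),
    hL.eventually_ge_atTop (Real.exp (4 / ε)),
    hmr.eventually_ge_atTop ((2 * (8 * V + 33)) / ε)] with a ha hka hkma hGa hm1 hL1 hL2 hL3 hL4 hm2
  have hL0 : 0 < L a := by linarith
  have hcV : (0 : ℝ) ≤ C₂ := by positivity
  -- the small-ball factor
  have hL8 : L a ≤ L a ^ 8 := le_self_pow₀ hL1 (by norm_num)
  have hcL : 2 ≤ c * L a ^ 8 := by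
    have := (div_le_iff₀ hc).1 hL3
    nlinarith
  have hw : c / 2 * L a ^ 8 ≤ (⌊c * L a ^ 8⌋₊ : ℝ) := by
    have := Nat.lt_floor_add_one (c * L a ^ 8)
    linarith
  have hw0 : 0 < ⌊c * L a ^ 8⌋₊ := Nat.floor_pos.2 (by linarith)
  set w := ⌊c * L a ^ 8⌋₊ with hwdef
  have hsq : √(c / 2) * L a ^ 4 ≤ √(w : ℝ) := by
    refine le_trans (le_of_eq ?_) (Real.sqrt_le_sqrt hw)
    rw [Real.sqrt_mul (by positivity), show L a ^ 8 = (L a ^ 4) ^ 2 by ring,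
      Real.sqrt_sq (by positivity)]
  have hs0 : 0 < √(c / 2) := Real.sqrt_pos.2 (by positivity)
  have hfac : 4 * (p : ℝ) * (p + 1) * ((w.choose (w / 2) : ℝ) / 2 ^ w
      * (⌊2 * L a ^ 2 / (b / 2)⌋₊ + 1)) ≤ (L a)⁻¹ := by
    have h1 : (w.choose (w / 2) : ℝ) / 2 ^ w ≤ 2 / (√(c / 2) * L a ^ 4) :=
      (choose_middle_div_le hw0).trans (by gcongr)
    have h2 : (⌊2 * L a ^ 2 / (b / 2)⌋₊ + 1 : ℝ) ≤ (4 / b + 1) * L a ^ 2 := by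
      have h3 : (⌊2 * L a ^ 2 / (b / 2)⌋₊ : ℝ) ≤ 2 * L a ^ 2 / (b / 2) :=
        Nat.floor_le (by positivity)
      have h4 : 2 * L a ^ 2 / (b / 2) = 4 / b * L a ^ 2 := by field_simp; norm_num
      have h5 : 1 ≤ L a ^ 2 := one_le_pow₀ hL1
      linarith
    calc 4 * (p : ℝ) * (p + 1) * ((w.choose (w / 2) : ℝ) / 2 ^ w
        * (⌊2 * L a ^ 2 / (b / 2)⌋₊ + 1))
        ≤ 4 * (p : ℝ) * (p + 1) * (2 / (√(c / 2) * L a ^ 4) * ((4 / b + 1) * L a ^ 2)) := by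
          gcongr
      _ = C₁ / L a ^ 2 := by rw [hC₁]; field_simp
      _ ≤ L a / L a ^ 2 := by gcongr
      _ = (L a)⁻¹ := by field_simp
  have hk4 : k a ^ 4 ≤ L a ^ 32 * (m a : ℝ) ^ 32 := by
    refine (pow_le_pow_left₀ hka.le hkma 4).trans_eq ?_
    ring
  have hpat : (2 * m a * (G a + 2) * (p + 1) + 1 : ℝ) ≤ C₂ * (L a ^ 8 * (m a : ℝ) ^ 9) := by
    have h1 : (2 * m a * (G a + 2) * (p + 1) : ℝ)
        ≤ 2 * m a * (M * (L a ^ 8 * m a ^ 8)) * (p + 1) := by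
      gcongr
      exact hGa.trans (by gcongr)
    have h2 : (1 : ℝ) ≤ L a ^ 8 * (m a : ℝ) ^ 9 := one_le_mul_of_one_le_of_one_le
      (one_le_pow₀ hL1) (one_le_pow₀ hm1)
    calc _ ≤ 2 * m a * (M * (L a ^ 8 * m a ^ 8)) * (p + 1) + L a ^ 8 * (m a : ℝ) ^ 9 := by
          linarith
      _ = _ := by rw [hC₂]; ring
  have hX0 : 0 ≤ 4 * (p : ℝ) * (p + 1) * ((w.choose (w / 2) : ℝ) / 2 ^ w
      * (⌊2 * L a ^ 2 / (b / 2)⌋₊ + 1)) := by positivity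
  have h7 : (2 : ℝ) ^ m a ≤ Real.exp (m a) := by
    rw [← Real.exp_one_pow]
    exact pow_le_pow_left₀ zero_le_two (by linarith [Real.add_one_le_exp 1]) _
  -- the exponent of `L`
  set R := ⌊ε * m a⌋₊ with hR
  have hRε : ε * m a - 1 < R := by
    have := Nat.lt_floor_add_one (ε * m a)
    linarith
  have hm2' : 2 * (8 * V + 33 : ℝ) ≤ m a * ε := (div_le_iff₀ hε).1 hm2
  have hRD : 8 * V + 32 ≤ R := by
    have : (8 * V + 32 : ℝ) ≤ R := by nlinarith [(Nat.cast_nonneg V : (0 : ℝ) ≤ V)]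
    exact_mod_cast this
  -- Splits off the exponents that pay for the polynomial factors in `L`; at least half of `ε * m`
  -- is left over.
  obtain ⟨R', hR'⟩ := Nat.exists_eq_add_of_le hRD
  have hR'ε : ε * m a / 2 ≤ (R' : ℝ) := by
    have : (R : ℝ) = 8 * V + 32 + R' := by rw [hR']; push_cast; ring
    nlinarith
  have hLR := exp_le_pow_of_le hε hR'ε hL4
  rw [le_div_iff₀ (by positivity), coinBound, ← hV]
  exact mul_le_one_of_polynomial_of_exp (by positivity) hpat (by positivity) h7 hX0 hfac hk4 hcV hL0
    (by linarith) hR' ha hLR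

end Numerics

/-! ### Absolutely continuous laws and the kernel -/

section Density

variable {d : ℕ}

/-- Truncation of the density. It replaces a bounded density: off a set of small mass, `ν` is
dominated by a multiple of Lebesgue measure. -/
theorem exists_density_bound (ν : Measure (Attr d)) [IsFiniteMeasure ν] (hν : ν ≪ volume) {ε : ℝ}
    (hε : 0 < ε) : ∃ S : Set (Attr d), MeasurableSet S ∧ ∃ L : ℝ, 0 < L ∧
      ν Sᶜ ≤ ENNReal.ofReal ε ∧
      ∀ A, MeasurableSet A → ν (A ∩ S) ≤ ENNReal.ofReal L * volume A := by
  set f := ν.rnDeriv volume with hf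
  have hfm : Measurable f := Measure.measurable_rnDeriv _ _
  have hmeas : ∀ n : ℕ, MeasurableSet {x | (n : ENNReal) < f x} := fun n =>
    measurableSet_lt measurable_const hfm
  have htop : ν (⋂ n : ℕ, {x | (n : ENNReal) < f x}) = 0 := by
    refine measure_mono_null (fun x hx => ?_)
      (show ν {x | ¬ f x < ⊤} = 0 from hν.ae_le (Measure.rnDeriv_lt_top ν volume))
    simp only [Set.mem_iInter, Set.mem_ofPred_eq] at hx ⊢
    intro hlt
    obtain ⟨n, hn⟩ := ENNReal.exists_nat_gt hlt.ne
    exact lt_asymm hn (hx n)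
  have hlim := tendsto_measure_iInter_atTop (μ := ν) (fun n => (hmeas n).nullMeasurableSet)
    (fun m n hmn x (hx : (n : ENNReal) < f x) =>
      (lt_of_le_of_lt (Nat.cast_le.2 hmn) hx : (m : ENNReal) < f x)) ⟨0, measure_ne_top _ _⟩
  rw [htop] at hlim
  obtain ⟨n, hn, hn0⟩ := ((hlim.eventually (eventually_le_nhds (ENNReal.ofReal_pos.2 hε))).and
    (eventually_gt_atTop 0)).exists
  refine ⟨{x | (n : ENNReal) < f x}ᶜ, (hmeas n).compl, n, Nat.cast_pos.2 hn0, ?_, fun A hA => ?_⟩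
  · rw [compl_compl]
    exact hn
  · rw [← Measure.withDensity_rnDeriv_eq ν volume hν, withDensity_apply _ (hA.inter (hmeas n).compl)]
    calc ∫⁻ x in A ∩ {x | (n : ENNReal) < f x}ᶜ, f x
        ≤ ∫⁻ x in A ∩ {x | (n : ENNReal) < f x}ᶜ, n :=
          setLIntegral_mono measurable_const fun x hx => not_lt.1 hx.2
      _ = n * volume (A ∩ {x | (n : ENNReal) < f x}ᶜ) := setLIntegral_const _ _
      _ ≤ n * volume A := by gcongr; exact Set.inter_subset_left
      _ = _ := by simp

theorem measurable_measure_closedBall (ν : Measure (Attr d)) [IsFiniteMeasure ν] (r : ℝ) :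
    Measurable fun x => ν (Metric.closedBall x r) := by
  have h : MeasurableSet {q : Attr d × Attr d | dist q.2 q.1 ≤ r} :=
    (isClosed_le (continuous_snd.dist continuous_fst) continuous_const).measurableSet
  exact measurable_measure_prodMk_left h

/-- By differentiation of measures, the ratio of `ν` to the volume of small balls tends almost
everywhere to the density, which is positive `ν`-almost everywhere. It supplies enough observations
near a typical point, namely of order `k * h ^ d`. -/
theorem exists_closedBall_lower_bound (ν : Measure (Attr d)) [IsFiniteMeasure ν]
    (hν : ν ≪ volume) {ε r : ℝ} (hε : 0 < ε) (hr : 0 < r) :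
    ∃ c > 0, ∀ᶠ h in 𝓝[>] (0 : ℝ),
      ν {x | ν (Metric.closedBall x (r * h)) < ENNReal.ofReal (c * h ^ d)} ≤ ENNReal.ofReal ε := by
  set f := ν.rnDeriv volume with hf
  have hfm : Measurable f := Measure.measurable_rnDeriv _ _
  have hpos : ∀ᵐ x ∂ν, 0 < f x := Measure.rnDeriv_pos hν
  have hmeas : ∀ n : ℕ, MeasurableSet {x | f x ≤ (n + 1 : ENNReal)⁻¹} := fun n =>
    measurableSet_le hfm measurable_const
  have hzero : ν (⋂ n : ℕ, {x | f x ≤ (n + 1 : ENNReal)⁻¹}) = 0 := by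
    refine measure_mono_null (fun x hx => ?_) (show ν {x | ¬ 0 < f x} = 0 from hpos)
    simp only [Set.mem_iInter, Set.mem_ofPred_eq] at hx ⊢
    intro hlt
    obtain ⟨n, hn⟩ := ENNReal.exists_inv_nat_lt hlt.ne'
    refine absurd ((hx n).trans ?_) (not_le.2 hn)
    rw [ENNReal.inv_le_inv]
    exact le_self_add
  have hlim := tendsto_measure_iInter_atTop (μ := ν) (fun n => (hmeas n).nullMeasurableSet)
    (fun m n hmn x hx => le_trans (show f x ≤ _ from hx)
      (ENNReal.inv_le_inv.2 (by gcongr))) ⟨0, measure_ne_top _ _⟩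
  rw [hzero] at hlim
  obtain ⟨n, hn⟩ := (hlim.eventually (eventually_le_nhds
    (ENNReal.ofReal_pos.2 (half_pos hε)))).exists
  set c₀ : ENNReal := (n + 1 : ENNReal)⁻¹ with hc₀
  have hc₀0 : c₀ ≠ 0 := by simp [hc₀]
  have hc₀t : c₀ ≠ ⊤ := by simp [hc₀]
  set v : ENNReal := volume (Metric.ball (0 : Attr d) 1)
  have hv0 : v ≠ 0 := (Metric.measure_ball_pos volume _ zero_lt_one).ne'
  have hvt : v ≠ ⊤ := measure_ball_lt_top.ne
  have hvol : ∀ (x : Attr d) {h : ℝ}, 0 < h → volume (Metric.closedBall x (r * h))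
      = ENNReal.ofReal ((r * h) ^ d) * v := fun x h hh => by
    rw [Measure.addHaar_closedBall volume x (by positivity), finrank_euclideanSpace_fin]
  refine ⟨(c₀ * v).toReal * r ^ d, mul_pos (ENNReal.toReal_pos (mul_ne_zero hc₀0 hv0)
    (ENNReal.mul_ne_top hc₀t hvt)) (pow_pos hr d), ?_⟩
  -- Points of density above `c₀` whose ball is nevertheless too light. The differentiation theorem
  -- makes the indicators tend to zero almost everywhere.
  set B : ℝ → Set (Attr d) := fun h =>
    {x | ν (Metric.closedBall x (r * h)) < c₀ * (ENNReal.ofReal ((r * h) ^ d) * v)} ∩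
      {x | f x ≤ c₀}ᶜ with hB
  have hBm : ∀ h, MeasurableSet (B h) := fun h =>
    (measurableSet_lt (measurable_measure_closedBall ν _) measurable_const).inter (hmeas n).compl
  have hBlim : Tendsto (fun h => ν (B h)) (𝓝[>] 0) (𝓝 (ν ∅)) := by
    refine tendsto_measure_of_ae_tendsto_indicator (𝓝[>] (0 : ℝ)) MeasurableSet.empty hBm
      MeasurableSet.univ (measure_ne_top _ _) (Eventually.of_forall fun _ => Set.subset_univ _) ?_
    filter_upwards [hν.ae_le (Besicovitch.ae_tendsto_rnDeriv ν volume)] with x hx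
    by_cases hfx : f x ≤ c₀
    · exact Eventually.of_forall fun h => iff_of_false (fun hx => hx.2 hfx) id
    have hsc : Tendsto (fun h : ℝ => r * h) (𝓝[>] 0) (𝓝[>] 0) := by
      refine tendsto_nhdsWithin_iff.2 ⟨?_, ?_⟩
      · have : Tendsto (fun h : ℝ => r * h) (𝓝 0) (𝓝 (r * 0)) := tendsto_id.const_mul r
        rw [mul_zero] at this
        exact this.mono_left nhdsWithin_le_nhds
      · filter_upwards [self_mem_nhdsWithin] with h hh
        exact mul_pos hr hh
    filter_upwards [(hx.comp hsc).eventually (eventually_gt_nhds (not_le.1 hfx)),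
      self_mem_nhdsWithin] with h hh hh0
    refine iff_of_false (fun hxB => ?_) id
    have h1 := hxB.1
    simp only [Set.mem_ofPred_eq] at h1
    rw [← hvol x hh0] at h1
    have h2 := ENNReal.mul_lt_of_lt_div hh
    exact lt_asymm h1 h2
  rw [measure_empty] at hBlim
  filter_upwards [hBlim.eventually (eventually_le_nhds (ENNReal.ofReal_pos.2 (half_pos hε))),
    self_mem_nhdsWithin] with h hh hh0
  have hcon : ENNReal.ofReal ((c₀ * v).toReal * r ^ d * h ^ d)
      = c₀ * (ENNReal.ofReal ((r * h) ^ d) * v) := by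
    rw [mul_assoc, ← mul_pow, ENNReal.ofReal_mul ENNReal.toReal_nonneg,
      ENNReal.ofReal_toReal (ENNReal.mul_ne_top hc₀t hvt)]
    ring
  rw [hcon]
  calc _ ≤ ν (B h ∪ {x | f x ≤ c₀}) := measure_mono fun x hx => by
        by_cases hfx : f x ≤ c₀
        · exact Or.inr hfx
        · exact Or.inl ⟨hx, hfx⟩
    _ ≤ ENNReal.ofReal (ε / 2) + ENNReal.ofReal (ε / 2) :=
        (measure_union_le _ _).trans (add_le_add hh hn)
    _ = ENNReal.ofReal ε := by
        rw [← ENNReal.ofReal_add (by positivity) (by positivity), add_halves]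

theorem volume_preimage_scaled {h : ℝ} (hh : 0 < h) (x : Attr d) {A : Set (Attr d)} :
    volume {y | h⁻¹ • (x - y) ∈ A} = ENNReal.ofReal (h ^ d) * volume A := by
  have h1 : {y | h⁻¹ • (x - y) ∈ A} = (fun y => x - y) ⁻¹' ((fun z => h⁻¹ • z) ⁻¹' A) := rfl
  rw [h1, (Measure.measurePreserving_sub_left volume x).measure_preimage_emb
    (MeasurableEquiv.subLeft x).measurableEmbedding, Measure.addHaar_preimage_smul _ (inv_ne_zero hh.ne'),
    finrank_euclideanSpace_fin, inv_pow, inv_inv, abs_of_pos (pow_pos hh d)]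

/-- The kernel with bandwidth `h`, without normalisation. -/
def scaledKernel (K : Attr d → ℝ) (h : ℝ) (x y : Attr d) : ℝ := K (h⁻¹ • (x - y))

theorem measurable_scaledKernel {K : Attr d → ℝ} (hK : Measurable K) (h : ℝ) :
    Measurable (Function.uncurry (scaledKernel K h)) :=
  hK.comp ((measurable_fst.sub measurable_snd).const_smul h⁻¹)

/-- The points from which the kernel exceeds `τ` within distance `r`. -/
def reachSet (K : Attr d → ℝ) (r τ : ℝ) : Set (Attr d) := {u | ∃ v, ‖v‖ < r ∧ τ < K (u + v)}

theorem isOpen_reachSet {K : Attr d → ℝ} (hK : Continuous K) (r τ : ℝ) :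
    IsOpen (reachSet K r τ) := by
  have : reachSet K r τ = ⋃ v ∈ Metric.ball (0 : Attr d) r, {u | τ < K (u + v)} := by
    ext u
    simp [reachSet]
  rw [this]
  exact isOpen_biUnion fun v _ =>
    isOpen_lt continuous_const (hK.comp (continuous_id.add continuous_const))

theorem le_sSup_image_closedBall {K : Attr d → ℝ} (hK : Continuous K) {r : ℝ} {x u : Attr d}
    (h : x ∈ Metric.closedBall u r) : K x ≤ sSup (K '' Metric.closedBall u r) :=
  le_csSup ((isCompact_closedBall u r).bddAbove_image hK.continuousOn) (Set.mem_image_of_mem K h)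

theorem IsContinuousRegularKernel.integrable {K : Attr d → ℝ} (hK : IsContinuousRegularKernel K) :
    Integrable K := by
  obtain ⟨r, hr, -, -, -, hint⟩ := hK.regular
  refine hint.mono' hK.continuous.aestronglyMeasurable (Eventually.of_forall fun x => ?_)
  rw [Real.norm_of_nonneg (hK.nonneg x)]
  exact le_sSup_image_closedBall hK.continuous (Metric.mem_closedBall_self hr.le)

/-- The value `K x` is at most the local supremum at every centre within `r` of `x`; averaging over
these centres bounds it by the integral of the local supremum over the volume of a ball. -/
theorem IsContinuousRegularKernel.exists_le {K : Attr d → ℝ} (hK : IsContinuousRegularKernel K) :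
    ∃ M, 0 < M ∧ ∀ x, K x ≤ M := by
  obtain ⟨r, hr, -, -, -, hint⟩ := hK.regular
  set Ks := fun u => sSup (K '' Metric.closedBall u r)
  set v := volume.real (Metric.closedBall (0 : Attr d) r) with hv
  have hvpos : 0 < v := ENNReal.toReal_pos (Metric.measure_closedBall_pos volume _ hr).ne'
    measure_closedBall_lt_top.ne
  have hKs0 : ∀ u, 0 ≤ Ks u := fun u => (hK.nonneg u).trans
    (le_sSup_image_closedBall hK.continuous (Metric.mem_closedBall_self hr.le))
  refine ⟨(∫ u, Ks u) / v + 1, by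
    have := integral_nonneg (μ := volume) (f := Ks) fun u => hKs0 u
    positivity, fun x => ?_⟩
  have h1 : K x * v ≤ ∫ u, Ks u := by
    calc K x * v = ∫ u in Metric.closedBall x r, K x := by
          rw [setIntegral_const, smul_eq_mul, mul_comm, hv,
            Measure.addHaar_real_closedBall_center volume x r]
      _ ≤ ∫ u in Metric.closedBall x r, Ks u := by
          refine setIntegral_mono_on (integrableOn_const measure_closedBall_lt_top.ne)
            hint.integrableOn measurableSet_closedBall fun u hu => ?_
          refine le_sSup_image_closedBall hK.continuous ?_
          rwa [Metric.mem_closedBall, dist_comm]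
      _ ≤ _ := setIntegral_le_integral hint (Eventually.of_forall hKs0)
  have := (le_div_iff₀ hvpos).2 h1
  linarith

/-- Markov's inequality for the integrable local supremum. It makes two independent points unlikely
to be so close that an observation near one is felt by the other above `τ`. -/
theorem IsContinuousRegularKernel.exists_reach {K : Attr d → ℝ}
    (hK : IsContinuousRegularKernel K) : ∃ r > 0, ∃ b > 0, ∃ C > 0,
      (∀ x, ‖x‖ ≤ r → b ≤ K x) ∧
      ∀ τ > 0, volume (reachSet K r τ) ≤ ENNReal.ofReal (C / τ) := by
  obtain ⟨r, hr, b, hb, hKb, hint⟩ := hK.regular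
  set Ks := fun u => sSup (K '' Metric.closedBall u r)
  have hKs0 : ∀ u, 0 ≤ Ks u := fun u => (hK.nonneg u).trans
    (le_sSup_image_closedBall hK.continuous (Metric.mem_closedBall_self hr.le))
  have hI := integral_nonneg (μ := volume) (f := Ks) fun u => hKs0 u
  refine ⟨r, hr, b, hb, (∫ u, Ks u) + 1, by positivity, hKb, fun τ hτ => ?_⟩
  have h1 := mul_meas_ge_le_lintegral₀ (μ := volume) hint.aestronglyMeasurable.aemeasurable.ennreal_ofReal
    (ENNReal.ofReal τ)
  rw [← ofReal_integral_eq_lintegral_ofReal hint (Eventually.of_forall hKs0), mul_comm,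
    ← ENNReal.le_div_iff_mul_le (Or.inl (by simpa using hτ)) (Or.inl ENNReal.ofReal_ne_top),
    ← ENNReal.ofReal_div_of_pos hτ] at h1
  refine (measure_mono ?_).trans (h1.trans (ENNReal.ofReal_le_ofReal (by gcongr; linarith)))
  rintro u ⟨v, hv, hlt⟩
  refine ENNReal.ofReal_le_ofReal (hlt.le.trans (le_sSup_image_closedBall hK.continuous ?_))
  rw [Metric.mem_closedBall, dist_eq_norm, add_sub_cancel_left]
  exact hv.le

/-- The pairs of points, the first of them in `S`, that are too close for the kernel. -/
def closePairs (K : Attr d → ℝ) (r τ h : ℝ) (S : Set (Attr d)) : Set (Attr d × Attr d) :=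
  {q | q.1 ∈ S ∧ h⁻¹ • (q.2 - q.1) ∈ reachSet K r τ}

theorem measurableSet_closePairs {K : Attr d → ℝ} (hK : Continuous K) (r τ h : ℝ)
    {S : Set (Attr d)} (hS : MeasurableSet S) : MeasurableSet (closePairs K r τ h S) :=
  (measurable_fst hS).inter ((isOpen_reachSet hK r τ).preimage
    ((continuous_snd.sub continuous_fst).const_smul h⁻¹)).measurableSet

theorem measure_closePairs_le {ν : Measure (Attr d)} [IsProbabilityMeasure ν] {K : Attr d → ℝ}
    (hK : Continuous K) {r τ h L C : ℝ} (hh : 0 < h) (hL : 0 < L) {S : Set (Attr d)}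
    (hS : MeasurableSet S)
    (hSν : ∀ A, MeasurableSet A → ν (A ∩ S) ≤ ENNReal.ofReal L * volume A)
    (hC : volume (reachSet K r τ) ≤ ENNReal.ofReal C) :
    (ν.prod ν) (closePairs K r τ h S) ≤ ENNReal.ofReal (L * (h ^ d * C)) := by
  rw [Measure.prod_apply_symm (measurableSet_closePairs hK r τ h hS)]
  have hone : ∀ x', ν ((fun x => (x, x')) ⁻¹' closePairs K r τ h S)
      ≤ ENNReal.ofReal (L * (h ^ d * C)) := by
    intro x'
    have hm : MeasurableSet {x | h⁻¹ • (x' - x) ∈ reachSet K r τ} :=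
      ((isOpen_reachSet hK r τ).preimage
        ((continuous_const.sub continuous_id).const_smul h⁻¹)).measurableSet
    refine (measure_mono (t := {x | h⁻¹ • (x' - x) ∈ reachSet K r τ} ∩ S) fun x hx => ⟨hx.2, hx.1⟩).trans ((hSν _ hm).trans ?_)
    rw [volume_preimage_scaled hh, ENNReal.ofReal_mul hL.le,
      ENNReal.ofReal_mul (pow_nonneg hh.le d)]
    gcongr
  refine (lintegral_mono hone).trans ?_
  simp

theorem measure_scaledKernel_gt_le {ν : Measure (Attr d)} {K : Attr d → ℝ}
    (hK : Continuous K) {r τ h L C : ℝ} (hr : 0 < r) (hh : 0 < h) (hL : 0 < L) {S : Set (Attr d)}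
    (hSν : ∀ A, MeasurableSet A → ν (A ∩ S) ≤ ENNReal.ofReal L * volume A)
    (hC : volume (reachSet K r τ) ≤ ENNReal.ofReal C) (x : Attr d) :
    ν ({y | τ < scaledKernel K h x y} ∩ S) ≤ ENNReal.ofReal (L * (h ^ d * C)) := by
  have hm : MeasurableSet {y | h⁻¹ • (x - y) ∈ reachSet K r τ} :=
    ((isOpen_reachSet hK r τ).preimage
      ((continuous_const.sub continuous_id).const_smul h⁻¹)).measurableSet
  refine (measure_mono (Set.inter_subset_inter_left _ fun y hy => ?_)).trans ((hSν _ hm).trans ?_)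
  · exact ⟨0, by simpa using hr, by simpa [scaledKernel] using hy⟩
  · rw [volume_preimage_scaled hh, ENNReal.ofReal_mul hL.le, ENNReal.ofReal_mul (pow_nonneg hh.le d)]
    gcongr

theorem lintegral_scaledKernel {K : Attr d → ℝ} (hK : IsContinuousRegularKernel K) {h : ℝ}
    (hh : 0 < h) (x : Attr d) :
    ∫⁻ z, ENNReal.ofReal (scaledKernel K h z x) = ENNReal.ofReal (h ^ d * ∫ z, K z) := by
  have h1 : ∫ z, scaledKernel K h z x = h ^ d * ∫ z, K z := by
    simp only [scaledKernel]
    rw [integral_sub_right_eq_self (fun z => K (h⁻¹ • z)) x,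
      Measure.integral_comp_inv_smul_of_nonneg volume _ hh.le, finrank_euclideanSpace_fin,
      smul_eq_mul]
  have h2 : Integrable fun z => scaledKernel K h z x :=
    (hK.integrable.comp_smul (inv_ne_zero hh.ne')).comp_sub_right x
  rw [← h1, ofReal_integral_eq_lintegral_ofReal h2 (Eventually.of_forall fun z => hK.nonneg _)]

/-- Markov's inequality under Lebesgue measure, transferred to `ν` on `S`. This gives the
probability of crowding. -/
theorem measure_sum_scaledKernel_gt_le {ν : Measure (Attr d)} {K : Attr d → ℝ}
    (hK : IsContinuousRegularKernel K) {h L s : ℝ} (hh : 0 < h) (hL : 0 < L) (hs : 0 < s)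
    {S : Set (Attr d)}
    (hSν : ∀ A, MeasurableSet A → ν (A ∩ S) ≤ ENNReal.ofReal L * volume A) {m : ℕ}
    (a : Fin m → Attr d) (T : Finset (Fin m)) :
    ν {z | s < ∑ l ∈ T, scaledKernel K h z (a l)}
      ≤ ν Sᶜ + ENNReal.ofReal (L * (m * (h ^ d * ∫ z, K z) / s)) := by
  have hkm : ∀ x, Measurable fun z => scaledKernel K h z x := fun x =>
    (measurable_scaledKernel hK.continuous.measurable h).comp
      (measurable_id.prodMk measurable_const)
  have hcm : Measurable fun z => ∑ l ∈ T, scaledKernel K h z (a l) :=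
    Finset.measurable_sum _ fun l _ => hkm (a l)
  have hI : 0 ≤ ∫ z, K z := integral_nonneg hK.nonneg
  have hvol : volume {z | s < ∑ l ∈ T, scaledKernel K h z (a l)}
      ≤ ENNReal.ofReal (m * (h ^ d * ∫ z, K z) / s) := by
    have h1 := mul_meas_ge_le_lintegral (μ := volume) hcm.ennreal_ofReal (ENNReal.ofReal s)
    have h2 : ∫⁻ z, ENNReal.ofReal (∑ l ∈ T, scaledKernel K h z (a l))
        ≤ ENNReal.ofReal (m * (h ^ d * ∫ z, K z)) := by
      have e : ∀ z, ENNReal.ofReal (∑ l ∈ T, scaledKernel K h z (a l))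
          = ∑ l ∈ T, ENNReal.ofReal (scaledKernel K h z (a l)) := fun z =>
        ENNReal.ofReal_sum_of_nonneg fun l _ => hK.nonneg _
      simp_rw [e]
      rw [lintegral_finsetSum _ fun l _ => (hkm (a l)).ennreal_ofReal]
      simp_rw [lintegral_scaledKernel hK hh]
      rw [Finset.sum_const, nsmul_eq_mul, ENNReal.ofReal_mul (Nat.cast_nonneg m),
        ENNReal.ofReal_natCast]
      gcongr
      simpa using Finset.card_le_univ T
    rw [mul_comm, ← ENNReal.le_div_iff_mul_le (Or.inl (by simpa using hs))
      (Or.inl ENNReal.ofReal_ne_top)] at h1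
    refine (measure_mono fun z hz => ?_).trans (h1.trans ?_)
    · exact ENNReal.ofReal_le_ofReal (le_of_lt hz)
    · rw [ENNReal.ofReal_div_of_pos hs]
      gcongr
  calc _ ≤ ν (Sᶜ ∪ {z | s < ∑ l ∈ T, scaledKernel K h z (a l)} ∩ S) := measure_mono fun z hz => by
        by_cases h : z ∈ S
        · exact Or.inr ⟨hz, h⟩
        · exact Or.inl h
    _ ≤ _ := (measure_union_le _ _).trans (by
        gcongr
        refine (hSν _ (measurableSet_lt measurable_const hcm)).trans ?_
        rw [ENNReal.ofReal_mul hL.le]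
        gcongr)

end Density

/-! ### Uniform deviations within one class, at fixed scales -/

section ClassDeviation

variable {d : ℕ}

/-- A coin arises from an observation within `r / 2 * h` of `x k` and a second one felt nowhere
above `τ`. The first has kernel at least `b` at `x k`, and at most `τ` at the other points because
they are not close to `x k`. The second has probability at least one half, so the product is at
least `c / 2`. -/
theorem le_measure_coinPairs {ν : Measure (Attr d)} [IsProbabilityMeasure ν] {K : Attr d → ℝ}
    (hK : Continuous K) {r b τ h c e : ℝ} (hr : 0 < r) (hh : 0 < h)
    (hKb : ∀ x, ‖x‖ ≤ r → b ≤ K x) {S : Set (Attr d)}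
    {κ : Type*} [Fintype κ] {x : κ → Attr d} {k : κ} (hkS : x k ∈ S)
    (hball : ENNReal.ofReal c ≤ ν (Metric.closedBall (x k) (r / 2 * h)))
    (hfar : ∀ l, l ≠ k → (x k, x l) ∉ closePairs K r τ h S)
    (hS : ν Sᶜ ≤ ENNReal.ofReal (1 / 4)) (he : 0 ≤ e)
    (hrem : ∀ l, ν ({y | τ < scaledKernel K h (x l) y} ∩ S) ≤ ENNReal.ofReal e)
    (hcard : Fintype.card κ * e ≤ 1 / 4) :
    c / 2 ≤ (ν.prod ν).real (coinPairs (scaledKernel K h) b τ x k) := by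
  set R : Set (Attr d) := {y | ∀ l, scaledKernel K h (x l) y ≤ τ} with hR
  have hRm : MeasurableSet R := by
    have : MeasurableSet {y | ∀ l, scaledKernel K h (x l) y ≤ τ} := by
      simp only [Set.ofPred_forall]
      exact MeasurableSet.iInter fun l => measurableSet_le
        ((measurable_scaledKernel hK.measurable h).comp
          (measurable_const.prodMk measurable_id)) measurable_const
    exact this
  have hRc : ν Rᶜ ≤ ENNReal.ofReal (1 / 2) := by
    have hcov : Rᶜ ⊆ Sᶜ ∪ ⋃ l, ({y | τ < scaledKernel K h (x l) y} ∩ S) := by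
      intro y hy
      by_cases hyS : y ∈ S
      · simp only [hR, Set.mem_compl_iff, Set.mem_ofPred_eq, not_forall, not_le] at hy
        obtain ⟨l, hl⟩ := hy
        exact Or.inr (Set.mem_iUnion.2 ⟨l, hl, hyS⟩)
      · exact Or.inl hyS
    calc ν Rᶜ ≤ ENNReal.ofReal (1 / 4) + ∑ l : κ, ENNReal.ofReal e :=
          (measure_mono hcov).trans ((measure_union_le _ _).trans (add_le_add hS
            ((measure_iUnion_fintype_le _ _).trans (Finset.sum_le_sum fun l _ => hrem l))))
      _ = ENNReal.ofReal (1 / 4 + Fintype.card κ * e) := by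
          rw [ENNReal.ofReal_add (by norm_num) (by positivity), ENNReal.ofReal_mul (by positivity)]
          simp
      _ ≤ _ := ENNReal.ofReal_le_ofReal (by linarith)
  have hR2 : 1 / 2 ≤ ν.real R := by
    have h1 : ν.real Rᶜ ≤ 1 / 2 := ENNReal.toReal_le_of_le_ofReal (by norm_num) hRc
    rw [probReal_compl_eq_one_sub hRm] at h1
    linarith
  have hB : c ≤ ν.real (Metric.closedBall (x k) (r / 2 * h)) :=
    (ENNReal.ofReal_le_iff_le_toReal (measure_ne_top _ _)).1 hball
  have hsub : Metric.closedBall (x k) (r / 2 * h) ×ˢ R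
      ⊆ coinPairs (scaledKernel K h) b τ x k := by
    rintro ⟨y, z⟩ ⟨hy, hz⟩
    have hn : ‖h⁻¹ • (x k - y)‖ ≤ r / 2 := by
      rw [norm_smul, norm_inv, Real.norm_of_nonneg hh.le, ← dist_eq_norm, dist_comm,
        inv_mul_le_iff₀ hh, mul_comm]
      exact hy
    refine ⟨hKb _ (hn.trans (by linarith)), hz k, fun l hl => ⟨?_, hz l⟩⟩
    by_contra hlt
    -- The radius `r / 2` leaves room for the strict inequality in `reachSet`.
    refine hfar l hl ⟨hkS, h⁻¹ • (x k - y), by linarith, ?_⟩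
    rw [← smul_add, sub_add_sub_cancel]
    exact not_le.1 hlt
  calc c / 2 = c * (1 / 2) := by ring
    _ ≤ ν.real (Metric.closedBall (x k) (r / 2 * h)) * ν.real R := by gcongr
    _ = (ν.prod ν).real (Metric.closedBall (x k) (r / 2 * h) ×ˢ R) := (measureReal_prod_prod _ _).symm
    _ ≤ _ := measureReal_mono hsub

/-- Verifies the smallness conditions of the ghost argument. The decisive one is that `m' ^ 2`
pairs, each close with probability of order `h ^ d / τ`, rarely contain a close pair; with `τ` of
order `1 / m'` this asks for `h ^ d * m' ^ 3` to be small, which a bounded `h ^ d * m' ^ 8` amply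
provides. -/
theorem measure_unstable_le_of_scales {ν : Measure (Attr d)} [IsProbabilityMeasure ν]
    {K : Attr d → ℝ} (hK : Continuous K) (hK0 : ∀ x, 0 ≤ K x) {r b C M L c δ h Λ : ℝ} (hr : 0 < r)
    (hb : 0 < b) (hC : 0 < C) (hKb : ∀ x, ‖x‖ ≤ r → b ≤ K x)
    (hreach : ∀ τ > 0, volume (reachSet K r τ) ≤ ENNReal.ofReal (C / τ)) (hM : 0 < M)
    (hKM : ∀ x, K x ≤ M) {S : Set (Attr d)} (hSm : MeasurableSet S) (hL : 0 < L)
    (hSν : ∀ A, MeasurableSet A → ν (A ∩ S) ≤ ENNReal.ofReal L * volume A)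
    (hS4 : ν Sᶜ ≤ ENNReal.ofReal (1 / 4)) (hδ : 0 < δ) (hSδ : ν Sᶜ ≤ ENNReal.ofReal (δ / 4))
    (hc : 0 < c) (hh : 0 < h)
    (hball : ν {x | ν (Metric.closedBall x (r / 2 * h)) < ENNReal.ofReal (c * h ^ d)}
      ≤ ENNReal.ofReal (δ / 4))
    {k m m' : ℕ} (hmk : 2 * m ≤ k) (hm'1 : 1 ≤ m') (hk : (k : ℝ) * h ^ d = Λ ^ 8) (hΛ : 1 ≤ Λ)
    (hm' : h ^ d * m' ^ 8 ≤ 256) (hm'' : 4096 * L * C / b ≤ m') (hmδ : 16 ≤ δ ^ 2 * m') {p : ℕ}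
    {ψ : Attr d → ℝ} (hψ : Measurable ψ) {Θ : Type*} [Countable Θ]
    (θ : Θ → Fin (p + 1) × Fin (p + 1) → ℝ) :
    Measure.pi (fun _ : Fin (k - m) => ν)
      {y | ∃ j, δ < ν.real (unstableSet (θ j) ψ (kernSum (scaledKernel K h) y) (Λ ^ 2))}
      ≤ ENNReal.ofReal (2 * (2 ^ m' * Real.exp (-((⌊δ / 8 * m'⌋₊ + 1) * (c / 16 * Λ ^ 8))))
        + 2 * coinBound p m' (⌈k * M⌉₊ + 1) ⌊c / 16 * Λ ^ 8⌋₊ ⌊δ / 8 * m'⌋₊ b (Λ ^ 2)) := by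
  classical
  have hm'0 : (0 : ℝ) < m' := by exact_mod_cast hm'1
  have hm'1' : (1 : ℝ) ≤ m' := by exact_mod_cast hm'1
  have hhd : 0 < h ^ d := pow_pos hh d
  -- The largest level that makes the system of `m'` sums diagonally dominant.
  set τ : ℝ := b / (4 * m') with hτ
  have hτ0 : 0 < τ := by positivity
  set Γ : Set (Attr d) := S ∩ {x | ν (Metric.closedBall x (r / 2 * h)) < ENNReal.ofReal (c * h ^ d)}ᶜ
    with hΓ
  have hBm : MeasurableSet
      {x | ν (Metric.closedBall x (r / 2 * h)) < ENNReal.ofReal (c * h ^ d)} :=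
    measurableSet_lt (measurable_measure_closedBall ν _) measurable_const
  have hΓm : MeasurableSet Γ := hSm.inter hBm.compl
  have hΓδ : ν.real Γᶜ ≤ δ / 2 := by
    refine ENNReal.toReal_le_of_le_ofReal (by positivity) ?_
    rw [hΓ, Set.compl_inter, compl_compl]
    refine (measure_union_le _ _).trans ((add_le_add hSδ hball).trans_eq ?_)
    rw [← ENNReal.ofReal_add (by positivity) (by positivity)]
    congr 1
    ring
  -- the probability that two ghost points are close
  have hkey : (m' : ℝ) ^ 2 * (L * (h ^ d * (C / τ))) ≤ 1 / 4 := by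
    have h1 : (m' : ℝ) ^ 2 * (L * (h ^ d * (C / τ))) = 4 * L * C / b * (h ^ d * m' ^ 3) := by
      rw [hτ]
      field_simp
    have h2 : h ^ d * (m' : ℝ) ^ 3 * m' ≤ 256 := by
      refine le_trans ?_ hm'
      rw [mul_assoc, ← pow_succ]
      gcongr
      norm_num
    have h3 : 4 * L * C / b * (h ^ d * m' ^ 3) ≤ m' / 1024 * (h ^ d * m' ^ 3) := by
      refine mul_le_mul_of_nonneg_right ?_ (by positivity)
      rw [le_div_iff₀ (by norm_num)]
      refine le_trans (le_of_eq ?_) hm''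
      ring
    rw [h1]
    linarith
  have hD : (m' : ENNReal) ^ 2 * (ν.prod ν) (closePairs K r τ h S) ≤ ENNReal.ofReal (1 / 4) := by
    calc _ ≤ (m' : ENNReal) ^ 2 * ENNReal.ofReal (L * (h ^ d * (C / τ))) := by
          gcongr
          exact measure_closePairs_le hK hh hL hSm hSν (hreach τ hτ0)
      _ = ENNReal.ofReal ((m' : ℝ) ^ 2 * (L * (h ^ d * (C / τ)))) := by
          rw [ENNReal.ofReal_mul (p := (m' : ℝ) ^ 2) (by positivity),
            ENNReal.ofReal_pow (by positivity), ENNReal.ofReal_natCast]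
      _ ≤ _ := ENNReal.ofReal_le_ofReal hkey
  have hrem : (m' : ℝ) * (L * (h ^ d * (C / τ))) ≤ 1 / 4 := by
    refine le_trans ?_ hkey
    gcongr
    exact le_self_pow₀ hm'1' two_ne_zero
  have hcardk : ((k - m : ℕ) : ℝ) = k - m := Nat.cast_sub (by omega)
  have hmk' : (2 * m : ℝ) ≤ k := by exact_mod_cast hmk
  have hq4 : c / 16 * Λ ^ 8 ≤ Fintype.card (Fin (k - m)) * (c * h ^ d / 2) / 4 := by
    rw [Fintype.card_fin, hcardk, ← hk]
    have h1 : (k : ℝ) / 2 ≤ k - m := by linarith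
    have h2 : (k : ℝ) / 2 * (c * h ^ d / 2) ≤ (k - m) * (c * h ^ d / 2) := by gcongr
    linarith
  -- The grid has to reach beyond `k * M`, the largest possible sum, and its mesh `Λ ^ 2` is at
  -- least `1`. At least half of the `k` points lie outside the block, which explains `c / 16`. The
  -- budget `δ * m' / 4` is shared equally by `ρ` and `R`.
  have hmain := measure_exists_unstable_gt_le (ι := Fin (k - m)) (p := p) (m := m')
    (G := ⌈k * M⌉₊ + 1) (w := ⌊c / 16 * Λ ^ 8⌋₊) (ρ := ⌊δ / 8 * m'⌋₊) (R := ⌊δ / 8 * m'⌋₊)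
    (q := c * h ^ d / 2) (t := Λ ^ 2) ν (measurable_scaledKernel hK.measurable h)
    (M := M) (fun _ _ => hK0 _) (fun _ _ => hKM _) hb hτ0.le
    (by rw [hτ, div_lt_iff₀ (by positivity)]; nlinarith) (by positivity)
    (by rw [hτ]; apply le_of_eq; field_simp) hΓm (measurableSet_closePairs hK r τ h hSm) hD
    (fun x hx κ => le_measure_coinPairs hK hr hh hKb κ.2.1
      (by simpa using κ.2.2) (fun l hl => hx _ _ fun h => hl (Subtype.ext h.symm)) hS4
      (e := L * (h ^ d * (C / τ))) (by positivity)
      (fun l => measure_scaledKernel_gt_le hK hr hh hL hSν (hreach τ hτ0) _) (by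
        refine le_trans ?_ hrem
        gcongr
        simpa using Fintype.card_subtype_le fun l => x l ∈ Γ))
    ((Nat.floor_le (by positivity)).trans hq4) (by
      rw [Fintype.card_fin]
      have h1 : ((k - m : ℕ) : ℝ) * M ≤ k * M := by gcongr; exact Nat.sub_le _ _
      have h2 : (k * M : ℝ) ≤ ⌈k * M⌉₊ := Nat.le_ceil _
      have h3 : (1 : ℝ) ≤ Λ ^ 2 := one_le_pow₀ hΛ
      push_cast
      nlinarith [(Nat.cast_nonneg ⌈k * M⌉₊ : (0 : ℝ) ≤ ⌈k * M⌉₊)]) hψ θ hδ hΓδ hmδ (by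
      have := Nat.floor_le (show 0 ≤ δ / 8 * m' by positivity)
      linarith)
  refine hmain.trans (ENNReal.ofReal_le_ofReal ?_)
  rw [mul_add]
  gcongr

/-- The probability of crowding must be at most `exp (-(8 / δ))`, since it is raised to the power
`⌊δ * m / 2⌋₊` against `2 ^ m`. Half of it is the mass outside `S` together with Markov's bound, of
order `m * h ^ d / Λ ^ 2`. -/
theorem measure_hits_posSet_dev_le_of_scales {ν : Measure (Attr d)} [IsProbabilityMeasure ν]
    {K : Attr d → ℝ} (hK : IsContinuousRegularKernel K) {M L δ h Λ : ℝ} (hM : 0 < M)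
    (hKM : ∀ x, K x ≤ M) {S : Set (Attr d)} (hL : 0 < L)
    (hSν : ∀ A, MeasurableSet A → ν (A ∩ S) ≤ ENNReal.ofReal L * volume A) (hδ : 0 < δ)
    (hSq : ν Sᶜ ≤ ENNReal.ofReal (Real.exp (-(8 / δ)) / 4)) (hh : 0 < h)
    {k m m' : ℕ} (hmk : 2 * m ≤ k) (hm1 : 1 ≤ m) (hm'1 : 1 ≤ m') (hΛ : 1 ≤ Λ)
    (hMΛ : 2 * M ≤ Λ ^ 2) (hmm' : (m : ℝ) ≤ 2 * Λ * m') (hm' : h ^ d * m' ^ 8 ≤ 256)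
    (hmδ : 2 ≤ δ ^ 2 * m)
    (hΛq : 2048 * L * (∫ z, K z) ≤ Real.exp (-(8 / δ)) / 4 * Λ) {p : ℕ}
    {ψ : Attr d → ℝ} (hψ : Measurable ψ) {Θ : Type*} [Countable Θ]
    (θ : Θ → Fin (p + 1) × Fin (p + 1) → ℝ) {η : ENNReal}
    (hη : Measure.pi (fun _ : Fin (k - m) => ν)
      {y | ∃ j, δ < ν.real (unstableSet (θ j) ψ (kernSum (scaledKernel K h) y) (Λ ^ 2))} ≤ η) :
    Measure.pi (fun _ : Fin k => ν)
      {x | ∃ j, 6 * δ * k < |hits (posSet (θ j) ψ (kernSum (scaledKernel K h) x)) x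
        - k * ν.real (posSet (θ j) ψ (kernSum (scaledKernel K h) x))|}
      ≤ k * (ENNReal.ofReal (blockBound p m δ) + η
        + ENNReal.ofReal (2 * (2 ^ m * Real.exp (-(8 / δ)) ^ ⌊δ * m / 2⌋₊))) := by
  have hI : 0 ≤ ∫ z, K z := integral_nonneg hK.nonneg
  have hm'1' : (1 : ℝ) ≤ m' := by exact_mod_cast hm'1
  have hhd : 0 < h ^ d := pow_pos hh d
  have hqδ : Real.exp (-(8 / δ)) ≤ δ := by
    have h1 : 8 / δ + 1 ≤ Real.exp (8 / δ) := Real.add_one_le_exp _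
    rw [Real.exp_neg, inv_le_comm₀ (Real.exp_pos _) hδ]
    refine le_trans ?_ h1
    rw [inv_eq_one_div, div_add_one hδ.ne']
    gcongr
    linarith
  have hs : Λ ^ 2 / 4 ≤ (Λ ^ 2 - M) / 2 := by linarith
  have hΛ0 : 0 < Λ := by linarith
  have hs0 : 0 < (Λ ^ 2 - M) / 2 := lt_of_lt_of_le (by positivity) hs
  have hcrowd : L * (m * (h ^ d * ∫ z, K z) / ((Λ ^ 2 - M) / 2)) ≤ Real.exp (-(8 / δ)) / 4 := by
    have h2 : h ^ d * (m' : ℝ) ≤ 256 := by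
      refine le_trans ?_ hm'
      gcongr
      exact le_self_pow₀ hm'1' (by norm_num)
    calc L * (m * (h ^ d * ∫ z, K z) / ((Λ ^ 2 - M) / 2))
        ≤ L * (2 * Λ * m' * (h ^ d * ∫ z, K z) / (Λ ^ 2 / 4)) := by gcongr
      _ = 8 * L * (∫ z, K z) * (h ^ d * m') / Λ := by field_simp; ring
      _ ≤ 8 * L * (∫ z, K z) * 256 / Λ := by gcongr
      _ ≤ _ := by rw [div_le_iff₀ hΛ0]; linarith
  have hblock := measure_block_dev_le (ι := Fin (k - m)) (m := m) (p := p)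
    (q := ENNReal.ofReal (Real.exp (-(8 / δ)))) (t := Λ ^ 2) (c := ⌊δ * m / 2⌋₊) ν
    (measurable_scaledKernel hK.continuous.measurable h) (M := M) (fun _ _ => hK.nonneg _) hM.le
    (fun _ _ => hKM _) (fun a T => by
      refine (measure_sum_scaledKernel_gt_le hK hh hL hs0 hSν a T).trans
        ((add_le_add hSq (ENNReal.ofReal_le_ofReal hcrowd)).trans ?_)
      rw [← ENNReal.ofReal_add (by positivity) (by positivity)]
      exact ENNReal.ofReal_le_ofReal (by linarith [Real.exp_pos (-(8 / δ))]))
    (by positivity) hψ θ hδ (ENNReal.ofReal_le_ofReal hqδ) hmδ (by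
      have := Nat.floor_le (show 0 ≤ δ * m / 2 by positivity)
      linarith) hη
  refine (measure_hits_posSet_dev_le (by omega) (by omega) (by omega) ν θ hblock).trans
    (le_of_eq ?_)
  congr 2
  rw [ENNReal.ofReal_mul zero_le_two, ENNReal.ofReal_mul (by positivity),
    ENNReal.ofReal_pow zero_le_two, ENNReal.ofReal_pow (Real.exp_pos _).le]
  simp

end ClassDeviation

/-! ### Choice of the scales -/

section ClassDeviationAsymptotics

variable {d : ℕ}

/-- The bound is uniform in `ψ`, because the sample of the other class will be frozen, and it is
stated along a general filter, because the size `k` of the class is not a function of the total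
sample size. -/
theorem eventually_measure_hits_posSet_dev_le (hd : 0 < d) {ν : Measure (Attr d)}
    [IsProbabilityMeasure ν] (hν : ν ≪ volume) {K : Attr d → ℝ}
    (hK : IsContinuousRegularKernel K) {α : Type*} {l : Filter α} {k : α → ℕ} {h : α → ℝ}
    (hh : ∀ a, 0 < h a) (h0 : Tendsto h l (𝓝 0))
    (hkh : Tendsto (fun a => k a * h a ^ d) l atTop) {p : ℕ} {Θ : Type*} [Countable Θ]
    (θ : Θ → Fin (p + 1) × Fin (p + 1) → ℝ) {ε : ℝ} (hε : 0 < ε) :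
    ∀ᶠ a in l, ∀ ψ, Measurable ψ → Measure.pi (fun _ : Fin (k a) => ν)
      {x | ∃ j, ε * k a < |hits (posSet (θ j) ψ (kernSum (scaledKernel K (h a)) x)) x
        - k a * ν.real (posSet (θ j) ψ (kernSum (scaledKernel K (h a)) x))|}
      ≤ ENNReal.ofReal (4 / (k a : ℝ) ^ 3) := by
  obtain ⟨δ, hδ, rfl⟩ : ∃ δ, 0 < δ ∧ ε = 6 * δ := ⟨ε / 6, by positivity, by ring⟩
  have hκ : 0 < Real.exp (-(8 / δ)) := Real.exp_pos _
  obtain ⟨S, hSm, L, hL, hS, hSν⟩ := exists_density_bound ν hν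
    (show 0 < min (min (1 / 4) (δ / 4)) (Real.exp (-(8 / δ)) / 4) by positivity)
  obtain ⟨r, hr, b, hb, C, hC, hKb, hreach⟩ := hK.exists_reach
  obtain ⟨M, hM, hKM⟩ := hK.exists_le
  obtain ⟨c, hc, hball⟩ := exists_closedBall_lower_bound ν hν (show 0 < δ / 4 by positivity)
    (half_pos hr)
  -- Both scales tend to infinity, one through `k h ^ d → ∞` and the other through `h → 0`, and `k =
  -- (Λ Z) ^ 8`. The power `8` leaves room in every estimate.
  set Λ : α → ℝ := fun a => (k a * h a ^ d) ^ ((8 : ℕ) : ℝ)⁻¹ with hΛdef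
  set Z : α → ℝ := fun a => ((h a ^ d)⁻¹) ^ ((8 : ℕ) : ℝ)⁻¹ with hZdef
  have hhd : ∀ a, 0 < h a ^ d := fun a => pow_pos (hh a) d
  have hΛ8 : ∀ a, Λ a ^ 8 = k a * h a ^ d := fun a =>
    Real.rpow_inv_natCast_pow (mul_nonneg (Nat.cast_nonneg _) (hhd a).le) (by norm_num)
  have hZ8 : ∀ a, Z a ^ 8 = (h a ^ d)⁻¹ := fun a =>
    Real.rpow_inv_natCast_pow (inv_nonneg.2 (hhd a).le) (by norm_num)
  have hΛ : Tendsto Λ l atTop := (tendsto_rpow_atTop (by positivity)).comp hkh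
  have hhd0 : Tendsto (fun a => h a ^ d) l (𝓝[>] 0) := by
    refine tendsto_nhdsWithin_iff.2 ⟨?_, Eventually.of_forall hhd⟩
    have := h0.pow d
    rwa [zero_pow hd.ne'] at this
  have hZ : Tendsto Z l atTop := (tendsto_rpow_atTop (by positivity)).comp
    (tendsto_inv_nhdsGT_zero.comp hhd0)
  have hkΛZ : ∀ a, (k a : ℝ) = (Λ a * Z a) ^ 8 := fun a => by
    rw [mul_pow, hΛ8, hZ8, mul_inv_cancel_right₀ (hhd a).ne']
  set m : α → ℕ := fun a => ⌈Λ a * Z a⌉₊ with hm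
  set m' : α → ℕ := fun a => ⌈Z a⌉₊ with hm'
  have hmt : Tendsto m l atTop := tendsto_nat_ceil_atTop.comp (hΛ.atTop_mul_atTop₀ hZ)
  have hm't : Tendsto m' l atTop := tendsto_nat_ceil_atTop.comp hZ
  have hmr : Tendsto (fun a => (m a : ℝ)) l atTop := tendsto_natCast_atTop_atTop.comp hmt
  have hm'r : Tendsto (fun a => (m' a : ℝ)) l atTop := tendsto_natCast_atTop_atTop.comp hm't
  have hΛ8t : Tendsto (fun a => Λ a ^ 8) l atTop := (tendsto_pow_atTop (by norm_num)).comp hΛ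
  have hk0 : ∀ᶠ a in l, 0 < k a := by
    filter_upwards [hΛ.eventually_gt_atTop 0, hZ.eventually_gt_atTop 0] with a h1 h2
    have : (0 : ℝ) < k a := by rw [hkΛZ]; positivity
    exact_mod_cast this
  have hkm : ∀ᶠ a in l, k a ≤ m a ^ 8 := by
    filter_upwards [hΛ.eventually_gt_atTop 0, hZ.eventually_gt_atTop 0] with a h1 h2
    have : (k a : ℝ) ≤ (m a : ℝ) ^ 8 := by
      rw [hkΛZ]
      exact pow_le_pow_left₀ (by positivity) (Nat.le_ceil _) 8
    exact_mod_cast this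
  have hkm' : ∀ᶠ a in l, (k a : ℝ) ≤ Λ a ^ 8 * m' a ^ 8 := by
    filter_upwards [hΛ.eventually_gt_atTop 0, hZ.eventually_gt_atTop 0] with a h1 h2
    rw [hkΛZ, mul_pow]
    gcongr
    exact Nat.le_ceil _
  have hk0r : ∀ᶠ a in l, (0 : ℝ) < k a := hk0.mono fun a h => Nat.cast_pos.2 h
  have e1 := eventually_blockBound_le p hδ hmt hk0 hkm
  have e2 := eventually_two_pow_mul_pow_le hδ hmt hk0 hkm
  have e3 := eventually_two_pow_mul_exp_le hm't hΛ8t hk0r hkm' (show 0 < δ / 8 by positivity)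
    (show 0 < c / 16 by positivity)
  have e4 := eventually_coinBound_le p (G := fun a => ⌈k a * M⌉₊ + 1) hm't hΛ hk0r hkm'
    (show 0 < δ / 8 by positivity) (show 0 < c / 16 by positivity) hb
    (show 0 ≤ M + 4 by positivity) (by
      filter_upwards [hk0] with a ha
      have h1 := Nat.ceil_lt_add_one (show 0 ≤ k a * M by positivity)
      have h2 : (1 : ℝ) ≤ k a := by exact_mod_cast ha
      push_cast
      nlinarith)
  have hh0 : Tendsto h l (𝓝[>] 0) := tendsto_nhdsWithin_iff.2 ⟨h0, Eventually.of_forall hh⟩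
  filter_upwards [e1, e2, e3, e4, hh0.eventually hball, hk0, hΛ.eventually_ge_atTop 2,
    hZ.eventually_ge_atTop 1, hmt.eventually_ge_atTop 1, hm't.eventually_ge_atTop 1,
    hΛ.eventually_ge_atTop (2 * M), hm'r.eventually_ge_atTop (4096 * L * C / b),
    hm'r.eventually_ge_atTop (16 / δ ^ 2), hmr.eventually_ge_atTop (2 / δ ^ 2),
    hΛ.eventually_ge_atTop (2048 * L * (∫ z, K z) / (Real.exp (-(8 / δ)) / 4))]
    with a a1 a2 a3 a4 aball ak aΛ aZ am am' aΛM am'L am'δ amδ aΛq ψ hψ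
  have hΛ0 : 0 < Λ a := by linarith
  have hZ0 : 0 < Z a := by linarith
  have hprod : 2 ≤ Λ a * Z a := by nlinarith
  have hm2 : (m a : ℝ) ≤ 2 * (Λ a * Z a) := by
    have := Nat.ceil_lt_add_one (show 0 ≤ Λ a * Z a by positivity)
    simp only [hm]
    linarith
  have hm'2 : (m' a : ℝ) ≤ 2 * Z a := by
    have := Nat.ceil_lt_add_one hZ0.le
    simp only [hm']
    linarith
  have hZm' : Z a ≤ m' a := Nat.le_ceil _
  have hmk : 2 * m a ≤ k a := by
    have h1 : (2 * m a : ℝ) ≤ k a := by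
      rw [hkΛZ]
      have h2 : (2 : ℝ) ^ 7 ≤ (Λ a * Z a) ^ 7 := pow_le_pow_left₀ zero_le_two hprod 7
      nlinarith
    exact_mod_cast h1
  have hm'256 : h a ^ d * (m' a : ℝ) ^ 8 ≤ 256 := by
    calc h a ^ d * (m' a : ℝ) ^ 8 ≤ h a ^ d * (2 * Z a) ^ 8 := by
          gcongr
          exact (hhd a).le
      _ = 256 * (h a ^ d * Z a ^ 8) := by ring
      _ = 256 := by rw [hZ8, mul_inv_cancel₀ (hhd a).ne', mul_one]
  have hη := measure_unstable_le_of_scales (p := p) (m := m a) hK.continuous hK.nonneg hr hb hC hKb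
    hreach hM
    hKM hSm hL hSν (hS.trans (ENNReal.ofReal_le_ofReal ((min_le_left _ _).trans (min_le_left _ _))))
    hδ (hS.trans (ENNReal.ofReal_le_ofReal ((min_le_left _ _).trans (min_le_right _ _)))) hc (hh a)
    aball hmk am' (hΛ8 a).symm (by linarith) hm'256 am'L
    (by rw [div_le_iff₀ (by positivity)] at am'δ; linarith) hψ θ
  have hmain := measure_hits_posSet_dev_le_of_scales (p := p) hK hM hKM hL hSν hδ
    (hS.trans (ENNReal.ofReal_le_ofReal (min_le_right _ _))) (hh a) hmk am am' (by linarith)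
    (by nlinarith) (by nlinarith) hm'256
    (by rw [div_le_iff₀ (by positivity)] at amδ; linarith)
    (by rw [div_le_iff₀ (by positivity)] at aΛq; linarith) hψ θ hη
  refine hmain.trans ?_
  have hk0' : (0 : ℝ) < k a := Nat.cast_pos.2 ak
  calc _ ≤ (k a : ENNReal) * (ENNReal.ofReal (1 / (k a : ℝ) ^ 4)
        + ENNReal.ofReal (1 / (k a : ℝ) ^ 4 + 1 / (k a : ℝ) ^ 4)
        + ENNReal.ofReal (1 / (k a : ℝ) ^ 4)) := by gcongr
    _ = ENNReal.ofReal (4 / (k a : ℝ) ^ 3) := by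
        rw [← ENNReal.ofReal_add (by positivity) (by positivity),
          ← ENNReal.ofReal_add (by positivity) (by positivity), ← ENNReal.ofReal_natCast,
          ← ENNReal.ofReal_mul (by positivity)]
        congr 1
        field_simp
        norm_num

end ClassDeviationAsymptotics

/-! ### Conditioning on the labels -/

section Labels

variable {E Z : Type*} [MeasurableSpace E] [MeasurableSpace Z]

theorem pi_const_smul {κ : Type*} [Fintype κ] (ν : Measure E) [IsProbabilityMeasure ν]
    {c : ENNReal} (hc : c ≠ ⊤) :
    Measure.pi (fun _ : κ => c • ν) = c ^ Fintype.card κ • Measure.pi fun _ : κ => ν := by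
  have : IsFiniteMeasure (c • ν) := ν.smul_finite hc
  refine Measure.pi_eq fun s _ => ?_
  simp [Measure.smul_apply, Measure.pi_pi, Finset.prod_mul_distrib]

/-- On the event that exactly the observations in `T` lie in `J`, their images are i.i.d. with law
`ν` and independent of the rest. The factor after `β` is the probability of that event when `c` is
the mass of `J`. -/
theorem measure_pi_forall_mem_iff_le {n : ℕ} (P : Measure Z) [IsProbabilityMeasure P] {J : Set Z}
    (hJ : MeasurableSet J) {φ : Z → E} (hφ : Measurable φ) {ν : Measure E} [IsProbabilityMeasure ν]
    {c : ENNReal} (hc : c ≠ ⊤) (hν : (P.restrict J).map φ = c • ν) (T : Finset (Fin n))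
    {B : Set ((T → E) × ({i // i ∉ T} → Z))} (hB : MeasurableSet B) {β : ENNReal}
    (hβ : ∀ z, Measure.pi (fun _ : T => ν) {y | (y, z) ∈ B} ≤ β) :
    Measure.pi (fun _ : Fin n => P) {D | (∀ i, D i ∈ J ↔ i ∈ T) ∧
      ((fun i : T => φ (D i)), fun i : {i // i ∉ T} => D i) ∈ B}
      ≤ β * (c ^ T.card * P Jᶜ ^ (n - T.card)) := by
  classical
  have hfin : IsFiniteMeasure (c • ν) := ν.smul_finite hc
  have hmp := measurePreserving_piEquivPiSubtypeProd (fun _ : Fin n => P) (fun i => i ∈ T)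
  rw [Subsingleton.elim (Subtype.fintype fun i => i ∈ T) (Finset.Subtype.fintype T)] at hmp
  set C : Set (({i // i ∈ T} → Z) × ({i // i ∉ T} → Z)) :=
    {q | (q.1 ∈ Set.univ.pi fun _ => J) ∧ (q.2 ∈ Set.univ.pi fun _ => Jᶜ) ∧
      ((fun i => φ (q.1 i)), q.2) ∈ B} with hC
  have hφm : Measurable fun y : {i // i ∈ T} → Z => fun i => φ (y i) :=
    measurable_pi_lambda _ fun i => hφ.comp (measurable_pi_apply i)
  have hCm : MeasurableSet C :=
    (measurable_fst (MeasurableSet.univ_pi fun _ => hJ)).inter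
      ((measurable_snd (MeasurableSet.univ_pi fun _ => hJ.compl)).inter
        (((hφm.comp measurable_fst).prodMk measurable_snd) hB))
  have hsub : {D | (∀ i, D i ∈ J ↔ i ∈ T) ∧
      ((fun i : T => φ (D i)), fun i : {i // i ∉ T} => D i) ∈ B}
      ⊆ MeasurableEquiv.piEquivPiSubtypeProd (fun _ : Fin n => Z) (fun i => i ∈ T) ⁻¹' C := by
    rintro D ⟨h1, h2⟩
    exact ⟨fun i _ => (h1 i).2 i.2, fun i _ => fun h => i.2 ((h1 i).1 h), h2⟩
  refine (measure_mono hsub).trans ?_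
  rw [hmp.measure_preimage hCm.nullMeasurableSet, Measure.prod_apply_symm hCm]
  have hsec : ∀ z, Measure.pi (fun _ : {i // i ∈ T} => P) ((fun y => (y, z)) ⁻¹' C)
      ≤ (Set.univ.pi fun _ => Jᶜ).indicator (fun _ => β * c ^ T.card) z := by
    intro z
    by_cases hz : z ∈ Set.univ.pi fun _ : {i // i ∉ T} => Jᶜ
    · rw [Set.indicator_of_mem hz]
      have hBz : MeasurableSet {y : {i // i ∈ T} → E | (y, z) ∈ B} :=
        measurable_prodMk_right hB
      have e1 : (fun y => (y, z)) ⁻¹' C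
          ⊆ ((fun y : {i // i ∈ T} → Z => fun i => φ (y i)) ⁻¹' {y | (y, z) ∈ B})
            ∩ Set.univ.pi fun _ => J := fun y hy => ⟨hy.2.2, hy.1⟩
      refine (measure_mono e1).trans ?_
      rw [← Measure.restrict_apply (hφm hBz), Measure.restrict_pi_pi, ← Measure.map_apply hφm hBz,
        Measure.pi_map_pi fun _ => hφ.aemeasurable]
      simp_rw [hν]
      rw [pi_const_smul ν hc, Measure.smul_apply, smul_eq_mul, mul_comm, Fintype.card_coe]
      gcongr
      exact hβ z
    · rw [Set.indicator_of_notMem hz, nonpos_iff_eq_zero]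
      convert measure_empty (μ := Measure.pi fun _ : {i // i ∈ T} => P)
      ext y
      exact iff_of_false (fun h => hz h.2.1) id
  refine (lintegral_mono hsec).trans ?_
  rw [lintegral_indicator_const (MeasurableSet.univ_pi fun _ => hJ.compl), Measure.pi_pi, mul_assoc]
  simp [Fintype.card_subtype_compl]

end Labels

section ClassSamples

variable {E : Type*} [MeasurableSpace E]

/-- The sum of the kernels centred at the sample points with label `j`. -/
def ownSum {n : ℕ} (kern : E → E → ℝ) (D : Fin n → E × Label) (j : Label) (x : E) : ℝ :=
  ∑ i with (D i).2 = j, kern x (D i).1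

/-- The sum of the kernels centred at the sample points with a label other than `j`. -/
def otherSum {n : ℕ} (kern : E → E → ℝ) (D : Fin n → E × Label) (j : Label) (x : E) : ℝ :=
  ∑ i with (D i).2 ≠ j, kern x (D i).1

/-- The number of sample points with label `j` in the set `A`. -/
def classHits {n : ℕ} (D : Fin n → E × Label) (j : Label) (A : Set E) : ℝ :=
  ∑ i with (D i).2 = j, A.indicator (fun _ => (1 : ℝ)) (D i).1

/-- The number of sample points with label `j`. -/
def labelCount {n : ℕ} (D : Fin n → E × Label) (j : Label) : ℕ :=
  (Finset.univ.filter fun i => (D i).2 = j).card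

theorem measure_hits_posSet_dev_reindex (ν : Measure E) [IsProbabilityMeasure ν]
    {kern : E → E → ℝ} {p : ℕ} {ψ : E → ℝ} {Θ : Type*}
    (θ : Θ → Fin (p + 1) × Fin (p + 1) → ℝ) {κ κ' : Type*} [Fintype κ] [Fintype κ'] (e : κ ≃ κ')
    (s : ℝ) :
    Measure.pi (fun _ : κ => ν) {y | ∃ j, s < |hits (posSet (θ j) ψ (kernSum kern y)) y
        - Fintype.card κ * ν.real (posSet (θ j) ψ (kernSum kern y))|}
      = Measure.pi (fun _ : κ' => ν) {y | ∃ j, s < |hits (posSet (θ j) ψ (kernSum kern y)) y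
        - Fintype.card κ' * ν.real (posSet (θ j) ψ (kernSum kern y))|} := by
  have hmp := (measurePreserving_piCongrLeft (fun _ : κ' => ν) e).symm
  rw [← hmp.measure_preimage_equiv]
  congr 1
  ext y
  have h1 : kernSum kern ((MeasurableEquiv.piCongrLeft (fun _ : κ' => E) e).symm y)
      = kernSum kern y := funext fun z => Equiv.sum_comp e fun i => kern z (y i)
  have h2 : ∀ A, hits A ((MeasurableEquiv.piCongrLeft (fun _ : κ' => E) e).symm y) = hits A y :=
    fun A => Equiv.sum_comp e fun i => A.indicator (fun _ => (1 : ℝ)) (y i)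
  simp only [Set.mem_preimage, Set.mem_ofPred_eq, h1, h2, Fintype.card_congr e]

theorem measurableSet_exists_hits_dev {Y κ Θ : Type*} [Fintype κ] [MeasurableSpace Y] [Countable Θ]
    (ν : Measure E) [IsProbabilityMeasure ν] {A : Θ → Y → Set E}
    (hA : ∀ j, MeasurableSet {q : Y × E | q.2 ∈ A j q.1}) {x : Y → κ → E} (hx : Measurable x)
    (s : ℝ) : MeasurableSet {q | ∃ j, s < |hits (A j q) (x q)
      - Fintype.card κ * ν.real (A j q)|} := by
  simp only [Set.ofPred_exists]
  refine MeasurableSet.iUnion fun j => measurableSet_lt measurable_const ?_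
  have h1 : Measurable fun q => hits (A j q) (x q) :=
    (measurable_hits_prod (κ := κ) (hA j)).comp (measurable_id.prodMk hx)
  exact continuous_abs.measurable.comp
    (h1.sub (measurable_const.mul (measurable_measure_prodMk_left (hA j)).ennreal_toReal))

theorem measurableSet_posSet_prod {Y : Type*} [MeasurableSpace Y] {p : ℕ}
    (θ : Fin (p + 1) × Fin (p + 1) → ℝ) {ψ s : Y → E → ℝ}
    (hψ : Measurable fun r : Y × E => ψ r.1 r.2) (hs : Measurable fun r : Y × E => s r.1 r.2) :
    MeasurableSet {r : Y × E | r.2 ∈ posSet θ (ψ r.1) (s r.1)} := by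
  have h : {r : Y × E | r.2 ∈ posSet θ (ψ r.1) (s r.1)}
      = (fun r : Y × E => (ψ r.1 r.2, s r.1 r.2)) ⁻¹' {q | 0 < θ ⬝ᵥ derivVec p 0 q.1 q.2} :=
    Set.ext fun r => mem_posSet
  rw [h]
  exact (hψ.prodMk hs) (measurableSet_lt measurable_const (measurable_dotProduct_derivVec θ 0))

/-- Sums the conditional bounds over all possible sets `T` of indices with label `j`; their weights
add up to one by the binomial theorem, so the bound `β` survives unchanged. -/
theorem measure_classHits_dev_le {n : ℕ} (P : Measure (E × Label)) [IsProbabilityMeasure P]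
    {j : Label} {ν : Measure E} [IsProbabilityMeasure ν] {c : ENNReal} (hc : c ≠ ⊤)
    (hν : (P.restrict {q | q.2 = j}).map Prod.fst = c • ν) {kern : E → E → ℝ}
    (hk : Measurable (Function.uncurry kern)) {p : ℕ} {Θ : Type*} [Countable Θ]
    (θ : Θ → Fin (p + 1) × Fin (p + 1) → ℝ) {ε k₀ : ℝ} {β : ENNReal}
    (hβ : ∀ k : ℕ, k₀ ≤ k → ∀ ψ, Measurable ψ → Measure.pi (fun _ : Fin k => ν)
      {x | ∃ a, ε * k < |hits (posSet (θ a) ψ (kernSum kern x)) x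
        - k * ν.real (posSet (θ a) ψ (kernSum kern x))|} ≤ β) :
    Measure.pi (fun _ : Fin n => P) {D | k₀ ≤ labelCount D j ∧ ∃ a, ε * labelCount D j <
      |classHits D j (posSet (θ a) (otherSum kern D j) (ownSum kern D j))
        - labelCount D j * ν.real (posSet (θ a) (otherSum kern D j) (ownSum kern D j))|} ≤ β := by
  classical
  have hJ : MeasurableSet {q : E × Label | q.2 = j} := measurable_snd (measurableSet_singleton j)
  have hcP : c = P {q | q.2 = j} := by
    have := congrArg (fun m => m Set.univ) hν
    simp only [Measure.smul_apply, measure_univ, smul_eq_mul, mul_one] at this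
    rw [Measure.map_apply measurable_fst MeasurableSet.univ] at this
    simpa using this.symm
  set Ψ : (T : Finset (Fin n)) → ({i // i ∉ T} → E × Label) → E → ℝ :=
    fun T z x => ∑ i, kern x (z i).1 with hΨ
  have hΨm : ∀ T, Measurable fun r : ({i // i ∉ T} → E × Label) × E => Ψ T r.1 r.2 := fun T => by
    refine Finset.measurable_sum _ fun i _ => ?_
    have e : Measurable fun r : ({i // i ∉ T} → E × Label) × E => (r.1 i).1 :=
      measurable_fst.comp ((measurable_pi_apply i).comp measurable_fst)
    have := hk.comp (measurable_snd.prodMk e)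
    exact this
  set B : (T : Finset (Fin n)) → Set ((T → E) × ({i // i ∉ T} → E × Label)) := fun T =>
    {q | ∃ a, ε * T.card < |hits (posSet (θ a) (Ψ T q.2) (kernSum kern q.1)) q.1
        - Fintype.card T * ν.real (posSet (θ a) (Ψ T q.2) (kernSum kern q.1))|} with hB
  have hBm : ∀ T, MeasurableSet (B T) := fun T =>
    measurableSet_exists_hits_dev ν
      (A := fun a (q : (T → E) × ({i // i ∉ T} → E × Label)) =>
        posSet (θ a) (Ψ T q.2) (kernSum kern q.1))
      (fun a => measurableSet_posSet_prod (θ a)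
        (ψ := fun q : (T → E) × ({i // i ∉ T} → E × Label) => Ψ T q.2)
        (s := fun q => kernSum kern q.1)
        (Measurable.comp (f := fun r : ((T → E) × ({i // i ∉ T} → E × Label)) × E => (r.1.2, r.2))
          (hΨm T) (measurable_fst.snd.prodMk measurable_snd))
        (Measurable.comp (f := fun r : ((T → E) × ({i // i ∉ T} → E × Label)) × E => (r.1.1, r.2))
          (measurable_kernSum hk) (measurable_fst.fst.prodMk measurable_snd)))
      measurable_fst _
  have hone : ∀ T : Finset (Fin n), k₀ ≤ T.card →
      Measure.pi (fun _ : Fin n => P) {D | (∀ i, D i ∈ {q : E × Label | q.2 = j} ↔ i ∈ T) ∧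
        ((fun i : T => (D i).1), fun i : {i // i ∉ T} => D i) ∈ B T}
      ≤ β * (c ^ T.card * P {q | q.2 = j}ᶜ ^ (n - T.card)) := by
    intro T hT
    refine measure_pi_forall_mem_iff_le P hJ measurable_fst hc hν T (hBm T) fun z => ?_
    have h1 := hβ T.card hT (Ψ T z) ((hΨm T).comp measurable_prodMk_left)
    have h2 := measure_hits_posSet_dev_reindex ν (kern := kern) (ψ := Ψ T z) θ T.equivFin
      (ε * T.card)
    rw [Fintype.card_fin] at h2
    exact h2.trans_le h1
  have hcov : {D : Fin n → E × Label | k₀ ≤ labelCount D j ∧ ∃ a, ε * labelCount D j <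
      |classHits D j (posSet (θ a) (otherSum kern D j) (ownSum kern D j))
        - labelCount D j * ν.real (posSet (θ a) (otherSum kern D j) (ownSum kern D j))|}
      ⊆ ⋃ T ∈ (Finset.univ : Finset (Fin n)).powerset.filter fun T => k₀ ≤ (T.card : ℝ),
        {D | (∀ i, D i ∈ {q : E × Label | q.2 = j} ↔ i ∈ T) ∧
        ((fun i : T => (D i).1), fun i : {i // i ∉ T} => D i) ∈ B T} := by
    rintro D ⟨hk₀, a, ha⟩
    set T := Finset.univ.filter fun i => (D i).2 = j with hT
    refine Set.mem_iUnion₂.2 ⟨T, Finset.mem_filter.2 ⟨by simp, hk₀⟩, fun i => by simp [hT], a, ?_⟩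
    have h1 : kernSum kern (fun i : T => (D i).1) = ownSum kern D j := funext fun x =>
      Finset.sum_coe_sort T fun i => kern x (D i).1
    have h2 : Ψ T (fun i : {i // i ∉ T} => D i) = otherSum kern D j := funext fun x => by
      refine (Finset.sum_subtype (p := fun i => i ∉ T)
        (Finset.univ.filter fun i => (D i).2 ≠ j) (fun i => by simp [hT])
        fun i => kern x (D i).1).symm
    have h3 : ∀ A, hits A (fun i : T => (D i).1) = classHits D j A := fun A =>
      Finset.sum_coe_sort T fun i => A.indicator (fun _ => (1 : ℝ)) (D i).1
    rw [h1, h2, h3, Fintype.card_coe]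
    exact ha
  calc _ ≤ ∑ T ∈ (Finset.univ : Finset (Fin n)).powerset.filter fun T => k₀ ≤ (T.card : ℝ),
        β * (c ^ T.card * P {q | q.2 = j}ᶜ ^ (n - T.card)) :=
        (measure_mono hcov).trans ((measure_biUnion_finset_le _ _).trans
          (Finset.sum_le_sum fun T hT => hone T (Finset.mem_filter.1 hT).2))
    _ ≤ ∑ T ∈ (Finset.univ : Finset (Fin n)).powerset,
        β * (c ^ T.card * P {q | q.2 = j}ᶜ ^ (n - T.card)) :=
        Finset.sum_le_sum_of_subset (Finset.filter_subset _ _)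
    _ = β := by
        have := Finset.sum_pow_mul_eq_add_pow c (P {q | q.2 = j}ᶜ) (Finset.univ : Finset (Fin n))
        rw [Finset.card_univ, Fintype.card_fin] at this
        rw [← Finset.mul_sum, this, hcP, prob_add_prob_compl hJ, one_pow, mul_one]

end ClassSamples

/-! ### Almost sure uniform deviations within one class -/

section UniformDeviation

/-- Reduces all `θ` to countably many. Where the form is positive, any approximation will do. Where
it is at most zero, strictness must survive at zero: the constant coefficient is lowered by at least
`1 / (i + 1)`, while the others move by at most `1 / (i + 1) ^ 2`, so the lowering wins eventually
at each point. -/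
theorem exists_rat_seq_dotProduct_pos {p : ℕ} (θ : Fin (p + 1) × Fin (p + 1) → ℝ) :
    ∃ Q : ℕ → Fin (p + 1) × Fin (p + 1) → ℚ, ∀ u s : ℝ, ∀ᶠ i in atTop,
      (0 < (fun c => (Q i c : ℝ)) ⬝ᵥ derivVec p 0 u s ↔ 0 < θ ⬝ᵥ derivVec p 0 u s) := by
  have hex : ∀ (i : ℕ) (c : Fin (p + 1) × Fin (p + 1)), ∃ q : ℚ,
      (c = 0 → θ c - 2 / (i + 1) < q ∧ (q : ℝ) < θ c - 1 / (i + 1)) ∧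
      (c ≠ 0 → θ c < q ∧ (q : ℝ) < θ c + 1 / ((i : ℝ) + 1) ^ 2) := by
    intro i c
    have hi : (0 : ℝ) < i + 1 := by positivity
    by_cases hc : c = 0
    · obtain ⟨q, h1, h2⟩ := exists_rat_btwn (show θ c - 2 / (i + 1) < θ c - 1 / (i + 1) by
        gcongr; norm_num)
      exact ⟨q, fun _ => ⟨h1, h2⟩, fun h => absurd hc h⟩
    · obtain ⟨q, h1, h2⟩ := exists_rat_btwn (show θ c < θ c + 1 / ((i : ℝ) + 1) ^ 2 by
        have : 0 < 1 / ((i : ℝ) + 1) ^ 2 := by positivity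
        linarith)
      exact ⟨q, fun h => absurd h hc, fun _ => ⟨h1, h2⟩⟩
  choose Q hQ0 hQ1 using hex
  refine ⟨Q, fun u s => ?_⟩
  set v := derivVec p 0 u s with hv
  -- The index `0` belongs to the constant monomial.
  have hv0 : v 0 = 1 := by simp [hv, derivVec]
  have hlim1 : Tendsto (fun i : ℕ => 1 / ((i : ℝ) + 1)) atTop (𝓝 0) :=
    tendsto_one_div_add_atTop_nhds_zero_nat
  have hlim : ∀ c, Tendsto (fun i => (Q i c : ℝ)) atTop (𝓝 (θ c)) := by
    intro c
    have h2 : Tendsto (fun i : ℕ => 2 / ((i : ℝ) + 1)) atTop (𝓝 0) := by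
      simpa only [mul_one_div, mul_zero] using hlim1.const_mul 2
    have h3 : Tendsto (fun i : ℕ => 1 / ((i : ℝ) + 1) ^ 2) atTop (𝓝 0) := by
      simpa using hlim1.pow 2
    by_cases hc : c = 0
    · refine tendsto_of_tendsto_of_tendsto_of_le_of_le (by simpa using h2.const_sub (θ c))
        (by simpa using hlim1.const_sub (θ c)) (fun i => (hQ0 i c hc).1.le)
        fun i => (hQ0 i c hc).2.le
    · refine tendsto_of_tendsto_of_tendsto_of_le_of_le tendsto_const_nhds
        (by simpa using h3.const_add (θ c)) (fun i => (hQ1 i c hc).1.le)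
        fun i => (hQ1 i c hc).2.le
  have hdot : Tendsto (fun i => (fun c => (Q i c : ℝ)) ⬝ᵥ v) atTop (𝓝 (θ ⬝ᵥ v)) :=
    tendsto_finsetSum _ fun c _ => (hlim c).mul_const _
  by_cases hpos : 0 < θ ⬝ᵥ v
  · filter_upwards [hdot.eventually (eventually_gt_nhds hpos)] with i hi
    exact iff_of_true hi hpos
  · set S := ∑ c, |v c| with hS
    filter_upwards [tendsto_natCast_atTop_atTop.eventually_ge_atTop S] with i hi
    refine iff_of_false (not_lt.2 (le_trans (le_of_lt ?_) (not_lt.1 hpos))) hpos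
    have hi0 : (0 : ℝ) < i + 1 := by positivity
    have hterm : ∀ c, ((Q i c : ℝ) - θ c) * v c
        ≤ (if c = 0 then -(1 / ((i : ℝ) + 1)) else 0) + |v c| * (1 / ((i : ℝ) + 1) ^ 2) := by
      intro c
      have hnn : 0 ≤ |v c| * (1 / ((i : ℝ) + 1) ^ 2) := by positivity
      by_cases hc : c = 0
      · rw [if_pos hc, hc, hv0, mul_one]
        have := (hQ0 i 0 rfl).2
        rw [hc, hv0] at hnn
        linarith
      · rw [if_neg hc, zero_add, mul_comm]
        have h1 := hQ1 i c hc
        calc v c * ((Q i c : ℝ) - θ c) ≤ |v c| * ((Q i c : ℝ) - θ c) := by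
              gcongr
              · linarith [h1.1]
              · exact le_abs_self _
          _ ≤ _ := by
              gcongr
              linarith [h1.2]
    have hsum : ((fun c => (Q i c : ℝ)) ⬝ᵥ v) - θ ⬝ᵥ v
        ≤ -(1 / ((i : ℝ) + 1)) + S * (1 / ((i : ℝ) + 1) ^ 2) := by
      have e : ((fun c => (Q i c : ℝ)) ⬝ᵥ v) - θ ⬝ᵥ v = ∑ c, ((Q i c : ℝ) - θ c) * v c := by
        simp [dotProduct, sub_mul, Finset.sum_sub_distrib]
      rw [e]
      refine (Finset.sum_le_sum fun c _ => hterm c).trans_eq ?_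
      rw [Finset.sum_add_distrib, ← Finset.sum_mul]
      simp [hS]
    have hneg : -(1 / ((i : ℝ) + 1)) + S * (1 / ((i : ℝ) + 1) ^ 2) < 0 := by
      have h1 : S * (1 / ((i : ℝ) + 1) ^ 2) < ((i : ℝ) + 1) * (1 / ((i : ℝ) + 1) ^ 2) := by
        gcongr
        linarith
      have h2 : ((i : ℝ) + 1) * (1 / ((i : ℝ) + 1) ^ 2) = 1 / ((i : ℝ) + 1) := by field_simp
      linarith
    linarith

theorem ae_tendsto_labelCount_div {E Ω : Type*} [MeasurableSpace E] [MeasurableSpace Ω]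
    {P : Measure (E × Label)} [IsProbabilityMeasure P] {μ : Measure Ω} [IsProbabilityMeasure μ]
    {ξ : ℕ → Ω → E × Label} (hmeas : ∀ i, Measurable (ξ i)) (hindep : iIndepFun ξ μ)
    (hlaw : ∀ i, μ.map (ξ i) = P) (j : Label) :
    ∀ᵐ ω ∂μ, Tendsto (fun n : ℕ => (labelCount (fun i : Fin n => ξ i ω) j : ℝ) / n) atTop
      (𝓝 (P.real {q | q.2 = j})) := by
  classical
  have hJ : MeasurableSet {q : E × Label | q.2 = j} := measurable_snd (measurableSet_singleton j)
  set f : E × Label → ℝ := {q : E × Label | q.2 = j}.indicator fun _ => 1 with hf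
  have hfm : Measurable f := measurable_const.indicator hJ
  have hint : Integrable (fun ω => f (ξ 0 ω)) μ := by
    refine Integrable.of_bound (hfm.comp (hmeas 0)).aestronglyMeasurable 1
      (Eventually.of_forall fun ω => ?_)
    by_cases h : ξ 0 ω ∈ {q : E × Label | q.2 = j} <;> simp [hf, h]
  have hmean : ∫ ω, f (ξ 0 ω) ∂μ = P.real {q | q.2 = j} := by
    rw [← integral_map (hmeas 0).aemeasurable hfm.aestronglyMeasurable, hlaw,
      integral_indicator_const _ hJ, smul_eq_mul, mul_one]
  have h := strong_law_ae_real (fun i ω => f (ξ i ω)) hint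
    (fun i k hik => (hindep.indepFun hik).comp hfm hfm)
    (fun i => (⟨(hmeas i).aemeasurable, (hmeas 0).aemeasurable, by rw [hlaw, hlaw]⟩ :
      IdentDistrib (ξ i) (ξ 0) μ μ).comp hfm)
  rw [hmean] at h
  filter_upwards [h] with ω hω
  refine hω.congr fun n => ?_
  rw [Finset.sum_range, labelCount, Finset.card_filter]
  push_cast
  refine congrArg (· / (n : ℝ)) (Finset.sum_congr rfl fun i _ => ?_)
  simp [hf, Set.indicator_apply]

theorem measure_map_le_pi {E Ω : Type*} [MeasurableSpace E] [MeasurableSpace Ω]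
    {P : Measure E} [IsProbabilityMeasure P] {μ : Measure Ω} [IsProbabilityMeasure μ]
    {ξ : ℕ → Ω → E} (hmeas : ∀ i, Measurable (ξ i)) (hindep : iIndepFun ξ μ)
    (hlaw : ∀ i, μ.map (ξ i) = P) (n : ℕ) (B : Set (Fin n → E)) :
    μ {ω | (fun i : Fin n => ξ i ω) ∈ B} ≤ Measure.pi (fun _ : Fin n => P) B := by
  have h1 : iIndepFun (fun i : Fin n => ξ i) μ := hindep.precomp Fin.val_injective
  have h2 := (iIndepFun_iff_map_fun_eq_pi_map fun i : Fin n => (hmeas i).aemeasurable).1 h1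
  simp_rw [hlaw] at h2
  rw [← h2]
  exact Measure.le_map_apply (measurable_pi_lambda (fun ω (i : Fin n) => ξ i ω)
    fun i => hmeas i).aemeasurable B

theorem ae_eventually_notMem_of_measure_le {Ω : Type*} [MeasurableSpace Ω] {μ : Measure Ω}
    {S : ℕ → Set Ω} {f : ℕ → ℝ} (hf : Summable f)
    (hS : ∀ᶠ n in atTop, μ (S n) ≤ ENNReal.ofReal (f n)) : ∀ᵐ ω ∂μ, ∀ᶠ n in atTop, ω ∉ S n := by
  obtain ⟨n₀, hn₀⟩ := eventually_atTop.1 hS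
  have h := ae_eventually_notMem (μ := μ) (s := fun n => if n₀ ≤ n then S n else ∅) (by
    refine ne_top_of_le_ne_top hf.tsum_ofReal_ne_top (ENNReal.tsum_le_tsum fun n => ?_)
    by_cases hn : n₀ ≤ n
    · simpa [hn] using hn₀ n hn
    · simp [hn])
  filter_upwards [h] with ω hω
  filter_upwards [hω, eventually_ge_atTop n₀] with n h1 h2
  simpa [h2] using h1

end UniformDeviation

section UniformDeviation

variable {E : Type*} [MeasurableSpace E]

theorem classHits_nonneg {E : Type*} {n : ℕ} (D : Fin n → E × Label) (j : Label) (A : Set E) :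
    0 ≤ classHits D j A :=
  Finset.sum_nonneg fun _ _ => Set.indicator_nonneg (by simp) _

theorem classHits_le_labelCount {E : Type*} {n : ℕ} (D : Fin n → E × Label) (j : Label) (A : Set E) :
    classHits D j A ≤ labelCount D j := by
  refine (Finset.sum_le_card_nsmul _ _ 1 fun i _ => ?_).trans_eq (by simp [labelCount])
  exact Set.indicator_le_self' (fun _ _ => zero_le_one) _

theorem measurable_sum_kernel {n : ℕ} {kern : E → E → ℝ} (hk : Measurable (Function.uncurry kern))
    (D : Fin n → E × Label) (s : Finset (Fin n)) : Measurable fun x => ∑ i ∈ s, kern x (D i).1 :=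
  Finset.measurable_sum _ fun _ _ => hk.comp (measurable_id.prodMk measurable_const)

theorem measureReal_label_inter {P : Measure (E × Label)} [IsProbabilityMeasure P] {j : Label}
    {ν : Measure E} {c : ENNReal} (hν : (P.restrict {q | q.2 = j}).map Prod.fst = c • ν)
    {A : Set E} (hA : MeasurableSet A) :
    P.real {q | q.2 = j ∧ q.1 ∈ A} = c.toReal * ν.real A := by
  have h1 := congrArg (fun m => m A) hν
  simp only [Measure.smul_apply, smul_eq_mul] at h1
  rw [Measure.map_apply measurable_fst hA, Measure.restrict_apply (measurable_fst hA)] at h1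
  rw [measureReal_def, measureReal_def, ← ENNReal.toReal_mul, ← h1]
  congr 2
  ext q
  exact and_comm

variable {d : ℕ}

theorem ae_eventually_rat_classHits_dev_le (hd : 0 < d) {P : Measure (Attr d × Label)}
    [IsProbabilityMeasure P] {j : Label} {ν : Measure (Attr d)} [IsProbabilityMeasure ν]
    (hac : ν ≪ volume) {c : ENNReal} (hc : c ≠ ⊤)
    (hν : (P.restrict {q | q.2 = j}).map Prod.fst = c • ν)
    {Ω : Type*} [MeasurableSpace Ω] {μ : Measure Ω} [IsProbabilityMeasure μ]
    {ξ : ℕ → Ω → Attr d × Label} (hmeas : ∀ i, Measurable (ξ i))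
    (hindep : iIndepFun ξ μ) (hlaw : ∀ i, μ.map (ξ i) = P)
    {K : Attr d → ℝ} (hK : IsContinuousRegularKernel K)
    {h : ℕ → ℝ} (hpos : ∀ n, 0 < h n) (hzero : Tendsto h atTop (𝓝 0))
    (hinf : Tendsto (fun n : ℕ => (n : ℝ) * h n ^ d) atTop atTop)
    {Θ : Type*} [Countable Θ] {p : ℕ} (θ : Θ → Fin (p + 1) × Fin (p + 1) → ℝ) {ε c₀ : ℝ}
    (hε : 0 < ε) (hc₀ : 0 < c₀) :
    ∀ᵐ ω ∂μ, ∀ᶠ n : ℕ in atTop, (fun i : Fin n => ξ i ω) ∉ {D : Fin n → Attr d × Label |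
      c₀ * n ≤ labelCount D j ∧ ∃ a, ε * labelCount D j <
      |classHits D j (posSet (θ a) (otherSum (scaledKernel K (h n)) D j)
          (ownSum (scaledKernel K (h n)) D j))
        - labelCount D j * ν.real (posSet (θ a) (otherSum (scaledKernel K (h n)) D j)
          (ownSum (scaledKernel K (h n)) D j))|} := by
  set B : ∀ n : ℕ, Set (Fin n → Attr d × Label) := fun n => {D : Fin n → Attr d × Label |
      c₀ * n ≤ labelCount D j ∧ ∃ a, ε * labelCount D j <
      |classHits D j (posSet (θ a) (otherSum (scaledKernel K (h n)) D j)
          (ownSum (scaledKernel K (h n)) D j))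
        - labelCount D j * ν.real (posSet (θ a) (otherSum (scaledKernel K (h n)) D j)
          (ownSum (scaledKernel K (h n)) D j))|}
  refine ae_eventually_notMem_of_measure_le (S := fun n => {ω | (fun i : Fin n => ξ i ω) ∈ B n})
    (f := fun n : ℕ => 4 / (c₀ * n) ^ 3) ?_ ?_
  · have : Summable fun n : ℕ => 4 / c₀ ^ 3 * (1 / (n : ℝ) ^ 3) :=
      (Real.summable_one_div_nat_pow.2 (by norm_num)).mul_left _
    refine this.congr fun n => ?_
    rw [mul_pow, div_mul_div_comm, mul_one]
  -- Total sample size tends to infinity while the class size stays above a fixed share of it; this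
  -- covers all values that the random class size can take.
  · set l : Filter (ℕ × ℕ) := comap Prod.fst atTop ⊓ 𝓟 {q | c₀ * q.1 ≤ q.2} with hl
    have hfst : Tendsto Prod.fst l (atTop : Filter ℕ) := tendsto_comap.mono_left inf_le_left
    have hev := eventually_measure_hits_posSet_dev_le hd hac hK (l := l) (k := fun q => q.2)
      (h := fun q => h q.1) (fun q => hpos q.1) (hzero.comp hfst) (by
        refine tendsto_atTop_mono' l ?_ ((hinf.comp hfst).const_mul_atTop hc₀)
        filter_upwards [mem_inf_of_right (mem_principal_self _)] with q hq
        have hq : c₀ * q.1 ≤ q.2 := hq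
        simp only [Function.comp_apply]
        rw [← mul_assoc]
        exact mul_le_mul_of_nonneg_right hq (pow_nonneg (hpos _).le _)) θ hε
    rw [hl, eventually_inf_principal, eventually_comap] at hev
    filter_upwards [hev, eventually_gt_atTop 0] with n hn hn0
    refine (measure_map_le_pi hmeas hindep hlaw n _).trans ?_
    refine measure_classHits_dev_le P hc hν (measurable_scaledKernel hK.continuous.measurable _) θ
      fun k hk ψ hψ => (hn (n, k) rfl hk ψ hψ).trans (ENNReal.ofReal_le_ofReal ?_)
    have : (0 : ℝ) < c₀ * n := mul_pos hc₀ (Nat.cast_pos.2 hn0)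
    simp only
    gcongr

/-- Borel-Cantelli gives the claim for rational `θ`. For fixed data, frequency and mass of the
positive sets pass to the limit along a rational sequence, by dominated convergence. The class size
is replaced by its limiting share by the strong law. -/
theorem ae_eventually_classHits_dev_le (hd : 0 < d) {P : Measure (Attr d × Label)}
    [IsProbabilityMeasure P] (j : Label)
    (hcont : (P.restrict {q | q.2 = j}).map Prod.fst ≪ volume)
    {Ω : Type*} [MeasurableSpace Ω] {μ : Measure Ω} [IsProbabilityMeasure μ]
    {ξ : ℕ → Ω → Attr d × Label} (hmeas : ∀ i, Measurable (ξ i))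
    (hindep : iIndepFun ξ μ) (hlaw : ∀ i, μ.map (ξ i) = P)
    {K : Attr d → ℝ} (hK : IsContinuousRegularKernel K)
    {h : ℕ → ℝ} (hpos : ∀ n, 0 < h n) (hzero : Tendsto h atTop (𝓝 0))
    (hinf : Tendsto (fun n : ℕ => (n : ℝ) * h n ^ d) atTop atTop) (p : ℕ) :
    ∀ᵐ ω ∂μ, ∀ ε > 0, ∀ᶠ n : ℕ in atTop, ∀ θ : Fin (p + 1) × Fin (p + 1) → ℝ, ∀ A : Set (Attr d),
      A = posSet θ (otherSum (scaledKernel K (h n)) (fun i : Fin n => ξ i ω) j)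
          (ownSum (scaledKernel K (h n)) (fun i : Fin n => ξ i ω) j) →
      |classHits (fun i : Fin n => ξ i ω) j A / n - P.real {q | q.2 = j ∧ q.1 ∈ A}| ≤ ε := by
  have hJ : MeasurableSet {q : Attr d × Label | q.2 = j} :=
    measurable_snd (measurableSet_singleton j)
  have hslln := ae_tendsto_labelCount_div hmeas hindep hlaw j
  set π := P {q | q.2 = j} with hπ
  have hπt : π ≠ ⊤ := measure_ne_top _ _
  -- A class of probability zero has no conditional law; then both terms are bounded by the share of
  -- the class.
  rcases eq_or_ne π 0 with hπ0 | hπ0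
  · have h0 : P.real {q | q.2 = j} = 0 := by rw [measureReal_def, ← hπ, hπ0]; rfl
    rw [h0] at hslln
    filter_upwards [hslln] with ω hω ε hε
    filter_upwards [hω.eventually (eventually_le_nhds hε)] with n hn θ A hA
    have h1 : P.real {q | q.2 = j ∧ q.1 ∈ A} = 0 :=
      le_antisymm ((measureReal_mono fun q hq => hq.1).trans_eq h0) measureReal_nonneg
    rw [h1, sub_zero, abs_of_nonneg (div_nonneg (classHits_nonneg _ _ _) (Nat.cast_nonneg _))]
    refine le_trans ?_ hn
    gcongr
    exact classHits_le_labelCount _ _ _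
  set ν : Measure (Attr d) := π⁻¹ • (P.restrict {q | q.2 = j}).map Prod.fst with hνdef
  have hν : (P.restrict {q | q.2 = j}).map Prod.fst = π • ν := by
    rw [hνdef, smul_smul, ENNReal.mul_inv_cancel hπ0 hπt, one_smul]
  have : IsProbabilityMeasure ν := by
    refine ⟨?_⟩
    rw [hνdef, Measure.smul_apply, Measure.map_apply measurable_fst MeasurableSet.univ]
    simp [← hπ, ENNReal.inv_mul_cancel hπ0 hπt]
  have hac : ν ≪ volume := hcont.smul_left _
  have hπr : 0 < P.real {q | q.2 = j} := ENNReal.toReal_pos hπ0 hπt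
  have hrat : ∀ m : ℕ, _ := fun m => ae_eventually_rat_classHits_dev_le hd hac hπt hν hmeas hindep
    hlaw hK hpos hzero hinf (p := p)
    (fun (Q : Fin (p + 1) × Fin (p + 1) → ℚ) c => (Q c : ℝ))
    (show (0 : ℝ) < 1 / ((m : ℝ) + 1) by positivity) (half_pos hπr)
  filter_upwards [hslln, ae_all_iff.2 hrat] with ω hω hbad ε hε
  obtain ⟨m, hm⟩ := exists_nat_one_div_lt (half_pos hε)
  filter_upwards [hbad m, hω.eventually (eventually_ge_nhds (half_lt_self hπr)),
    hω.eventually (Metric.closedBall_mem_nhds _ (half_pos hε)), eventually_gt_atTop 0]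
    with n hn hn1 hn2 hn0 θ A hA
  set D : Fin n → Attr d × Label := fun i => ξ i ω with hD
  set s := ownSum (scaledKernel K (h n)) D j with hs
  set ψ := otherSum (scaledKernel K (h n)) D j with hψ
  have hkm := measurable_scaledKernel hK.continuous.measurable (h n)
  have hsm : Measurable s := measurable_sum_kernel hkm D _
  have hψm : Measurable ψ := measurable_sum_kernel hkm D _
  have hn0' : (0 : ℝ) < n := Nat.cast_pos.2 hn0
  have hlabel : (labelCount D j : ℝ) ≤ n := by
    have : labelCount D j ≤ n := (Finset.card_le_univ _).trans_eq (Fintype.card_fin n)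
    exact_mod_cast this
  have hratio : |(labelCount D j : ℝ) / n - π.toReal| ≤ ε / 2 := by
    have := hn2
    rwa [Real.dist_eq] at this
  have hq : ∀ Q : Fin (p + 1) × Fin (p + 1) → ℚ, ∀ A, A = posSet (fun c => (Q c : ℝ)) ψ s →
      |classHits D j A / n - P.real {q | q.2 = j ∧ q.1 ∈ A}| ≤ ε := by
    intro Q A hA
    simp only [not_and, not_exists, not_lt] at hn
    have h1 := hn ((le_div_iff₀ hn0').1 hn1) Q
    rw [← hA] at h1
    have hAm : MeasurableSet A := hA ▸ measurableSet_posSet _ hψm hsm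
    rw [measureReal_label_inter hν hAm]
    have hνA : ν.real A ≤ 1 := measureReal_le_one
    have hνA0 : 0 ≤ ν.real A := measureReal_nonneg
    have e1 : |classHits D j A / n - labelCount D j / n * ν.real A| ≤ ε / 2 := by
      have : classHits D j A / n - labelCount D j / n * ν.real A
          = (classHits D j A - labelCount D j * ν.real A) / n := by ring
      rw [this, abs_div, abs_of_pos hn0', div_le_iff₀ hn0']
      refine h1.trans ?_
      gcongr
    have e2 : |(labelCount D j : ℝ) / n * ν.real A - π.toReal * ν.real A| ≤ ε / 2 := by
      rw [← sub_mul, abs_mul, abs_of_nonneg hνA0]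
      calc _ ≤ ε / 2 * 1 := by gcongr
        _ = _ := mul_one _
    exact (abs_sub_le _ _ _).trans ((add_le_add e1 e2).trans_eq (add_halves ε))
  obtain ⟨Q, hQ⟩ := exists_rat_seq_dotProduct_pos θ
  have hmem : ∀ x, ∀ᶠ i in atTop, (x ∈ posSet (fun c => (Q i c : ℝ)) ψ s ↔ x ∈ A) := fun x => by
    filter_upwards [hQ (ψ x) (s x)] with i hi
    rw [hA, mem_posSet, mem_posSet]
    exact hi
  have hAm : MeasurableSet A := hA ▸ measurableSet_posSet _ hψm hsm
  have hlim1 : Tendsto (fun i => classHits D j (posSet (fun c => (Q i c : ℝ)) ψ s)) atTop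
      (𝓝 (classHits D j A)) := by
    refine tendsto_finsetSum _ fun k _ => tendsto_const_nhds.congr' ?_
    filter_upwards [hmem (D k).1] with i hi
    by_cases hx : (D k).1 ∈ A
    · rw [Set.indicator_of_mem hx, Set.indicator_of_mem (hi.2 hx)]
    · rw [Set.indicator_of_notMem hx, Set.indicator_of_notMem (mt hi.1 hx)]
  have hlim2 : Tendsto (fun i => P.real {q | q.2 = j ∧ q.1 ∈ posSet (fun c => (Q i c : ℝ)) ψ s})
      atTop (𝓝 (P.real {q | q.2 = j ∧ q.1 ∈ A})) := by
    refine (ENNReal.tendsto_toReal (measure_ne_top _ _)).comp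
      (tendsto_measure_of_tendsto_indicator atTop (fun i => hJ.inter (measurable_fst
        (measurableSet_posSet _ hψm hsm))) MeasurableSet.univ (measure_ne_top _ _)
        (Eventually.of_forall fun _ => Set.subset_univ _) fun q => ?_)
    filter_upwards [hmem q.1] with i hi
    exact and_congr_right fun _ => hi
  have hlim := ((hlim1.div_const (n : ℝ)).sub hlim2).abs
  exact le_of_tendsto hlim (Eventually.of_forall fun i => hq (Q i) _ rfl)

end UniformDeviation

/-! ### McDiarmid's inequality -/

section BoundedDifferences

variable {E : Type*} [MeasurableSpace E]

theorem integrable_of_measurable_of_abs_le {μ : Measure E} [IsFiniteMeasure μ] {f : E → ℝ}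
    (hf : Measurable f) {C : ℝ} (hC : ∀ x, |f x| ≤ C) : Integrable f μ :=
  Integrable.of_bound hf.aestronglyMeasurable C (Eventually.of_forall hC)

theorem integrable_exp_of_abs_le {μ : Measure E} [IsFiniteMeasure μ] {f : E → ℝ}
    (hf : Measurable f) {C : ℝ} (hC : ∀ x, |f x| ≤ C) (s : ℝ) :
    Integrable (fun x => Real.exp (s * f x)) μ := by
  refine integrable_of_measurable_of_abs_le (C := Real.exp (|s| * C)) (by fun_prop) fun x => ?_
  rw [abs_of_pos (Real.exp_pos _), Real.exp_le_exp]
  calc s * f x ≤ |s * f x| := le_abs_self _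
    _ = |s| * |f x| := abs_mul _ _
    _ ≤ |s| * C := by gcongr; exact hC x

/-- The moment generating function of a function of independent variables that has bounded
differences. -/
theorem integral_exp_le_of_bounded_differences (μ : Measure E) [IsProbabilityMeasure μ] {c : ℝ}
    (hc : 0 ≤ c) (s : ℝ) (n : ℕ) (Φ : (Fin n → E) → ℝ) (hΦ : Measurable Φ) {C : ℝ}
    (hC : ∀ x, |Φ x| ≤ C) (hdiff : ∀ x i z, |Φ (Function.update x i z) - Φ x| ≤ c) :
    ∫ x, Real.exp (s * Φ x) ∂Measure.pi (fun _ : Fin n => μ)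
      ≤ Real.exp (s * ∫ x, Φ x ∂Measure.pi (fun _ : Fin n => μ)) * Real.exp (n * c ^ 2 * s ^ 2 / 2) := by
  induction n with
  | zero =>
    have h : ∀ x, Φ x = Φ default := fun x => congrArg Φ (Subsingleton.elim _ _)
    simp [h]
  | succ n ih =>
    set ν := Measure.pi fun _ : Fin n => μ with hν
    set e := (MeasurableEquiv.piFinSuccAbove (fun _ : Fin (n + 1) => E) 0).symm with he
    have hmp : MeasurePreserving e (μ.prod ν) (Measure.pi fun _ : Fin (n + 1) => μ) :=
      (measurePreserving_piFinSuccAbove (fun _ : Fin (n + 1) => μ) 0).symm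
    have hecons : ∀ q : E × (Fin n → E), e q = Fin.cons q.1 q.2 := fun q => by
      simp [he, MeasurableEquiv.piFinSuccAbove]
      rfl
    have hupd0 : ∀ (a b : E) (y : Fin n → E), e (b, y) = Function.update (e (a, y)) 0 b := by
      intro a b y
      rw [hecons, hecons, Fin.update_cons_zero]
    have hupds : ∀ (a : E) (y : Fin n → E) (i : Fin n) (z : E),
        e (a, Function.update y i z) = Function.update (e (a, y)) i.succ z := by
      intro a y i z
      rw [hecons, hecons, ← Fin.cons_update]
    set Ψ : E × (Fin n → E) → ℝ := fun q => Φ (e q) with hΨ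
    have hΨm : Measurable Ψ := hΦ.comp e.measurable
    have hΨa : ∀ a, Measurable fun y => Ψ (a, y) := fun a => hΨm.comp measurable_prodMk_left
    set g : E → ℝ := fun a => ∫ y, Ψ (a, y) ∂ν with hg
    have hgm : Measurable g := (hΨm.stronglyMeasurable.integral_prod_right (ν := ν)).measurable
    have hgC : ∀ a, |g a| ≤ C := fun a => by
      have := norm_integral_le_of_norm_le_const (μ := ν) (f := fun y => Ψ (a, y)) (C := C)
        (Eventually.of_forall fun y => hC _)
      simpa using this
    have hint : ∀ a, Integrable (fun y => Ψ (a, y)) ν := fun a =>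
      integrable_of_measurable_of_abs_le (hΨa a) fun y => hC _
    have hgdiff : ∀ a b, |g b - g a| ≤ c := by
      intro a b
      rw [hg, ← integral_sub (hint b) (hint a)]
      have := norm_integral_le_of_norm_le_const (μ := ν) (f := fun y => Ψ (b, y) - Ψ (a, y)) (C := c)
        (Eventually.of_forall fun y => by
          simp only [hΨ, Real.norm_eq_abs]
          rw [hupd0 a b y]
          exact hdiff _ _ _)
      simpa using this
    have hmean : ∫ x, Φ x ∂Measure.pi (fun _ : Fin (n + 1) => μ) = ∫ a, g a ∂μ := by
      rw [← hmp.integral_comp' (g := Φ), hg, ← integral_prod (fun q => Ψ q)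
        (integrable_of_measurable_of_abs_le hΨm fun q => hC _)]
    have hstep : ∀ a, ∫ y, Real.exp (s * Ψ (a, y)) ∂ν
        ≤ Real.exp (s * g a) * Real.exp (n * c ^ 2 * s ^ 2 / 2) := fun a =>
      ih (fun y => Ψ (a, y)) (hΨa a) (fun y => hC _) fun y i z => by
        simp only [hΨ]
        rw [hupds]
        exact hdiff _ _ _
    -- Hoeffding's lemma on an interval of length `2 * c` around one value of `g`; hence the
    -- parameter `c ^ 2`.
    have hsub := hasSubgaussianMGF_of_mem_Icc (μ := μ) (X := g) (a := g (Classical.choice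
      μ.nonempty_of_neZero) - c) (b := g (Classical.choice μ.nonempty_of_neZero) + c)
      hgm.aemeasurable (Eventually.of_forall fun a => by
        have := abs_le.1 (hgdiff (Classical.choice μ.nonempty_of_neZero) a)
        constructor <;> linarith)
    have hexp : ∫ a, Real.exp (s * g a) ∂μ
        ≤ Real.exp (s * ∫ a, g a ∂μ) * Real.exp (c ^ 2 * s ^ 2 / 2) := by
      have h1 := hsub.mgf_le s
      have h2 : mgf (fun a => g a - ∫ x, g x ∂μ) μ s
          = (∫ a, Real.exp (s * g a) ∂μ) * Real.exp (-(s * ∫ a, g a ∂μ)) := by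
        rw [mgf, ← integral_mul_const]
        congr 1
        ext a
        rw [← Real.exp_add]
        ring_nf
      rw [h2] at h1
      have h3 : ((‖g (Classical.choice μ.nonempty_of_neZero) + c
          - (g (Classical.choice μ.nonempty_of_neZero) - c)‖₊ / 2) ^ 2 : NNReal) = (c.toNNReal) ^ 2 := by
        congr 1
        ext
        push_cast
        rw [Real.coe_toNNReal _ hc, show g (Classical.choice μ.nonempty_of_neZero) + c
          - (g (Classical.choice μ.nonempty_of_neZero) - c) = 2 * c by ring, Real.norm_of_nonneg
          (by positivity)]
        ring
      rw [h3, Real.exp_neg, mul_inv_le_iff₀ (Real.exp_pos _)] at h1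
      refine h1.trans_eq ?_
      push_cast
      rw [Real.coe_toNNReal _ hc, mul_comm]
    calc ∫ x, Real.exp (s * Φ x) ∂Measure.pi (fun _ : Fin (n + 1) => μ)
        = ∫ a, ∫ y, Real.exp (s * Ψ (a, y)) ∂ν ∂μ := by
          rw [← hmp.integral_comp' (g := fun x => Real.exp (s * Φ x)),
            integral_prod (fun q => Real.exp (s * Ψ q)) (integrable_exp_of_abs_le hΨm
              (fun q => hC _) s)]
      _ ≤ ∫ a, Real.exp (s * g a) * Real.exp (n * c ^ 2 * s ^ 2 / 2) ∂μ := by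
          refine integral_mono ?_ ((integrable_exp_of_abs_le hgm hgC s).mul_const _) hstep
          exact (integrable_exp_of_abs_le (μ := μ.prod ν) hΨm (fun q => hC _) s).integral_prod_left
      _ ≤ Real.exp (s * ∫ a, g a ∂μ) * Real.exp (c ^ 2 * s ^ 2 / 2)
            * Real.exp (n * c ^ 2 * s ^ 2 / 2) := by
          rw [integral_mul_const]
          gcongr
      _ = _ := by
          rw [hmean, mul_assoc, ← Real.exp_add]
          congr 2
          push_cast
          ring

/-- McDiarmid's inequality, with a constant that is not optimal. -/
theorem measureReal_ge_le_of_bounded_differences (μ : Measure E) [IsProbabilityMeasure μ] {c : ℝ}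
    (hc : 0 ≤ c) {n : ℕ} {Φ : (Fin n → E) → ℝ} (hΦ : Measurable Φ) {C : ℝ}
    (hC : ∀ x, |Φ x| ≤ C) (hdiff : ∀ x i z, |Φ (Function.update x i z) - Φ x| ≤ c) {ε : ℝ}
    (hε : 0 ≤ ε) :
    (Measure.pi fun _ : Fin n => μ).real
      {x | ε ≤ Φ x - ∫ y, Φ y ∂Measure.pi (fun _ : Fin n => μ)}
      ≤ Real.exp (-ε ^ 2 / (2 * (n * c ^ 2))) := by
  set m := ∫ y, Φ y ∂Measure.pi (fun _ : Fin n => μ) with hm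
  have hcC : ∀ x, |Φ x - m| ≤ C + |m| := fun x => (abs_sub _ _).trans (by gcongr; exact hC x)
  have h : HasSubgaussianMGF (fun x => Φ x - m) (n * c.toNNReal ^ 2)
      (Measure.pi fun _ : Fin n => μ) := by
    refine ⟨fun t => integrable_exp_of_abs_le (hΦ.sub_const m) hcC t, fun t => ?_⟩
    have h1 := integral_exp_le_of_bounded_differences μ hc t n Φ hΦ hC hdiff
    have h2 : mgf (fun x => Φ x - m) (Measure.pi fun _ : Fin n => μ) t
        = (∫ x, Real.exp (t * Φ x) ∂Measure.pi fun _ : Fin n => μ) * Real.exp (-(t * m)) := by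
      rw [mgf, ← integral_mul_const]
      congr 1
      ext a
      rw [← Real.exp_add]
      ring_nf
    rw [h2, Real.exp_neg, mul_inv_le_iff₀ (Real.exp_pos _)]
    refine h1.trans_eq ?_
    push_cast
    rw [Real.coe_toNNReal _ hc, mul_comm]
  have := h.measure_ge_le hε
  simpa [Real.coe_toNNReal _ hc] using this

end BoundedDifferences

/-! ### Mean `L¹` error of an average -/

section MeanDeviation

variable {Z F : Type*} [MeasurableSpace Z] [MeasurableSpace F]

theorem integral_sq_sum_sub_le (P : Measure Z) [IsProbabilityMeasure P] {k : Z → ℝ}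
    (hk : Measurable k) (hk0 : ∀ q, 0 ≤ k q) {A : ℝ} (hkA : ∀ q, k q ≤ A) (n : ℕ) :
    ∫ D, (∑ i, k (D i) - n * ∫ q, k q ∂P) ^ 2 ∂(Measure.pi fun _ : Fin n => P)
      ≤ n * (A * ∫ q, k q ∂P) := by
  have hkabs : ∀ q, |k q| ≤ A := fun q => (abs_of_nonneg (hk0 q)).trans_le (hkA q)
  have hint : Integrable k P := integrable_of_measurable_of_abs_le hk hkabs
  have hL2 : MemLp k 2 P := MemLp.of_bound hk.aestronglyMeasurable A (Eventually.of_forall hkabs)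
  have hmeas : Measurable fun D : Fin n → Z => ∑ i, k (D i) :=
    Finset.measurable_sum _ fun i _ => hk.comp (measurable_pi_apply i)
  have hmean : ∫ D, ∑ i, k (D i) ∂(Measure.pi fun _ : Fin n => P) = n * ∫ q, k q ∂P := by
    have hi : ∀ i ∈ Finset.univ, Integrable (fun D : Fin n → Z => k (D i))
        (Measure.pi fun _ : Fin n => P) := fun i _ =>
      integrable_of_measurable_of_abs_le (by fun_prop) fun D => hkabs (D i)
    rw [integral_finsetSum _ hi]
    rw [Finset.sum_congr rfl fun i _ => integral_comp_eval (μ := fun _ : Fin n => P) (i := i) (f := k)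
      hk.aestronglyMeasurable]
    simp
  have hvar := variance_sum_pi (μ := fun _ : Fin n => P) (X := fun _ => k) fun _ => hL2
  rw [variance_eq_integral (by fun_prop)] at hvar
  have e : (∑ i : Fin n, fun ω : Fin n → Z => k (ω i)) = fun D => ∑ i, k (D i) := by
    ext D; simp
  rw [e, hmean, Finset.sum_const, Finset.card_univ, Fintype.card_fin, nsmul_eq_mul] at hvar
  rw [hvar]
  gcongr
  refine (variance_le_expectation_sq hk.aestronglyMeasurable).trans ?_
  rw [← integral_const_mul]
  refine integral_mono (hL2.integrable_sq) (hint.const_mul A) fun q => ?_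
  change k q ^ 2 ≤ A * k q
  nlinarith [hk0 q, hkA q]

/-- From `|y| ≤ a / 2 + y ^ 2 / (2 a)` with `a = √(A / n)` and variance at most `A * m / n`.
Compared with Cauchy-Schwarz, the result is linear in the mean `m`, so it can be integrated over a
second variable. -/
theorem integral_abs_average_sub_le (P : Measure Z) [IsProbabilityMeasure P] {k : Z → ℝ}
    (hk : Measurable k) (hk0 : ∀ q, 0 ≤ k q) {A : ℝ} (hA : 0 < A) (hkA : ∀ q, k q ≤ A) {n : ℕ}
    (hn : 0 < n) :
    ∫ D, |(1 / (n : ℝ)) * ∑ i, k (D i) - ∫ q, k q ∂P| ∂(Measure.pi fun _ : Fin n => P)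
      ≤ √(A / n) / 2 * (1 + ∫ q, k q ∂P) := by
  have hn' : (0 : ℝ) < n := by exact_mod_cast hn
  set a := √(A / n) with ha
  have ha0 : 0 < a := Real.sqrt_pos.2 (by positivity)
  have ha2 : a ^ 2 = A / n := Real.sq_sqrt (by positivity)
  set m := ∫ q, k q ∂P with hm
  have hS : Measurable fun D : Fin n → Z => ∑ i, k (D i) :=
    Finset.measurable_sum _ fun i _ => hk.comp (measurable_pi_apply i)
  have hbound : ∀ D : Fin n → Z, |∑ i, k (D i) - n * m| ≤ n * A + |n * m| := fun D =>
    (abs_sub _ _).trans (by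
      gcongr
      rw [abs_of_nonneg (Finset.sum_nonneg fun i _ => hk0 _)]
      exact (Finset.sum_le_card_nsmul _ _ A fun i _ => hkA _).trans_eq (by simp))
  have hsq : Integrable (fun D : Fin n → Z => (∑ i, k (D i) - n * m) ^ 2)
      (Measure.pi fun _ : Fin n => P) :=
    integrable_of_measurable_of_abs_le (by fun_prop) (C := (n * A + |n * m|) ^ 2) fun D => by
      rw [abs_pow]
      gcongr
      exact hbound D
  calc ∫ D, |(1 / (n : ℝ)) * ∑ i, k (D i) - m| ∂(Measure.pi fun _ : Fin n => P)
      ≤ ∫ D, (a / 2 + 1 / (2 * a * n ^ 2) * (∑ i, k (D i) - n * m) ^ 2)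
          ∂(Measure.pi fun _ : Fin n => P) := by
        refine integral_mono_of_nonneg (Eventually.of_forall fun D => abs_nonneg _)
          ((integrable_const _).add (hsq.const_mul _)) (Eventually.of_forall fun D => ?_)
        set y := ∑ i, k (D i) - n * m with hy
        have e : (1 / (n : ℝ)) * ∑ i, k (D i) - m = y / n := by
          rw [hy]; field_simp
        change |(1 / (n : ℝ)) * ∑ i, k (D i) - m| ≤ a / 2 + 1 / (2 * a * n ^ 2) * y ^ 2
        rw [e]
        have e2 : a / 2 + 1 / (2 * a * n ^ 2) * y ^ 2 = (a ^ 2 + |y / n| ^ 2) / (2 * a) := by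
          rw [sq_abs]; field_simp
        rw [e2, le_div_iff₀ (by positivity)]
        nlinarith [sq_nonneg (a - |y / n|)]
    _ = a / 2 + 1 / (2 * a * n ^ 2)
          * ∫ D, (∑ i, k (D i) - n * m) ^ 2 ∂(Measure.pi fun _ : Fin n => P) := by
        rw [integral_add (integrable_const _) (hsq.const_mul _), integral_const_mul]
        simp
    _ ≤ a / 2 + 1 / (2 * a * n ^ 2) * (n * (A * m)) := by
        gcongr
        exact integral_sq_sum_sub_le P hk hk0 hkA n
    _ = a / 2 * (1 + m) := by
        have : A = a ^ 2 * n := by rw [ha2]; field_simp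
        rw [this]
        field_simp

theorem integral_integral_abs_average_sub_le (P : Measure Z) [IsProbabilityMeasure P]
    (m : Measure F) [IsFiniteMeasure m] {k : Z → F → ℝ} (hk : Measurable (Function.uncurry k))
    (hk0 : ∀ q x, 0 ≤ k q x) {A : ℝ} (hA : 0 < A) (hkA : ∀ q x, k q x ≤ A) {κ : ℝ}
    (hκ : ∀ q, ∫ x, k q x ∂m ≤ κ) {n : ℕ} (hn : 0 < n) :
    ∫ D, ∫ x, |(1 / (n : ℝ)) * ∑ i, k (D i) x - ∫ q, k q x ∂P| ∂m
        ∂(Measure.pi fun _ : Fin n => P)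
      ≤ √(A / n) / 2 * (m.real Set.univ + κ) := by
  have hkabs : ∀ q x, |k q x| ≤ A := fun q x => (abs_of_nonneg (hk0 q x)).trans_le (hkA q x)
  have hgm : Measurable fun x => ∫ q, k q x ∂P :=
    (hk.stronglyMeasurable.integral_prod_left' (μ := P)).measurable
  have hg0 : ∀ x, 0 ≤ ∫ q, k q x ∂P := fun x => integral_nonneg fun q => hk0 q x
  have hgA : ∀ x, ∫ q, k q x ∂P ≤ A := fun x => by
    have h := integral_mono (μ := P) (integrable_of_measurable_of_abs_le
      (hk.comp (measurable_id.prodMk measurable_const)) fun q => hkabs q x) (integrable_const A)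
      fun q => hkA q x
    simpa using h
  have hgabs : ∀ x, |∫ q, k q x ∂P| ≤ A := fun x => (abs_of_nonneg (hg0 x)).trans_le (hgA x)
  have hint : Integrable (Function.uncurry fun (D : Fin n → Z) (x : F) =>
      |(1 / (n : ℝ)) * ∑ i, k (D i) x - ∫ q, k q x ∂P|)
      ((Measure.pi fun _ : Fin n => P).prod m) := by
    refine integrable_of_measurable_of_abs_le (C := (1 / (n : ℝ)) * (n * A) + A) ?_ ?_
    · refine Measurable.abs (((Finset.measurable_sum _ fun i _ => ?_).const_mul _).sub
        (hgm.comp measurable_snd))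
      have hp : Measurable fun r : (Fin n → Z) × F => (r.1 i, r.2) :=
        ((measurable_pi_apply i).comp measurable_fst).prodMk measurable_snd
      exact hk.comp hp
    · rintro ⟨D, x⟩
      simp only [Function.uncurry_apply_pair, abs_abs]
      refine (abs_sub _ _).trans (add_le_add ?_ (hgabs x))
      rw [abs_mul, abs_of_nonneg (by positivity : 0 ≤ 1 / (n : ℝ))]
      gcongr
      refine (Finset.abs_sum_le_sum_abs _ _).trans ?_
      exact (Finset.sum_le_card_nsmul _ _ A fun i _ => hkabs _ _).trans_eq (by simp)
  have hgint : Integrable (fun x => ∫ q, k q x ∂P) m := integrable_of_measurable_of_abs_le hgm hgabs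
  rw [integral_integral_swap hint]
  calc _ ≤ ∫ x, √(A / n) / 2 * (1 + ∫ q, k q x ∂P) ∂m := by
        refine integral_mono hint.integral_prod_right
          (((integrable_const _).add hgint).const_mul _) fun x => ?_
        exact integral_abs_average_sub_le P (hk.comp (measurable_id.prodMk measurable_const))
          (fun q => hk0 q x) hA (fun q => hkA q x) hn
    _ = √(A / n) / 2 * (m.real Set.univ + ∫ q, ∫ x, k q x ∂m ∂P) := by
        rw [integral_const_mul, integral_add (integrable_const _) hgint, integral_const,
          integral_integral_swap]
        · simp
        · exact integrable_of_measurable_of_abs_le (hk.comp measurable_swap)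
            fun z => hkabs z.2 z.1
    _ ≤ _ := by
        gcongr
        have h := integral_mono (μ := P) (integrable_of_measurable_of_abs_le
          ((hk.stronglyMeasurable.integral_prod_right' (ν := m)).measurable)
          (C := A * m.real Set.univ) fun q => by
            have := norm_integral_le_of_norm_le_const (μ := m) (f := fun x => k q x) (C := A)
              (Eventually.of_forall fun x => hkabs q x)
            simpa using this) (integrable_const κ) hκ
        simpa using h

end MeanDeviation

/-! ### Convolution with the scaled kernel -/

section ApproximateIdentity

variable {d : ℕ}

theorem tendsto_lintegral_enorm_translate_sub {f : Attr d → ℝ} (hf : Integrable f volume) :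
    Tendsto (fun v => ∫⁻ x, ‖f (x - v) - f x‖ₑ) (𝓝 0) (𝓝 0) := by
  have hL : MemLp f 1 volume := memLp_one_iff_integrable.2 hf
  let τ : C(Attr d, C(Attr d, Attr d)) :=
    ContinuousMap.curry ⟨fun q : Attr d × Attr d => q.2 - q.1, by fun_prop⟩
  have hτ : ∀ v, MeasurePreserving (τ v) volume volume := fun v =>
    measurePreserving_sub_right volume v
  have hcont : Continuous fun v => Lp.compMeasurePreserving (τ v) (hτ v) (hL.toLp f) :=
    Continuous.compMeasurePreservingLp continuous_const τ.continuous hτ ENNReal.one_ne_top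
  have h := tendsto_iff_edist_tendsto_0.1 (hcont.tendsto 0)
  refine h.congr fun v => ?_
  have hae : ∀ v, Lp.compMeasurePreserving (τ v) (hτ v) (hL.toLp f)
      =ᵐ[volume] fun x => f (x - v) := fun v =>
    (Lp.coeFn_compMeasurePreserving _ (hτ v)).trans
      ((hτ v).quasiMeasurePreserving.ae_eq_comp hL.coeFn_toLp)
  rw [Lp.edist_def, eLpNorm_one_eq_lintegral_enorm]
  refine lintegral_congr_ae ?_
  filter_upwards [hae v, hae 0] with x h1 h2
  rw [Pi.sub_apply, h1, h2, sub_zero]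

theorem integral_scaled_mul_eq {K f : Attr d → ℝ} {h : ℝ} (hh : 0 < h) (x : Attr d) :
    ∫ y, f y * ((h ^ d)⁻¹ * K (h⁻¹ • (x - y))) = ∫ u, K u * f (x - h • u) := by
  have e : ∀ y, f y * ((h ^ d)⁻¹ * K (h⁻¹ • (x - y)))
      = (fun z => (fun u => (h ^ d)⁻¹ * (K u * f (x - h • u))) (h⁻¹ • z)) (x - y) := by
    intro y
    simp only [smul_smul, mul_inv_cancel₀ hh.ne', one_smul, sub_sub_cancel]
    ring
  simp_rw [e]
  rw [integral_sub_left_eq_self (fun z => (fun u => (h ^ d)⁻¹ * (K u * f (x - h • u))) (h⁻¹ • z)),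
    Measure.integral_comp_inv_smul_of_nonneg volume
      (fun u => (h ^ d)⁻¹ * (K u * f (x - h • u))) hh.le, finrank_euclideanSpace_fin,
    integral_const_mul, smul_eq_mul, mul_inv_cancel_left₀ (by positivity)]

/-- By Fubini the bias is at most the `K`-average of the `L¹` distance between `f` and its translate
by `h n • u`. This distance tends to zero and is bounded by twice the norm of `f`, so dominated
convergence applies. -/
theorem tendsto_lintegral_enorm_convolution_sub {K : Attr d → ℝ} (hK : IsContinuousRegularKernel K)
    {f : Attr d → ℝ} (hfm : Measurable f) (hf : Integrable f volume) {h : ℕ → ℝ}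
    (hpos : ∀ n, 0 < h n) (hzero : Tendsto h atTop (𝓝 0)) :
    Tendsto (fun n => ∫⁻ x, ‖(∫ y, f y * ((h n ^ d)⁻¹ * K ((h n)⁻¹ • (x - y))))
      - (∫ u, K u) * f x‖ₑ) atTop (𝓝 0) := by
  obtain ⟨M, -, hM⟩ := hK.exists_le
  have hKm : Measurable K := hK.continuous.measurable
  set W : Attr d → ENNReal := fun v => ∫⁻ x, ‖f (x - v) - f x‖ₑ with hW
  have hWm : Measurable W := by
    have : Measurable fun q : Attr d × Attr d => ‖f (q.2 - q.1) - f q.2‖ₑ := by fun_prop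
    exact this.lintegral_prod_right'
  have hWle : ∀ v, W v ≤ 2 * ∫⁻ x, ‖f x‖ₑ := fun v =>
    calc W v ≤ ∫⁻ x, (‖f (x - v)‖ₑ + ‖f x‖ₑ) := lintegral_mono fun x => enorm_sub_le
      _ = 2 * ∫⁻ x, ‖f x‖ₑ := by
        rw [lintegral_add_right _ (by fun_prop), lintegral_sub_right_eq_self (fun x => ‖f x‖ₑ) v,
          two_mul]
  have hKf : ∫⁻ u, ‖K u‖ₑ ≠ ⊤ := hK.integrable.2.ne
  have hff : ∫⁻ u, ‖f u‖ₑ ≠ ⊤ := hf.2.ne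
  have hlim : Tendsto (fun n => ∫⁻ u, ‖K u‖ₑ * W (h n • u)) atTop (𝓝 (∫⁻ _ : Attr d, 0)) := by
    refine tendsto_lintegral_filter_of_dominated_convergence
      (fun u => ‖K u‖ₑ * (2 * ∫⁻ x, ‖f x‖ₑ)) (Eventually.of_forall fun n => by fun_prop)
      (Eventually.of_forall fun n => Eventually.of_forall fun u => by gcongr; exact hWle _) ?_
      (Eventually.of_forall fun u => ?_)
    · rw [lintegral_mul_const _ (by fun_prop)]
      exact ENNReal.mul_ne_top hKf (ENNReal.mul_ne_top (by simp) hff)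
    · have h1 : Tendsto (fun n => h n • u) atTop (𝓝 0) := by simpa using hzero.smul_const u
      have h2 := (tendsto_lintegral_enorm_translate_sub hf).comp h1
      simpa using ENNReal.Tendsto.const_mul h2 (Or.inr (enorm_ne_top (x := K u)))
  rw [lintegral_zero] at hlim
  refine tendsto_of_tendsto_of_tendsto_of_le_of_le tendsto_const_nhds hlim (fun n => zero_le) ?_
  intro n
  have hpt : ∀ x, ‖(∫ y, f y * ((h n ^ d)⁻¹ * K ((h n)⁻¹ • (x - y)))) - (∫ u, K u) * f x‖ₑ
      ≤ ∫⁻ u, ‖K u‖ₑ * ‖f (x - h n • u) - f x‖ₑ := by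
    intro x
    have h1 : Integrable fun u => K u * f (x - h n • u) :=
      ((hf.comp_sub_left x).comp_smul (hpos n).ne').bdd_mul hKm.aestronglyMeasurable
        (Eventually.of_forall fun u => (abs_of_nonneg (hK.nonneg u)).trans_le (hM u))
    rw [integral_scaled_mul_eq (hpos n), ← integral_mul_const,
      ← integral_sub h1 (hK.integrable.mul_const _)]
    refine (enorm_integral_le_lintegral_enorm _).trans_eq ?_
    simp_rw [← mul_sub, enorm_mul]
  calc _ ≤ ∫⁻ x, ∫⁻ u, ‖K u‖ₑ * ‖f (x - h n • u) - f x‖ₑ := lintegral_mono hpt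
    _ = ∫⁻ u, ∫⁻ x, ‖K u‖ₑ * ‖f (x - h n • u) - f x‖ₑ :=
        lintegral_lintegral_swap (by
          refine Measurable.aemeasurable ?_
          change Measurable fun q : Attr d × Attr d => ‖K q.2‖ₑ * ‖f (q.1 - h n • q.2) - f q.1‖ₑ
          fun_prop)
    _ = ∫⁻ u, ‖K u‖ₑ * W (h n • u) := by
        congr 1
        ext u
        rw [lintegral_const_mul _ (by fun_prop)]

end ApproximateIdentity

/-! ### Strong `L¹` consistency of averages -/

section StrongConsistency

variable {Z F : Type*} [MeasurableSpace Z] [MeasurableSpace F]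

theorem measurable_average {k : Z → F → ℝ} (hk : Measurable (Function.uncurry k)) (n : ℕ) :
    Measurable fun q : (Fin n → Z) × F => (1 / (n : ℝ)) * ∑ i, k (q.1 i) q.2 := by
  refine (Finset.measurable_sum _ fun i _ => ?_).const_mul _
  have hp : Measurable fun r : (Fin n → Z) × F => (r.1 i, r.2) :=
    ((measurable_pi_apply i).comp measurable_fst).prodMk measurable_snd
  exact hk.comp hp

/-- Exchanging one observation changes the `L¹` error by at most `2 * κ / n`, so by McDiarmid it
exceeds its mean by a fixed amount with exponentially small, hence summable, probability. The mean
is at most the stochastic error `√(A n / n)` times a constant, plus the bias. -/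
theorem ae_tendsto_integral_abs_average_sub {P : Measure Z} [IsProbabilityMeasure P]
    {m : Measure F} [IsFiniteMeasure m] {Ω : Type*} [MeasurableSpace Ω] {μ : Measure Ω}
    [IsProbabilityMeasure μ] {ξ : ℕ → Ω → Z} (hmeas : ∀ i, Measurable (ξ i))
    (hindep : iIndepFun ξ μ) (hlaw : ∀ i, μ.map (ξ i) = P) {k : ℕ → Z → F → ℝ}
    (hk : ∀ n, Measurable (Function.uncurry (k n))) (hk0 : ∀ n q x, 0 ≤ k n q x) {A : ℕ → ℝ}
    (hA : ∀ n, 0 < A n) (hkA : ∀ n q x, k n q x ≤ A n)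
    (hAn : Tendsto (fun n => A n / n) atTop (𝓝 0)) {κ : ℝ} (hκ0 : 0 < κ)
    (hκ : ∀ n q, ∫ x, k n q x ∂m ≤ κ) {f : F → ℝ} (hfm : Measurable f) (hf : Integrable f m)
    (hbias : Tendsto (fun n => ∫ x, |∫ q, k n q x ∂P - f x| ∂m) atTop (𝓝 0)) :
    ∀ᵐ ω ∂μ, Tendsto (fun n : ℕ => ∫ x, |(1 / (n : ℝ)) * ∑ i : Fin n, k n (ξ i ω) x - f x| ∂m)
      atTop (𝓝 0) := by
  have hkabs : ∀ n q x, |k n q x| ≤ A n := fun n q x =>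
    (abs_of_nonneg (hk0 n q x)).trans_le (hkA n q x)
  have hkx : ∀ n q, Measurable (k n q) := fun n q =>
    (hk n).comp (measurable_const.prodMk measurable_id)
  have hki : ∀ n q, Integrable (k n q) m := fun n q =>
    integrable_of_measurable_of_abs_le (hkx n q) (hkabs n q)
  have hfi : ∀ n (D : Fin n → Z),
      Integrable (fun x => |(1 / (n : ℝ)) * ∑ i, k n (D i) x - f x|) m := fun n D =>
    (((integrable_finsetSum _ fun i _ => hki n (D i)).const_mul _).sub hf).abs
  set Φ : ∀ n, (Fin n → Z) → ℝ :=
    fun n D => ∫ x, |(1 / (n : ℝ)) * ∑ i, k n (D i) x - f x| ∂m with hΦ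
  have havg : ∀ n (D : Fin n → Z), Integrable (fun x => (1 / (n : ℝ)) * ∑ i, k n (D i) x) m :=
    fun n D => (integrable_finsetSum _ fun i _ => hki n (D i)).const_mul _
  have hΦm : ∀ n, Measurable (Φ n) := fun n => by
    have h1 : Measurable fun q : (Fin n → Z) × F =>
        |(1 / (n : ℝ)) * ∑ i, k n (q.1 i) q.2 - f q.2| :=
      ((measurable_average (hk n) n).sub (hfm.comp measurable_snd)).abs
    exact (h1.stronglyMeasurable.integral_prod_right' (ν := m)).measurable
  have hΦ0 : ∀ n D, 0 ≤ Φ n D := fun n D => integral_nonneg fun x => abs_nonneg _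
  have hgm : ∀ n, Measurable fun x => ∫ q, k n q x ∂P := fun n =>
    ((hk n).stronglyMeasurable.integral_prod_left' (μ := P)).measurable
  have hgi : ∀ n, Integrable (fun x => ∫ q, k n q x ∂P) m := fun n =>
    integrable_of_measurable_of_abs_le (hgm n) (C := A n) fun x => by
      have := norm_integral_le_of_norm_le_const (μ := P) (f := fun q => k n q x) (C := A n)
        (Eventually.of_forall fun q => hkabs n q x)
      simpa using this
  have hbound : ∀ n, 0 < n → ∀ D, |Φ n D| ≤ κ + ∫ x, |f x| ∂m := by
    intro n hn D
    have hn' : (0 : ℝ) < n := by exact_mod_cast hn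
    rw [abs_of_nonneg (hΦ0 n D)]
    calc Φ n D ≤ ∫ x, ((1 / (n : ℝ)) * ∑ i, k n (D i) x + |f x|) ∂m := by
          refine integral_mono (hfi n D) ((havg n D).add hf.abs) fun x => ?_
          refine (abs_sub _ _).trans (add_le_add_left (abs_of_nonneg ?_).le _)
          exact mul_nonneg (by positivity) (Finset.sum_nonneg fun i _ => hk0 _ _ _)
      _ = (1 / (n : ℝ)) * ∑ i, ∫ x, k n (D i) x ∂m + ∫ x, |f x| ∂m := by
          rw [integral_add (havg n D) hf.abs, integral_const_mul,
            integral_finsetSum _ fun i _ => hki n (D i)]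
      _ ≤ (1 / (n : ℝ)) * (n * κ) + ∫ x, |f x| ∂m := by
          gcongr
          exact (Finset.sum_le_card_nsmul _ _ κ fun i _ => hκ n _).trans_eq (by simp)
      _ = _ := by field_simp
  have hdiff : ∀ n (D : Fin n → Z) i z, |Φ n (Function.update D i z) - Φ n D| ≤ 2 * κ / n := by
    intro n D i z
    have hpt : ∀ x, |(1 / (n : ℝ)) * ∑ l, k n (Function.update D i z l) x
        - (1 / (n : ℝ)) * ∑ l, k n (D l) x| ≤ (1 / (n : ℝ)) * (k n z x + k n (D i) x) := by
      intro x
      rw [← mul_sub, ← Finset.sum_sub_distrib, Finset.sum_eq_single i, Function.update_self, abs_mul,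
        abs_of_nonneg (by positivity : 0 ≤ 1 / (n : ℝ))]
      · gcongr
        refine (abs_sub _ _).trans_eq ?_
        rw [abs_of_nonneg (hk0 _ _ _), abs_of_nonneg (hk0 _ _ _)]
      · intro l _ hl
        rw [Function.update_of_ne hl, sub_self]
      · simp
    calc |Φ n (Function.update D i z) - Φ n D|
        ≤ ∫ x, |(|(1 / (n : ℝ)) * ∑ l, k n (Function.update D i z l) x - f x|
            - |(1 / (n : ℝ)) * ∑ l, k n (D l) x - f x|)| ∂m := by
          simp only [hΦ]
          rw [← integral_sub (hfi n (Function.update D i z)) (hfi n D)]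
          exact abs_integral_le_integral_abs
      _ ≤ ∫ x, (1 / (n : ℝ)) * (k n z x + k n (D i) x) ∂m := by
          refine integral_mono ((hfi n _).sub (hfi n D)).abs
            (((hki n z).add (hki n _)).const_mul _) fun x => ?_
          refine (abs_abs_sub_abs_le _ _).trans ?_
          rw [sub_sub_sub_cancel_right]
          exact hpt x
      _ = (1 / (n : ℝ)) * (∫ x, k n z x ∂m + ∫ x, k n (D i) x ∂m) := by
          rw [integral_const_mul, integral_add (hki n z) (hki n _)]
      _ ≤ (1 / (n : ℝ)) * (κ + κ) := by
          gcongr <;> exact hκ n _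
      _ = 2 * κ / n := by ring
  set β : ℕ → ℝ := fun n => √(A n / n) / 2 * (m.real Set.univ + κ)
    + ∫ x, |∫ q, k n q x ∂P - f x| ∂m with hβ
  have hβlim : Tendsto β atTop (𝓝 0) := by
    have h1 : Tendsto (fun n => √(A n / n)) atTop (𝓝 0) := by
      have := (Real.continuous_sqrt.tendsto 0).comp hAn
      rwa [Real.sqrt_zero] at this
    have h2 := ((h1.div_const 2).mul_const (m.real Set.univ + κ)).add hbias
    rwa [zero_div, zero_mul, zero_add] at h2
  have hmean : ∀ n, 0 < n → ∫ D, Φ n D ∂(Measure.pi fun _ : Fin n => P) ≤ β n := by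
    intro n hn
    have h1 := integral_integral_abs_average_sub_le P m (hk n) (hk0 n) (hA n) (hkA n) (hκ n) hn
    have hVm : Measurable fun D : Fin n → Z =>
        ∫ x, |(1 / (n : ℝ)) * ∑ i, k n (D i) x - ∫ q, k n q x ∂P| ∂m := by
      have h1 : Measurable fun q : (Fin n → Z) × F =>
          |(1 / (n : ℝ)) * ∑ i, k n (q.1 i) q.2 - ∫ z, k n z q.2 ∂P| :=
        ((measurable_average (hk n) n).sub ((hgm n).comp measurable_snd)).abs
      exact (h1.stronglyMeasurable.integral_prod_right' (ν := m)).measurable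
    have hVi : Integrable (fun D : Fin n → Z =>
        ∫ x, |(1 / (n : ℝ)) * ∑ i, k n (D i) x - ∫ q, k n q x ∂P| ∂m)
        (Measure.pi fun _ : Fin n => P) := by
      refine integrable_of_measurable_of_abs_le hVm (C := (A n + A n) * m.real Set.univ) fun D => ?_
      have h2 := norm_integral_le_of_norm_le_const (μ := m)
        (f := fun x => |(1 / (n : ℝ)) * ∑ i, k n (D i) x - ∫ q, k n q x ∂P|) (C := A n + A n)
        (Eventually.of_forall fun x => by
          rw [Real.norm_eq_abs, abs_abs]
          refine (abs_sub _ _).trans (add_le_add ?_ ?_)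
          · rw [abs_mul, abs_of_nonneg (by positivity : 0 ≤ 1 / (n : ℝ)), one_div,
              inv_mul_le_iff₀ (by exact_mod_cast hn)]
            refine (Finset.abs_sum_le_sum_abs _ _).trans ?_
            exact (Finset.sum_le_card_nsmul _ _ (A n) fun i _ => hkabs _ _ _).trans_eq (by simp)
          · have := norm_integral_le_of_norm_le_const (μ := P) (f := fun q => k n q x) (C := A n)
              (Eventually.of_forall fun q => hkabs n q x)
            simpa using this)
      exact h2
    calc ∫ D, Φ n D ∂(Measure.pi fun _ : Fin n => P)
        ≤ ∫ D, (∫ x, |(1 / (n : ℝ)) * ∑ i, k n (D i) x - ∫ q, k n q x ∂P| ∂m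
            + ∫ x, |∫ q, k n q x ∂P - f x| ∂m) ∂(Measure.pi fun _ : Fin n => P) := by
          refine integral_mono (integrable_of_measurable_of_abs_le (hΦm n) (hbound n hn))
            (hVi.add (integrable_const _)) fun D => ?_
          have i1 : Integrable (fun x => |(1 / (n : ℝ)) * ∑ i, k n (D i) x - ∫ q, k n q x ∂P|) m :=
            ((havg n D).sub (hgi n)).abs
          have i2 : Integrable (fun x => |∫ q, k n q x ∂P - f x|) m := ((hgi n).sub hf).abs
          change Φ n D ≤ _ + _
          rw [← integral_add i1 i2]
          refine integral_mono (hfi n D) (i1.add i2) fun x => ?_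
          exact abs_sub_le _ _ _
      _ ≤ β n := by
          rw [integral_add hVi (integrable_const _)]
          simpa [hβ] using h1
  have hdev : ∀ r : ℕ, ∀ᵐ ω ∂μ, ∀ᶠ n in atTop,
      ω ∉ {ω | (fun i : Fin n => ξ i ω) ∈ {D | 1 / ((r : ℝ) + 1)
        ≤ Φ n D - ∫ y, Φ n y ∂Measure.pi (fun _ : Fin n => P)}} := by
    intro r
    set ε : ℝ := 1 / ((r : ℝ) + 1) with hε
    have hε0 : 0 < ε := by positivity
    refine ae_eventually_notMem_of_measure_le
      (f := fun n : ℕ => Real.exp (n * -(ε ^ 2 / (8 * κ ^ 2)))) ?_ ?_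
    · exact Real.summable_exp_nat_mul_iff.2 (by simp only [Left.neg_neg_iff]; positivity)
    · filter_upwards [eventually_gt_atTop 0] with n hn
      have hn' : (0 : ℝ) < n := by exact_mod_cast hn
      refine (measure_map_le_pi hmeas hindep hlaw n {D | ε
        ≤ Φ n D - ∫ y, Φ n y ∂Measure.pi (fun _ : Fin n => P)}).trans ?_
      rw [← ofReal_measureReal]
      refine ENNReal.ofReal_le_ofReal ((measureReal_ge_le_of_bounded_differences P
        (by positivity) (hΦm n) (hbound n hn) (hdiff n) hε0.le).trans_eq ?_)
      congr 1
      field_simp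
      norm_num
  filter_upwards [ae_all_iff.2 hdev] with ω hω
  rw [Metric.tendsto_nhds]
  intro ε hε
  obtain ⟨r, hr⟩ := exists_nat_one_div_lt (half_pos hε)
  filter_upwards [hω r, hβlim.eventually (eventually_lt_nhds (half_pos hε)), eventually_gt_atTop 0]
    with n h1 h2 h3
  rw [Real.dist_eq, sub_zero, abs_of_nonneg (hΦ0 n fun i : Fin n => ξ i ω)]
  have h4 : ¬ (1 / ((r : ℝ) + 1) ≤ Φ n (fun i : Fin n => ξ i ω)
      - ∫ y, Φ n y ∂Measure.pi (fun _ : Fin n => P)) := h1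
  have h5 := hmean n h3
  change Φ n (fun i : Fin n => ξ i ω) < ε
  linarith [not_le.1 h4]

end StrongConsistency

/-! ### Consistency of the potentials -/

section PotentialConsistency

variable {d : ℕ}

/-- The law of the attributes in class `j`, weighted with the prior probability of the class. -/
def classMeasure (P : Measure (Attr d × Label)) (j : Label) : Measure (Attr d) :=
  (P.restrict {q | q.2 = j}).map Prod.fst

/-- The density of the weighted law of class `j`. -/
def classDensity (P : Measure (Attr d × Label)) (j : Label) (x : Attr d) : ℝ :=
  ((classMeasure P j).rnDeriv volume x).toReal

instance (P : Measure (Attr d × Label)) [IsFiniteMeasure P] (j : Label) :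
    IsFiniteMeasure (classMeasure P j) := by
  unfold classMeasure; infer_instance

theorem measurable_classDensity (P : Measure (Attr d × Label)) (j : Label) :
    Measurable (classDensity P j) :=
  (Measure.measurable_rnDeriv _ _).ennreal_toReal

theorem integrable_classDensity (P : Measure (Attr d × Label)) [IsFiniteMeasure P] (j : Label) :
    Integrable (classDensity P j) volume :=
  Measure.integrable_toReal_rnDeriv

theorem measurableSet_label_eq (j : Label) : MeasurableSet {q : Attr d × Label | q.2 = j} :=
  measurable_snd (measurableSet_singleton j)

theorem IsContinuousRegularKernel.integral_pos {K : Attr d → ℝ} (hK : IsContinuousRegularKernel K) :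
    0 < ∫ u, K u := by
  obtain ⟨r, hr, b, hb, hKb, -⟩ := hK.regular
  rw [integral_pos_iff_support_of_nonneg hK.nonneg hK.integrable]
  refine (Metric.measure_ball_pos volume (0 : Attr d) hr).trans_le (measure_mono fun x hx => ?_)
  exact (hb.trans_le (hKb x (mem_ball_zero_iff.1 hx).le)).ne'

theorem integrable_normalized_kernel {K : Attr d → ℝ} (hK : IsContinuousRegularKernel K) {h : ℝ}
    (hh : 0 < h) (y : Attr d) : Integrable fun x => (h ^ d)⁻¹ * K (h⁻¹ • (x - y)) :=
  ((hK.integrable.comp_smul (inv_ne_zero hh.ne')).comp_sub_right y).const_mul _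

theorem integral_normalized_kernel {K : Attr d → ℝ} {h : ℝ}
    (hh : 0 < h) (y : Attr d) : ∫ x, (h ^ d)⁻¹ * K (h⁻¹ • (x - y)) = ∫ u, K u := by
  rw [integral_const_mul, integral_sub_right_eq_self (fun z => K (h⁻¹ • z)) y,
    Measure.integral_comp_inv_smul_of_nonneg volume _ hh.le, finrank_euclideanSpace_fin,
    smul_eq_mul, inv_mul_cancel_left₀ (by positivity)]

theorem integral_ite_label_eq {P : Measure (Attr d × Label)} [IsFiniteMeasure P] {j : Label}
    (hcont : classMeasure P j ≪ volume) {G : Attr d → ℝ} (hG : Measurable G) :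
    ∫ q, (if q.2 = j then G q.1 else 0) ∂P = ∫ y, classDensity P j y * G y := by
  have h1 := integral_rnDeriv_smul (f := G) hcont
  simp only [smul_eq_mul] at h1
  change ∫ y, classDensity P j y * G y = _ at h1
  rw [h1, classMeasure, integral_map measurable_fst.aemeasurable hG.aestronglyMeasurable,
    ← integral_indicator (measurableSet_label_eq j)]
  simp only [Set.indicator, Set.mem_ofPred_eq]

/-- The kernel is not normalised, so the limit carries the factor `∫ u, K u`; it is common to both
classes and does not affect their comparison. Finite volume of `B` is needed because the variance
bound integrates a constant. -/
theorem ae_tendsto_integral_abs_potential_sub {P : Measure (Attr d × Label)}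
    [IsProbabilityMeasure P] (j : Label) (hcont : classMeasure P j ≪ volume)
    {Ω : Type*} [MeasurableSpace Ω] {μ : Measure Ω} [IsProbabilityMeasure μ]
    {ξ : ℕ → Ω → Attr d × Label} (hmeas : ∀ i, Measurable (ξ i))
    (hindep : iIndepFun ξ μ) (hlaw : ∀ i, μ.map (ξ i) = P)
    {K : Attr d → ℝ} (hK : IsContinuousRegularKernel K)
    {h : ℕ → ℝ} (hpos : ∀ n, 0 < h n) (hzero : Tendsto h atTop (𝓝 0))
    (hinf : Tendsto (fun n : ℕ => (n : ℝ) * h n ^ d) atTop atTop)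
    {B : Set (Attr d)} (hB : volume B ≠ ⊤) :
    ∀ᵐ ω ∂μ, Tendsto (fun n : ℕ => ∫ x in B,
      |potential K (h n) (fun i : Fin n => ξ i ω) j x - (∫ u, K u) * classDensity P j x|)
      atTop (𝓝 0) := by
  have hfin : IsFiniteMeasure (volume.restrict B) := ⟨by simpa using hB.lt_top⟩
  obtain ⟨M, hM0, hM⟩ := hK.exists_le
  have hKm : Measurable K := hK.continuous.measurable
  have hfm := (measurable_classDensity P j).const_mul (∫ u, K u)
  have hfi := (integrable_classDensity P j).const_mul (∫ u, K u)
  set k : ℕ → Attr d × Label → Attr d → ℝ := fun n q x =>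
    if q.2 = j then (h n ^ d)⁻¹ * K ((h n)⁻¹ • (x - q.1)) else 0 with hk
  have hkm : ∀ n, Measurable (Function.uncurry (k n)) := fun n =>
    Measurable.ite (measurable_snd.comp measurable_fst (measurableSet_singleton j))
      (by fun_prop) measurable_const
  have hgoal := ae_tendsto_integral_abs_average_sub (P := P) (m := volume.restrict B) hmeas hindep
    hlaw (k := k) hkm ?_ (A := fun n => (h n ^ d)⁻¹ * M) ?_ ?_ ?_ hK.integral_pos ?_ hfm
    hfi.integrableOn ?_
  · filter_upwards [hgoal] with ω hω
    simpa only [potential, Finset.sum_filter] using hω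
  · intro n q x
    simp only [hk]
    split_ifs
    · exact mul_nonneg (inv_nonneg.2 (pow_nonneg (hpos n).le _)) (hK.nonneg _)
    · exact le_rfl
  · exact fun n => mul_pos (inv_pos.2 (pow_pos (hpos n) _)) hM0
  · intro n q x
    have hc : 0 ≤ (h n ^ d)⁻¹ := inv_nonneg.2 (pow_nonneg (hpos n).le _)
    simp only [hk]
    split_ifs
    · gcongr
      exact hM _
    · positivity
  · have h1 := hinf.inv_tendsto_atTop.const_mul M
    rw [mul_zero] at h1
    refine h1.congr fun n => ?_
    simp only [Pi.inv_apply, mul_inv]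
    ring
  · intro n q
    by_cases hq : q.2 = j
    · simp only [hk, hq, if_true]
      rw [← integral_normalized_kernel (K := K) (hpos n) q.1]
      exact setIntegral_le_integral (integrable_normalized_kernel hK (hpos n) q.1)
        (Eventually.of_forall fun x =>
          mul_nonneg (inv_nonneg.2 (pow_nonneg (hpos n).le _)) (hK.nonneg _))
    · simp only [hk, hq, if_false, integral_zero]
      exact hK.integral_pos.le
  · have hbias := tendsto_lintegral_enorm_convolution_sub hK (measurable_classDensity P j)
      (integrable_classDensity P j) hpos hzero
    have hB' := tendsto_of_tendsto_of_tendsto_of_le_of_le (tendsto_const_nhds (x := (0 : ENNReal)))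
      hbias (fun n => zero_le) fun n => lintegral_mono' (μ := volume.restrict B)
        Measure.restrict_le_self le_rfl
    have h2 := (ENNReal.tendsto_toReal ENNReal.zero_ne_top).comp hB'
    rw [ENNReal.toReal_zero] at h2
    refine h2.congr fun n => ?_
    have e : ∀ x, ∫ q, k n q x ∂P
        = ∫ y, classDensity P j y * ((h n ^ d)⁻¹ * K ((h n)⁻¹ • (x - y))) := fun x =>
      integral_ite_label_eq hcont (G := fun y => (h n ^ d)⁻¹ * K ((h n)⁻¹ • (x - y)))
        (by fun_prop)
    have hgm : Measurable fun x => ∫ q, k n q x ∂P :=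
      ((hkm n).stronglyMeasurable.integral_prod_left' (μ := P)).measurable
    simp_rw [Function.comp_apply, ← e]
    exact (integral_norm_eq_lintegral_enorm (hgm.sub hfm).aestronglyMeasurable).symm

end PotentialConsistency

/-! ### Comparison with the Bayes risk -/

section BayesComparison

variable {d : ℕ} {P : Measure (Attr d × Label)}

theorem measureReal_label_and_mem (j : Label) {A : Set (Attr d)} (hA : MeasurableSet A) :
    P.real {q | q.2 = j ∧ q.1 ∈ A} = (classMeasure P j).real A := by
  rw [classMeasure, measureReal_def, measureReal_def, Measure.map_apply measurable_fst hA,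
    Measure.restrict_apply (measurable_fst hA)]
  congr 2
  ext q
  exact and_comm

theorem errorProb_eq [IsProbabilityMeasure P] {g : Attr d → Label} {A : Set (Attr d)}
    (hA : MeasurableSet A) (hg : ∀ x, g x = 1 ↔ x ∈ A) :
    errorProb P g = P.real {q | q.2 = 0 ∧ q.1 ∈ A}
      + (P.real {q | q.2 = 1} - P.real {q | q.2 = 1 ∧ q.1 ∈ A}) := by
  have hm : ∀ j, MeasurableSet {q : Attr d × Label | q.2 = j ∧ q.1 ∈ A} := fun j =>
    (measurableSet_label_eq j).inter (measurable_fst hA)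
  have h1 : {q : Attr d × Label | g q.1 ≠ q.2} = {q | q.2 = 0 ∧ q.1 ∈ A}
      ∪ ({q | q.2 = 1} \ {q | q.2 = 1 ∧ q.1 ∈ A}) := by
    ext ⟨x, y⟩
    have hx := hg x
    have hg2 : g x = 0 ∨ g x = 1 := by generalize g x = v; fin_cases v <;> simp
    fin_cases y <;> rcases hg2 with h | h <;> simp [h] at hx <;> simp [h, hx]
  have h2 : Disjoint {q : Attr d × Label | q.2 = 0 ∧ q.1 ∈ A}
      ({q | q.2 = 1} \ {q | q.2 = 1 ∧ q.1 ∈ A}) := by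
    rw [Set.disjoint_left]
    rintro q ⟨h, -⟩ ⟨h', -⟩
    rw [Set.mem_ofPred_eq, h] at h'
    exact absurd h' (by simp)
  have hsub : {q : Attr d × Label | q.2 = 1 ∧ q.1 ∈ A} ⊆ {q | q.2 = 1} := fun q hq => hq.1
  rw [errorProb, h1, measureReal_union h2 ((measurableSet_label_eq 1).diff (hm 1)),
    measureReal_sdiff hsub (hm 1)]

theorem classMeasure_real_eq_setIntegral_density [IsProbabilityMeasure P] {j : Label}
    (hcont : classMeasure P j ≪ volume) (A : Set (Attr d)) :
    (classMeasure P j).real A = ∫ x in A, classDensity P j x :=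
  (Measure.setIntegral_toReal_rnDeriv hcont A).symm

theorem classPosterior_nonneg [IsProbabilityMeasure P] (j : Label) (x : Attr d) :
    0 ≤ classPosterior P j x := measureReal_nonneg

theorem measurable_classPosterior [IsProbabilityMeasure P] (j : Label) :
    Measurable (classPosterior P j) :=
  (Kernel.measurable_coe _ (measurableSet_singleton j)).ennreal_toReal

theorem integrable_classPosterior [IsProbabilityMeasure P] (j : Label) :
    Integrable (classPosterior P j) P.fst :=
  integrable_of_measurable_of_abs_le (measurable_classPosterior j) (C := 1) fun x => by
    rw [abs_of_nonneg (classPosterior_nonneg j x)]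
    exact measureReal_le_one

theorem classMeasure_real_eq_setIntegral_posterior [IsProbabilityMeasure P] (j : Label)
    {A : Set (Attr d)} (hA : MeasurableSet A) :
    (classMeasure P j).real A = ∫ x in A, classPosterior P j x ∂P.fst := by
  have h1 := Measure.setLIntegral_condKernel_eq_measure_prod (ρ := P) hA (measurableSet_singleton j)
  rw [← measureReal_label_and_mem j hA]
  have e : {q : Attr d × Label | q.2 = j ∧ q.1 ∈ A} = A ×ˢ {j} := by
    ext q
    exact and_comm
  rw [e, measureReal_def, ← h1]
  exact (integral_toReal (Kernel.measurable_coe _ (measurableSet_singleton j)).aemeasurable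
    (Eventually.of_forall fun x => measure_lt_top _ _)).symm

theorem measurableSet_bayes [IsProbabilityMeasure P] :
    MeasurableSet {x | classPosterior P 0 x < classPosterior P 1 x} :=
  measurableSet_lt (measurable_classPosterior 0) (measurable_classPosterior 1)

theorem bayesClassifier_eq_one_iff [IsProbabilityMeasure P] (x : Attr d) :
    bayesClassifier P x = 1 ↔ x ∈ {x | classPosterior P 0 x < classPosterior P 1 x} := by
  rw [bayesClassifier, Set.mem_ofPred_eq]
  split_ifs with h <;> simp [h]

theorem bayesErrorProb_le [IsProbabilityMeasure P] {g : Attr d → Label} {A : Set (Attr d)}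
    (hA : MeasurableSet A) (hg : ∀ x, g x = 1 ↔ x ∈ A) : bayesErrorProb P ≤ errorProb P g := by
  rw [bayesErrorProb, errorProb_eq hA hg, errorProb_eq measurableSet_bayes bayesClassifier_eq_one_iff]
  simp only [measureReal_label_and_mem _ hA, measureReal_label_and_mem _ measurableSet_bayes,
    classMeasure_real_eq_setIntegral_posterior _ hA,
    classMeasure_real_eq_setIntegral_posterior _ measurableSet_bayes]
  have hi := fun j => integrable_classPosterior (P := P) j
  have hsub : ∀ S : Set (Attr d), ∫ x in S, (classPosterior P 0 x - classPosterior P 1 x) ∂P.fst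
      = ∫ x in S, classPosterior P 0 x ∂P.fst - ∫ x in S, classPosterior P 1 x ∂P.fst := fun S =>
    integral_sub (hi 0).integrableOn (hi 1).integrableOn
  have h1 : ∫ x in {x | classPosterior P 0 x < classPosterior P 1 x},
      (classPosterior P 0 x - classPosterior P 1 x) ∂P.fst
      ≤ ∫ x in A, (classPosterior P 0 x - classPosterior P 1 x) ∂P.fst := by
    rw [← integral_indicator measurableSet_bayes, ← integral_indicator hA]
    refine integral_mono (((hi 0).sub (hi 1)).indicator measurableSet_bayes)
      (((hi 0).sub (hi 1)).indicator hA) fun x => ?_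
    simp only [Set.indicator, Set.mem_ofPred_eq]
    split_ifs <;> linarith
  rw [hsub, hsub] at h1
  linarith

/-- At a point of `B` where the two rules differ, the excess loss of the plug-in rule is a
difference of densities whose order the estimates `φ` contradict, so `κ` times it is at most the two
estimation errors. Outside `B` the densities themselves bound it. -/
theorem mul_errorProb_sub_le [IsProbabilityMeasure P] (hcont : ∀ j, classMeasure P j ≪ volume)
    {κ : ℝ} (hκ : 0 ≤ κ) {φ : Label → Attr d → ℝ} (hφm : ∀ j, Measurable (φ j)) {B : Set (Attr d)}
    (hB : MeasurableSet B) (hφ : ∀ j, IntegrableOn (fun x => |φ j x - κ * classDensity P j x|) B)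
    {g g' : Attr d → Label} (hg : ∀ x, g x = 1 ↔ φ 0 x < φ 1 x) {A' : Set (Attr d)}
    (hA' : MeasurableSet A') (hg' : ∀ x, g' x = 1 ↔ x ∈ A') :
    κ * (errorProb P g - errorProb P g')
      ≤ ∑ j, (∫ x in B, |φ j x - κ * classDensity P j x|)
        + κ * ∑ j, ((∫ x, classDensity P j x) - (∫ x in B, classDensity P j x)) := by
  have hA : MeasurableSet {x | φ 0 x < φ 1 x} := measurableSet_lt (hφm 0) (hφm 1)
  rw [errorProb_eq hA hg, errorProb_eq hA' hg']
  simp only [measureReal_label_and_mem _ hA, measureReal_label_and_mem _ hA',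
    classMeasure_real_eq_setIntegral_density (hcont _)]
  have hi := fun j => integrable_classDensity P j
  have h0 : ∀ j x, 0 ≤ classDensity P j x := fun j x => ENNReal.toReal_nonneg
  have hsub : ∀ S : Set (Attr d), (∫ x in S, (classDensity P 0 x - classDensity P 1 x))
      = (∫ x in S, classDensity P 0 x) - (∫ x in S, classDensity P 1 x) := fun S =>
    integral_sub (hi 0).integrableOn (hi 1).integrableOn
  have hcompl : ∀ j, (∫ x, classDensity P j x) - (∫ x in B, classDensity P j x)
      = (∫ x in Bᶜ, classDensity P j x) := fun j => by
    rw [← integral_add_compl hB (hi j)]; ring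
  simp only [hcompl, Fin.sum_univ_two]
  have h1 : κ * ((∫ x in {x | φ 0 x < φ 1 x}, (classDensity P 0 x - classDensity P 1 x))
      - ∫ x in A', (classDensity P 0 x - classDensity P 1 x))
      ≤ (∫ x in B, |φ 0 x - κ * classDensity P 0 x|) + (∫ x in B, |φ 1 x - κ * classDensity P 1 x|)
        + κ * ((∫ x in Bᶜ, classDensity P 0 x) + (∫ x in Bᶜ, classDensity P 1 x)) := by
    have i0 : ∀ S : Set (Attr d), MeasurableSet S → Integrable
        (S.indicator fun x => classDensity P 0 x - classDensity P 1 x) := fun S hS =>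
      ((hi 0).sub (hi 1)).indicator hS
    have i1 := i0 _ hA
    have i2 := i0 _ hA'
    have i3 := fun j => (hφ j).integrable_indicator hB
    have i4 := fun j => (hi j).indicator hB.compl
    have i5 : Integrable fun x => B.indicator (fun x => |φ 0 x - κ * classDensity P 0 x|) x
        + B.indicator (fun x => |φ 1 x - κ * classDensity P 1 x|) x := (i3 0).add (i3 1)
    have i6 : Integrable fun x => κ * (Bᶜ.indicator (classDensity P 0) x
        + Bᶜ.indicator (classDensity P 1) x) := ((i4 0).add (i4 1)).const_mul κ
    rw [← integral_indicator hA, ← integral_indicator hA', ← integral_sub i1 i2,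
      ← integral_const_mul, ← integral_indicator hB, ← integral_indicator hB,
      ← integral_indicator hB.compl, ← integral_indicator hB.compl, ← integral_add (i3 0) (i3 1),
      ← integral_add (i4 0) (i4 1), ← integral_const_mul,
      ← integral_add i5 i6]
    refine integral_mono ((i1.sub i2).const_mul κ)
      (i5.add i6) fun x => ?_
    have a0 := abs_le.1 (le_refl |φ 0 x - κ * classDensity P 0 x|)
    have a1 := abs_le.1 (le_refl |φ 1 x - κ * classDensity P 1 x|)
    have b0 := mul_nonneg hκ (h0 0 x)
    have b1 := mul_nonneg hκ (h0 1 x)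
    by_cases hxB : x ∈ B <;>
      simp only [Set.indicator, Set.mem_ofPred_eq, Set.mem_compl_iff, hxB, not_true_eq_false,
        not_false_eq_true, if_true, if_false] <;> split_ifs <;> nlinarith
  rw [hsub, hsub] at h1
  linarith

end BayesComparison

/-! ### Composed features as polynomials -/

section PlanarPolynomials

/-- The functions of the two coordinates that are polynomials of degree at most `p` in each
coordinate. -/
def IsPlanarPolynomial (p : ℕ) (w : ℝ × ℝ → ℝ) : Prop :=
  ∃ θ : Fin (p + 1) × Fin (p + 1) → ℝ, ∀ z, w z = ∑ e, θ e * (z.1 ^ (e.1 : ℕ) * z.2 ^ (e.2 : ℕ))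

theorem isPlanarPolynomial_feature {p : ℕ} {k : ℕ × ℕ} (hk : k ∈ featureIndex p) :
    IsPlanarPolynomial p (feature k) := by
  simp only [featureIndex, Finset.mem_filter, Finset.mem_product, Finset.mem_range] at hk
  refine ⟨Pi.single (⟨k.1, hk.1.1⟩, ⟨k.2, hk.1.2⟩) 1, fun z => ?_⟩
  rw [Finset.sum_eq_single (⟨k.1, hk.1.1⟩, ⟨k.2, hk.1.2⟩)]
  · simp [feature]
  · intro e _ he
    simp [he]
  · simp

theorem IsPlanarPolynomial.combine {p : ℕ} {u v : ℝ × ℝ → ℝ} (hu : IsPlanarPolynomial p u)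
    (hv : IsPlanarPolynomial p v) (a b : ℝ) : IsPlanarPolynomial p (combine a b u v) := by
  obtain ⟨θ, hθ⟩ := hu
  obtain ⟨η, hη⟩ := hv
  refine ⟨fun e => a * θ e + b * η e, fun z => ?_⟩
  simp only [_root_.combine, hθ, hη, Finset.mul_sum, ← Finset.sum_add_distrib]
  exact Finset.sum_congr rfl fun e _ => by ring

theorem IsPlanarPolynomial.measurable {p : ℕ} {w : ℝ × ℝ → ℝ} (hw : IsPlanarPolynomial p w) :
    Measurable w := by
  obtain ⟨θ, hθ⟩ := hw
  rw [funext hθ]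
  fun_prop

/-- The normalisation of the potentials and the threshold are absorbed into the coefficients, the
threshold into the one with index `0`, so that the rules become positive sets in terms of the raw
kernel sums. -/
theorem IsPlanarPolynomial.exists_rescale {p : ℕ} {w : ℝ × ℝ → ℝ} (hw : IsPlanarPolynomial p w)
    (a c : ℝ) : ∃ θ : Fin (p + 1) × Fin (p + 1) → ℝ, ∀ s t : ℝ,
      w (a * s, a * t) - c = ∑ e, θ e * (s ^ (e.1 : ℕ) * t ^ (e.2 : ℕ)) := by
  obtain ⟨θ, hθ⟩ := hw
  refine ⟨fun e => θ e * (a ^ (e.1 : ℕ) * a ^ (e.2 : ℕ)) - Pi.single (M := fun _ => ℝ) 0 c e,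
    fun s t => ?_⟩
  simp only [sub_mul, Finset.sum_sub_distrib]
  congr 1
  · rw [hθ]
    exact Finset.sum_congr rfl fun e _ => by simp only [mul_pow]; ring
  · rw [Finset.sum_eq_single 0]
    · simp
    · intro e _ he
      simp [he]
    · simp

theorem AlphaRun.isPlanarPolynomial {F : LineFamily} {p n : ℕ} {Z : Fin n → (ℝ × ℝ) × Label}
    {U : Finset (ℕ × ℕ)} {w : ℝ × ℝ → ℝ} {c : ℝ} (h : AlphaRun F p Z U w c) :
    IsPlanarPolynomial p w := by
  induction h with
  | first k l hk hl hkl a b c hline hmin =>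
    exact (isPlanarPolynomial_feature hk).combine (isPlanarPolynomial_feature hl) a b
  | next U w c₀ hprev k hk hkU a b c hline hmin hlower ih =>
    exact ih.combine (isPlanarPolynomial_feature hk) a b

/-- The composed feature that compares the two coordinates. -/
def diagonalFeature : ℝ × ℝ → ℝ :=
  combine (-(√2)⁻¹) (√2)⁻¹ (feature (1, 0)) (feature (0, 1))

theorem diagonalFeature_pos_iff (z : ℝ × ℝ) : 0 < diagonalFeature z ↔ z.1 < z.2 := by
  have e : diagonalFeature z = (√2)⁻¹ * (z.2 - z.1) := by
    simp [diagonalFeature, combine, feature]; ring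
  rw [e, mul_pos_iff_of_pos_left (by positivity), sub_pos]

theorem mem_featureIndex_one_zero {p : ℕ} (hp : 1 ≤ p) : (1, 0) ∈ featureIndex p := by
  simp [featureIndex]; omega

theorem mem_featureIndex_zero_one {p : ℕ} (hp : 1 ≤ p) : (0, 1) ∈ featureIndex p := by
  simp [featureIndex]; omega

theorem isPlanarPolynomial_diagonalFeature {p : ℕ} (hp : 1 ≤ p) :
    IsPlanarPolynomial p diagonalFeature :=
  (isPlanarPolynomial_feature (mem_featureIndex_one_zero hp)).combine
    (isPlanarPolynomial_feature (mem_featureIndex_zero_one hp)) _ _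

/-- The diagonal passes through the origin, so both families contain it, and it uses two features of
degree one; hence it competes in the first step. Later steps are made only if they lower the
empirical risk. -/
theorem AlphaRun.empRisk_le_diagonal {F : LineFamily} {p n : ℕ} (hp : 1 ≤ p)
    {Z : Fin n → (ℝ × ℝ) × Label} {U : Finset (ℕ × ℕ)} {w : ℝ × ℝ → ℝ} {c : ℝ}
    (h : AlphaRun F p Z U w c) : empRisk Z w c ≤ empRisk Z diagonalFeature 0 := by
  induction h with
  | first k l hk hl hkl a b c hline hmin =>
    refine hmin _ (mem_featureIndex_one_zero hp) _ (mem_featureIndex_zero_one hp) (by simp) _ _ _ ?_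
    have h1 : (-(√2)⁻¹) ^ 2 + ((√2)⁻¹) ^ 2 = (1 : ℝ) := by
      rw [neg_sq, inv_pow, Real.sq_sqrt (by norm_num)]; norm_num
    cases F
    · exact ⟨h1, rfl⟩
    · exact h1
  | next U w c₀ hprev k hk hkU a b c hline hmin hlower ih => exact hlower.le.trans ih

end PlanarPolynomials

/-! ### Risks in terms of class frequencies -/

section RiskDeviation

variable {d : ℕ}

theorem potential_eq_mul_ownSum {n : ℕ} (K : Attr d → ℝ) (h : ℝ) (D : Fin n → Attr d × Label)
    (j : Label) (x : Attr d) :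
    potential K h D j x = (1 / (n : ℝ) * (h ^ d)⁻¹) * ownSum (scaledKernel K h) D j x := by
  rw [potential, ownSum, ← Finset.mul_sum, mul_assoc]
  rfl

theorem label_eq_zero_or_one (j : Label) : j = 0 ∨ j = 1 := by
  fin_cases j <;> simp

theorem otherSum_zero {n : ℕ} (kern : Attr d → Attr d → ℝ) (D : Fin n → Attr d × Label) :
    otherSum kern D 0 = ownSum kern D 1 := by
  ext x
  simp only [otherSum, ownSum]
  congr 1
  ext i
  have : (D i).2 ≠ 0 ↔ (D i).2 = 1 := by
    rcases label_eq_zero_or_one (D i).2 with h | h <;> simp [h]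
  simp [this]

theorem otherSum_one {n : ℕ} (kern : Attr d → Attr d → ℝ) (D : Fin n → Attr d × Label) :
    otherSum kern D 1 = ownSum kern D 0 := by
  ext x
  simp only [otherSum, ownSum]
  congr 1
  ext i
  have : (D i).2 ≠ 1 ↔ (D i).2 = 0 := by
    rcases label_eq_zero_or_one (D i).2 with h | h <;> simp [h]
  simp [this]

theorem measurable_potential {n : ℕ} {K : Attr d → ℝ} (hK : Measurable K) (h : ℝ)
    (D : Fin n → Attr d × Label) (j : Label) : Measurable (potential K h D j) := by
  unfold potential
  fun_prop

theorem exists_posSet_eq {p n : ℕ} {w : ℝ × ℝ → ℝ} (hw : IsPlanarPolynomial p w) (c : ℝ)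
    (K : Attr d → ℝ) (h : ℝ) (D : Fin n → Attr d × Label) (j : Label) :
    ∃ θ : Fin (p + 1) × Fin (p + 1) → ℝ, {x | c < w (potPot K h D x)}
      = posSet θ (otherSum (scaledKernel K h) D j) (ownSum (scaledKernel K h) D j) := by
  obtain ⟨θ, hθ⟩ := hw.exists_rescale (1 / (n : ℝ) * (h ^ d)⁻¹) c
  have hmem : ∀ x, x ∈ {x | c < w (potPot K h D x)}
      ↔ 0 < ∑ e, θ e * (ownSum (scaledKernel K h) D 0 x ^ (e.1 : ℕ)
        * ownSum (scaledKernel K h) D 1 x ^ (e.2 : ℕ)) := fun x => by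
    rw [Set.mem_ofPred_eq, ← sub_pos, potPot, potential_eq_mul_ownSum, potential_eq_mul_ownSum, hθ]
  rcases label_eq_zero_or_one j with rfl | rfl
  -- In `posSet` the own sum is the second variable, so for class `0` the two exponents trade
  -- places.
  · refine ⟨fun e => θ e.swap, Set.ext fun x => ?_⟩
    rw [hmem, mem_posSet, otherSum_zero, dotProduct,
      ← (Equiv.prodComm (Fin (p + 1)) (Fin (p + 1))).sum_comp]
    refine Eq.to_iff (congrArg _ (Finset.sum_congr rfl fun e _ => ?_))
    simp only [derivVec, Equiv.prodComm_apply, Prod.fst_swap, Prod.snd_swap, Function.iterate_zero,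
      id, Polynomial.eval_pow, Polynomial.eval_X]
    ring
  · refine ⟨θ, Set.ext fun x => ?_⟩
    rw [hmem, mem_posSet, otherSum_one, dotProduct]
    refine Eq.to_iff (congrArg _ (Finset.sum_congr rfl fun e _ => ?_))
    simp only [derivVec, Function.iterate_zero, id, Polynomial.eval_pow, Polynomial.eval_X]

theorem thresholdRule_eq_one_iff (w : ℝ × ℝ → ℝ) (c : ℝ) (z : ℝ × ℝ) :
    thresholdRule w c z = 1 ↔ c < w z := by
  rw [thresholdRule]
  split_ifs with h <;> simp [h]

theorem empRisk_potPotPlot_eq {n : ℕ} (K : Attr d → ℝ) (h : ℝ) (D : Fin n → Attr d × Label)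
    (w : ℝ × ℝ → ℝ) (c : ℝ) :
    empRisk (potPotPlot K h D) w c = classHits D 0 {x | c < w (potPot K h D x)} / n
      + ((labelCount D 1 : ℝ) / n - classHits D 1 {x | c < w (potPot K h D x)} / n) := by
  rw [empRisk, ← sub_div, ← add_div]
  congr 1
  simp only [classHits, labelCount, Finset.card_filter, Finset.sum_filter, Nat.cast_sum]
  rw [← Finset.sum_sub_distrib, ← Finset.sum_add_distrib]
  refine Finset.sum_congr rfl fun i _ => ?_
  have hj := label_eq_zero_or_one (D i).2
  by_cases hc : c < w (potPot K h D (D i).1) <;> rcases hj with hj | hj <;>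
    simp [potPotPlot, thresholdRule, hc, hj]

end RiskDeviation

/-! ### Convergence of the risks -/

section RiskConvergence

variable {d : ℕ} {P : Measure (Attr d × Label)} [IsProbabilityMeasure P]
  {Ω : Type*} [MeasurableSpace Ω] {μ : Measure Ω} [IsProbabilityMeasure μ]
  {ξ : ℕ → Ω → Attr d × Label} {K : Attr d → ℝ} {h : ℕ → ℝ}

theorem measurableSet_lt_potPot {n p : ℕ} (hK : Measurable K) (h : ℝ) (D : Fin n → Attr d × Label)
    {w : ℝ × ℝ → ℝ} (hw : IsPlanarPolynomial p w) (c : ℝ) :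
    MeasurableSet {x | c < w (potPot K h D x)} :=
  measurableSet_lt measurable_const
    (hw.measurable.comp ((measurable_potential hK h D 0).prodMk (measurable_potential hK h D 1)))

/-- Both risks split into the frequency, or mass, of class `0` in the decision region, minus that of
class `1`, plus the share of class `1`. The three deviations take `ε / 3` each. -/
theorem ae_eventually_abs_errorProb_sub_empRisk_le (hd : 0 < d)
    (hcont : ∀ j : Label, (P.restrict {q | q.2 = j}).map Prod.fst ≪ volume)
    (hmeas : ∀ i, Measurable (ξ i)) (hindep : iIndepFun ξ μ) (hlaw : ∀ i, μ.map (ξ i) = P)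
    (hK : IsContinuousRegularKernel K) (hpos : ∀ n, 0 < h n) (hzero : Tendsto h atTop (𝓝 0))
    (hinf : Tendsto (fun n : ℕ => (n : ℝ) * h n ^ d) atTop atTop) (p : ℕ) :
    ∀ᵐ ω ∂μ, ∀ ε > 0, ∀ᶠ n : ℕ in atTop, ∀ w : ℝ × ℝ → ℝ, IsPlanarPolynomial p w → ∀ c : ℝ,
      |errorProb P (fun x => thresholdRule w c (potPot K (h n) (fun i : Fin n => ξ i ω) x))
        - empRisk (potPotPlot K (h n) (fun i : Fin n => ξ i ω)) w c| ≤ ε := by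
  filter_upwards [ae_eventually_classHits_dev_le hd 0 (hcont 0) hmeas hindep hlaw hK hpos hzero hinf p,
    ae_eventually_classHits_dev_le hd 1 (hcont 1) hmeas hindep hlaw hK hpos hzero hinf p,
    ae_tendsto_labelCount_div hmeas hindep hlaw 1] with ω h0 h1 hl ε hε
  filter_upwards [h0 (ε / 3) (by positivity), h1 (ε / 3) (by positivity),
    Metric.tendsto_nhds.1 hl (ε / 3) (by positivity)] with n h0 h1 hl w hw c
  obtain ⟨θ₀, e0⟩ := exists_posSet_eq hw c K (h n) (fun i : Fin n => ξ i ω) 0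
  obtain ⟨θ₁, e1⟩ := exists_posSet_eq hw c K (h n) (fun i : Fin n => ξ i ω) 1
  rw [errorProb_eq (measurableSet_lt_potPot hK.continuous.measurable (h n) _ hw c)
    fun x => thresholdRule_eq_one_iff w c _, empRisk_potPotPlot_eq]
  have h0 := abs_le.1 (h0 θ₀ _ e0)
  have h1 := abs_le.1 (h1 θ₁ _ e1)
  rw [Real.dist_eq] at hl
  have hl := abs_lt.1 hl
  rw [abs_le]
  constructor <;> linarith [h0.1, h0.2, h1.1, h1.2, hl.1, hl.2]

theorem tendsto_integral_closedBall {f : Attr d → ℝ} (hf : Integrable f) :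
    Tendsto (fun ρ : ℕ => ∫ x in Metric.closedBall 0 (ρ : ℝ), f x) atTop (𝓝 (∫ x, f x)) :=
  (aecover_closedBall tendsto_natCast_atTop_atTop).integral_tendsto_of_countably_generated hf

/-- Outside a large ball the densities have little mass; on the ball the potentials converge in `L¹`
to a common multiple of the densities. -/
theorem ae_eventually_errorProb_diagonal_le
    (hcont : ∀ j : Label, (P.restrict {q | q.2 = j}).map Prod.fst ≪ volume)
    (hmeas : ∀ i, Measurable (ξ i)) (hindep : iIndepFun ξ μ) (hlaw : ∀ i, μ.map (ξ i) = P)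
    (hK : IsContinuousRegularKernel K) (hpos : ∀ n, 0 < h n) (hzero : Tendsto h atTop (𝓝 0))
    (hinf : Tendsto (fun n : ℕ => (n : ℝ) * h n ^ d) atTop atTop) :
    ∀ᵐ ω ∂μ, ∀ ε > 0, ∀ᶠ n : ℕ in atTop,
      errorProb P (fun x => thresholdRule diagonalFeature 0
        (potPot K (h n) (fun i : Fin n => ξ i ω) x)) ≤ bayesErrorProb P + ε := by
  set κ := ∫ u, K u with hκ
  have hκ0 : 0 < κ := hK.integral_pos
  have hcv : ∀ (j : Label) (ρ : ℕ), ∀ᵐ ω ∂μ, Tendsto (fun n : ℕ =>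
      ∫ x in Metric.closedBall 0 (ρ : ℝ), |potential K (h n) (fun i : Fin n => ξ i ω) j x
        - κ * classDensity P j x|) atTop (𝓝 0) := fun j ρ =>
    ae_tendsto_integral_abs_potential_sub j (hcont j) hmeas hindep hlaw hK hpos hzero hinf
      measure_closedBall_lt_top.ne
  filter_upwards [ae_all_iff.2 fun j => ae_all_iff.2 (hcv j)] with ω hω ε hε
  have htail : Tendsto (fun ρ : ℕ => ∑ j : Label, ((∫ x, classDensity P j x)
      - ∫ x in Metric.closedBall 0 (ρ : ℝ), classDensity P j x)) atTop (𝓝 0) := by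
    have := tendsto_finsetSum (Finset.univ : Finset Label) fun j _ =>
      (tendsto_integral_closedBall (integrable_classDensity P j)).const_sub
        (∫ x, classDensity P j x)
    simpa using this
  obtain ⟨ρ, hρ⟩ := (htail.eventually (eventually_lt_nhds (half_pos hε))).exists
  have hsum : Tendsto (fun n : ℕ => ∑ j : Label, ∫ x in Metric.closedBall 0 (ρ : ℝ),
      |potential K (h n) (fun i : Fin n => ξ i ω) j x - κ * classDensity P j x|) atTop (𝓝 0) := by
    have := tendsto_finsetSum (Finset.univ : Finset Label) fun j _ => hω j ρ
    simpa using this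
  filter_upwards [hsum.eventually (eventually_lt_nhds (mul_pos hκ0 (half_pos hε)))] with n hn
  have hpi : ∀ j, Integrable (potential K (h n) (fun i : Fin n => ξ i ω) j) := fun j =>
    (integrable_finsetSum _ fun i _ => integrable_normalized_kernel hK (hpos n) _).const_mul _
  have hcmp := mul_errorProb_sub_le (P := P) hcont hκ0.le
    (fun j => measurable_potential hK.continuous.measurable (h n) (fun i : Fin n => ξ i ω) j)
    (Metric.isClosed_closedBall (x := (0 : Attr d)) (ε := (ρ : ℝ))).measurableSet
    (fun j => ((hpi j).sub ((integrable_classDensity P j).const_mul κ)).abs.integrableOn)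
    (g := fun x => thresholdRule diagonalFeature 0 (potPot K (h n) (fun i : Fin n => ξ i ω) x))
    (fun x => (thresholdRule_eq_one_iff _ _ _).trans (diagonalFeature_pos_iff _))
    (measurableSet_bayes (P := P)) bayesClassifier_eq_one_iff
  have h1 := hcmp.trans (add_le_add hn.le (mul_le_mul_of_nonneg_left hρ.le hκ0.le))
  rw [← mul_add, mul_le_mul_iff_right₀ hκ0, add_halves] at h1
  rw [bayesErrorProb]
  linarith

end RiskConvergence

end

theorem theorem2 {d : ℕ} (hd : 0 < d)
    -- the law of `(X, Y)`
    (P : Measure (Attr d × Label)) [IsProbabilityMeasure P]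
    -- both classes have continuous distributions
    (hcont : ∀ j : Label, (P.restrict {q | q.2 = j}).map Prod.fst ≪ volume)
    -- the posterior probabilities almost surely differ
    (hdiag : P.map Prod.fst {x | classPosterior P 0 x = classPosterior P 1 x} = 0)
    -- the training data: an i.i.d. sequence with law `P`
    {Ω : Type*} [MeasurableSpace Ω] (μ : Measure Ω) [IsProbabilityMeasure μ]
    (ξ : ℕ → Ω → Attr d × Label) (hmeas : ∀ i, Measurable (ξ i))
    (hindep : iIndepFun ξ μ) (hlaw : ∀ i, μ.map (ξ i) = P)
    -- the kernel and the bandwidths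
    (K : Attr d → ℝ) (hK : IsContinuousRegularKernel K)
    (h : ℕ → ℝ) (hpos : ∀ n, 0 < h n) (hzero : Tendsto h atTop (𝓝 0))
    (hinf : Tendsto (fun n : ℕ => (n : ℝ) * h n ^ d) atTop atTop)
    -- the family of lines and the degree of the α-procedure
    (F : LineFamily) (p : ℕ) (hp : 1 ≤ p)
    -- the classifiers trained on the first `n` observations
    (g : ℕ → Ω → Attr d → Label)
    (hg : ∀ n ω, IsAlphaPotPotClassifier F p K (h n) (fun i : Fin n => ξ i ω) (g n ω)) :
    ∀ᵐ ω ∂μ, Tendsto (fun n => errorProb P (g n ω)) atTop (𝓝 (bayesErrorProb P)) := by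
  filter_upwards [ae_eventually_abs_errorProb_sub_empRisk_le hd hcont hmeas hindep hlaw hK hpos hzero
    hinf p, ae_eventually_errorProb_diagonal_le hcont hmeas hindep hlaw hK hpos hzero hinf]
    with ω hdev hdiagonal
  rw [Metric.tendsto_nhds]
  intro ε hε
  filter_upwards [hdev (ε / 4) (by positivity), hdiagonal (ε / 4) (by positivity)] with n h1 h2
  obtain ⟨U, w, c, hrun, hgw⟩ := hg n ω
  have hw := hrun.isPlanarPolynomial
  have hle : bayesErrorProb P ≤ errorProb P (g n ω) :=
    bayesErrorProb_le (measurableSet_lt_potPot hK.continuous.measurable (h n) _ hw c) fun x => by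
      rw [hgw, thresholdRule_eq_one_iff]
      rfl
  have h3 := abs_le.1 (h1 w hw c)
  have h4 := abs_le.1 (h1 diagonalFeature (isPlanarPolynomial_diagonalFeature hp) 0)
  have h5 := hrun.empRisk_le_diagonal hp
  rw [← funext hgw] at h3
  rw [Real.dist_eq, abs_of_nonneg (sub_nonneg.2 hle)]
  -- Deviation for the chosen rule, deviation for the diagonal, and excess of the diagonal take `ε /
  -- 4` each, which keeps the inequality strict.
  linarith [h3.2, h4.1]
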